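/- Let $N>0$ and $\underline{k}=(\mathtt m,\mathtt n)\in\mathbb Z^2$ with $\mathtt m,\mathtt n>0$. For $v=(v_1,v_2)\in\mathbb R^2$ put $v^\perp=(v_2,-v_1)$, and put $\nabla^\perp=(\partial_y,-\partial_x)$, $\Omega(v)=N v_1/|v|$ for $v\neq0$, $\Omega(0)=0$, $\underline c=N\mathtt m|\underline k|^{-3}\,\underline k$. Consider the plane wave $b_\epsilon=\epsilon\sin(\underline k\cdot x)$, $\omega_\epsilon=\epsilon\frac{|\underline k|}{N}\sin(\underline k\cdot x)$, $\psi_\epsilon=\frac{\epsilon}{N|\underline k|}\sin(\underline k\cdot x)$ of the inviscid Boussinesq system and, for $\mu=(\mu_1,\mu_2)\in\mathbb R^2$, $\epsilon\in\mathbb R$, the Bloch operator of the system linearized at this wave in the frame moving with velocity $\underline c$, $$\mathcal L_{\mu,\epsilon}=\underline c\cdot(\nabla+i\mu)\,\mathbb I_2+\begin{pmatrix}-\nabla^\perp\psi_\epsilon\cdot(\nabla+i\mu) & \big(-N^2(\partial_x+i\mu_1)-\nabla b_\epsilon\cdot(\nabla^\perp+i\mu^\perp)\big)|D+\mu|^{-2}\\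 -(\partial_x+i\mu_1) & -\nabla^\perp\psi_\epsilon\cdot(\nabla+i\mu)-\nabla\omega_\epsilon\cdot(\nabla^\perp+i\mu^\perp)|D+\mu|^{-2}\end{pmatrix},$$ with domain $H^1(\mathbb T^2,\mathbb C^2)\subset L^2(\mathbb T^2,\mathbb C^2)$, $\mathbb T^2=(\mathbb R/2\pi\mathbb Z)^2$, where $L^2(\mathbb T^2,\mathbb C^2)$ carries $\langle f,g\rangle=(2\pi)^{-2}\int(f_1\bar g_1+f_2\bar g_2)\,dx$. Let $H^\ell_{\underline k}\subset H^\ell(\mathbb T^2,\mathbb C^2)$ ($\ell=0,1$) be the subspace of functions with Fourier modes in $\underline k\mathbb Z$, and $\mathscr L_{\mu,\epsilon}=\mathcal L_{\mu,\epsilon}|_{H^1_{\underline k}}:H^1_{\underline k}\to H^0_{\underline k}$. For $n\in\mathbb Z$, $\sigma=\pm$ put $$w^\sigma_{n\underline k}(\mu)=\underline c\cdot(n\underline k+\mu)+\sigma\,\Omega(n\underline k+\mu),\qquad f^\sigma_{n\underline k}=\tfrac1{\sqrt2}\begin{pmatrix}N\\-\sigma|n\underline k+\mu|\end{pmatrix}e^{in\underline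 k\cdot x}.$$ Let $\mathcal R_{\underline k}=\{0\}\cup\{\mu\neq0:\Omega(\underline k)-\Omega(\underline k+\mu)=\Omega(\mu)\}$, and let $\mathcal D_{\underline k}$ be the set of $\mu\in\mathcal R_{\underline k}$ for which there is no $\alpha>0$ with $|w^+_{\ell\underline k}(\mu)-w^+_0(\mu)|\ge\alpha$ for all $\ell\in\mathbb Z\setminus\{0\}$ and $|w^-_{\ell\underline k}(\mu)-w^-_{\underline k}(\mu)|\ge\alpha$ for all $\ell\in\mathbb Z\setminus\{1\}$. Fix $\mu\in\mathcal R_{\underline k}\setminus\mathcal D_{\underline k}$ and let $$\underline w=\underline c\cdot\mu+\Omega(\mu)=\underline c\cdot(\underline k+\mu)-\Omega(\underline k+\mu),\qquad \lambda^+=i\underline w .$$ Then $\lambda^+$ is an isolated point of the spectrum of $\mathscr L_{\mu,0}$. Let $\Gamma$ be any circle centered at $\lambda^+$, oriented counterclockwise, such that the closed disc it bounds contains no other point of the spectrum of $\mathscr L_{\mu,0}$. There is $\epsilon_0>0$ such that for $|\epsilon|<\epsilon_0$ the circle $\Gamma$ lies in the resolvent set of $\mathscr L_{\mu,\epsilon}$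 and $$P_{\mu,\epsilon}=-\frac1{2\pi i}\oint_\Gamma(\mathscr L_{\mu,\epsilon}-\lambda)^{-1}d\lambda$$ is well defined with range in $H^1_{\underline k}$. Put $\mathfrak I=P_{\mu,0}^*P_{\mu,\epsilon}^*P_{\mu,\epsilon}P_{\mu,0}$, $\mathfrak L=P_{\mu,0}^*P_{\mu,\epsilon}^*\mathscr L_{\mu,\epsilon}P_{\mu,\epsilon}P_{\mu,0}$, $f_1=f^-_{\underline k}$, $f_0=f^+_0$ and, for $i,j\in\{0,1\}$, $$\iota_{ij}(\mu,\epsilon)=\langle\mathfrak I f_i,f_j\rangle,\qquad \mathrm i\,a_{ij}(\mu,\epsilon)=\langle\mathfrak L f_i,f_j\rangle\quad(\mathrm i=\sqrt{-1}).$$ Then, for $|\epsilon|<\epsilon_0$, the $\iota_{ij}$ and $a_{ij}$ are real-valued real-analytic functions of $\epsilon$, $\iota_{01}=\iota_{10}$, and as $\epsilon\to0$ $$\iota_{11}(\mu,\epsilon)=\iota_{11}(\mu,0)+O(\epsilon^2),\quad \iota_{10}(\mu,\epsilon)=\gamma_1\epsilon+O(\epsilon^2),\quad \iota_{00}(\mu,\epsilon)=\iota_{00}(\mu,0)+O(\epsilon^2),$$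 $$a_{11}(\mu,\epsilon)=\underline w\,\iota_{11}(\mu,0)+O(\epsilon^2),\quad a_{00}(\mu,\epsilon)=\underline w\,\iota_{00}(\mu,0)+O(\epsilon^2),$$ $$a_{10}(\mu,\epsilon)=\beta_1\epsilon+O(\epsilon^2),\quad a_{01}(\mu,\epsilon)=\beta_0\epsilon+O(\epsilon^2),$$ where $\iota_{11}(\mu,0)=\frac12(N^2+|\underline k+\mu|^2)$, $\iota_{00}(\mu,0)=\frac12(N^2+|\mu|^2)$, and the real numbers $\gamma_1,\beta_1,\beta_0$, which depend only on $N,\underline k,\mu$ and not on $\Gamma$, satisfy $$\beta_1-\gamma_1\underline w=\frac18(\underline k^\perp\cdot\mu)\,\frac{(|\underline k+\mu|-|\underline k|)(|\underline k+\mu|+|\underline k|-|\mu|)(N^2+|\mu|^2)}{N|\underline k||\mu||\underline k+\mu|},$$ $$\beta_0-\gamma_1\underline w=-\frac18(\underline k^\perp\cdot\mu)\,\frac{(|\underline k|+|\mu|)(|\underline k+\mu|+|\underline k|-|\mu|)(|\underline k+\mu|^2+N^2)}{N|\underline k||\mu||\underline k+\mu|}.$$ -/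

import Mathlib

open MeasureTheory Set Filter Topology Asymptotics
open scoped ENNReal

noncomputable section

namespace InternalWave

/-! ## Function spaces on the torus `𝕋² = (ℝ / 2πℤ)²`

A point of `𝕋²` is written `x = 2πt` with `t` in Mathlib's unit torus `(ℝ / ℤ)²`.  Then
`e^{i j·x}` is `UnitAddTorus.mFourier j` and `(2π)⁻² ∫_{𝕋²} · dx` is integration against the
normalised Haar measure. -/

/-- The normalised measure `(2π)⁻² dx` on the torus. -/
abbrev torusMeasure : Measure (UnitAddTorus (Fin 2)) :=
  Measure.pi fun _ => (AddCircle.haarAddCircle : Measure UnitAddCircle)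

/-- `L²(𝕋², ℂ)` with `(f, g) = (2π)⁻² ∫ f ḡ`. -/
abbrev L2T : Type := Lp ℂ 2 torusMeasure

/-- The orthonormal basis `e^{i j·x}`, `j ∈ ℤ²`, of `L²(𝕋², ℂ)`. -/
def fourierBasis : HilbertBasis (Fin 2 → ℤ) ℂ L2T := UnitAddTorus.mFourierBasis

/-- The Fourier coefficient `f̂(j) = (2π)⁻² ∫ f(x) e^{-i j·x} dx`. -/
def coeff (f : L2T) (j : Fin 2 → ℤ) : ℂ := fourierBasis.repr f j

/-- An integer wavevector as a vector of the Euclidean plane. -/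
def vec (j : Fin 2 → ℤ) : EuclideanSpace ℝ (Fin 2) := WithLp.toLp 2 fun i => (j i : ℝ)

/-- `v^⊥ = (v₂, -v₁)`. -/
def perp (v : EuclideanSpace ℝ (Fin 2)) : EuclideanSpace ℝ (Fin 2) := !₂[v 1, -v 0]

lemma coeff_add (f g : L2T) (j : Fin 2 → ℤ) : coeff (f + g) j = coeff f j + coeff g j := by
  simp [coeff]

lemma coeff_smul (c : ℂ) (f : L2T) (j : Fin 2 → ℤ) : coeff (c • f) j = c * coeff f j := by
  simp [coeff]

/-- The Fourier multiplier with symbol `s`, on its maximal domain in `L²(𝕋², ℂ)`. -/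
def multiplier (s : (Fin 2 → ℤ) → ℂ) : L2T →ₗ.[ℂ] L2T where
  domain :=
    { carrier := {f | Memℓp (fun j => s j * coeff f j) 2}
      zero_mem' := by
        have h : (fun j => s j * coeff (0 : L2T) j) = 0 := by
          funext j; simp [coeff]
        simp only [mem_ofPred_eq, h]
        exact zero_memℓp
      add_mem' := by
        intro f g hf hg
        have h : (fun j => s j * coeff (f + g) j)
            = (fun j => s j * coeff f j) + fun j => s j * coeff g j := by
          funext j; simp [coeff_add, mul_add]
        simp only [mem_ofPred_eq, h]
        exact hf.add hg
      smul_mem' := by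
        intro c f hf
        have h : (fun j => s j * coeff (c • f) j) = c • fun j => s j * coeff f j := by
          funext j; simp only [coeff_smul, Pi.smul_apply, smul_eq_mul]; ring
        simp only [mem_ofPred_eq, h]
        exact hf.const_smul c }
  toFun :=
    { toFun := fun f => fourierBasis.repr.symm ⟨fun j => s j * coeff f j, f.2⟩
      map_add' := by
        intro f g
        rw [← map_add]
        congr 1
        ext j
        change s j * coeff ((f : L2T) + (g : L2T)) j = s j * coeff f j + s j * coeff g j
        rw [coeff_add, mul_add]
      map_smul' := by
        intro c f
        rw [RingHom.id_apply, ← map_smul]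
        congr 1
        ext j
        change s j * coeff (c • (f : L2T)) j = c * (s j * coeff f j)
        rw [coeff_smul]
        ring }

lemma coeff_multiplier (s : (Fin 2 → ℤ) → ℂ) (f : (multiplier s).domain) (j : Fin 2 → ℤ) :
    coeff (multiplier s f) j = s j * coeff f j := by
  change fourierBasis.repr (fourierBasis.repr.symm _) j = _
  simp

/-- `H¹(𝕋², ℂ)`: the `f ∈ L²` with `∑ (1 + |j|²) |f̂(j)|² < ∞`. -/
def H1 : Submodule ℂ L2T := (multiplier fun j => ((√(1 + ‖vec j‖ ^ 2) : ℝ) : ℂ)).domain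

/-- A Fourier multiplier of order one is defined on `H¹`. -/
lemma H1_le_domain (s : (Fin 2 → ℤ) → ℂ) (C : ℝ) (hs : ∀ j, ‖s j‖ ≤ C * √(1 + ‖vec j‖ ^ 2)) :
    H1 ≤ (multiplier s).domain := by
  intro f hf
  have hf' : Memℓp (fun j => ((√(1 + ‖vec j‖ ^ 2) : ℝ) : ℂ) * coeff f j) 2 := hf
  refine (hf'.const_smul (C : ℂ)).mono' fun j => ?_
  have h0 := Real.sqrt_nonneg (1 + ‖vec j‖ ^ 2)
  have h1 : 0 ≤ C * √(1 + ‖vec j‖ ^ 2) := (norm_nonneg _).trans (hs j)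
  have h2 : C * √(1 + ‖vec j‖ ^ 2) ≤ |C| * √(1 + ‖vec j‖ ^ 2) :=
    mul_le_mul_of_nonneg_right (le_abs_self C) h0
  simp only [Pi.smul_apply, smul_eq_mul, norm_mul, Complex.norm_real, Real.norm_eq_abs,
    abs_of_nonneg h0]
  rw [← mul_assoc]
  exact mul_le_mul_of_nonneg_right ((hs j).trans h2) (norm_nonneg _)

lemma abs_coord_le (v : EuclideanSpace ℝ (Fin 2)) (i : Fin 2) : |v i| ≤ ‖v‖ := by
  simpa using PiLp.norm_apply_le v i

lemma norm_dSymbol_le (μ : EuclideanSpace ℝ (Fin 2)) (i : Fin 2) (j : Fin 2 → ℤ) :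
    ‖Complex.I * (((vec j + μ) i : ℝ) : ℂ)‖ ≤ (1 + ‖μ‖) * √(1 + ‖vec j‖ ^ 2) := by
  have h1 : |(vec j + μ) i| ≤ ‖vec j‖ + ‖μ‖ := (abs_coord_le _ i).trans (norm_add_le _ _)
  have h2 : ‖vec j‖ ≤ √(1 + ‖vec j‖ ^ 2) := Real.le_sqrt_of_sq_le (by linarith)
  have h3 : 1 ≤ √(1 + ‖vec j‖ ^ 2) := Real.le_sqrt_of_sq_le (by nlinarith [sq_nonneg ‖vec j‖])
  simp only [norm_mul, Complex.norm_I, one_mul, Complex.norm_real, Real.norm_eq_abs]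
  nlinarith [norm_nonneg μ]

/-- The symbol of `∂ᵢ + i μᵢ`. -/
def dSymbol (μ : EuclideanSpace ℝ (Fin 2)) (i : Fin 2) (j : Fin 2 → ℤ) : ℂ :=
  Complex.I * (((vec j + μ) i : ℝ) : ℂ)

lemma mem_domain_dMu (μ : EuclideanSpace ℝ (Fin 2)) (i : Fin 2) (f : H1) :
    (f : L2T) ∈ (multiplier (dSymbol μ i)).domain :=
  H1_le_domain _ (1 + ‖μ‖) (norm_dSymbol_le μ i) f.2

/-- The Bloch derivative `∂ᵢ + i μᵢ : H¹ → L²`. -/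
def dMu (μ : EuclideanSpace ℝ (Fin 2)) (i : Fin 2) : H1 →ₗ[ℂ] L2T where
  toFun f := multiplier (dSymbol μ i) ⟨f, mem_domain_dMu μ i f⟩
  map_add' f g := (multiplier (dSymbol μ i)).map_add
    ⟨f, mem_domain_dMu μ i f⟩ ⟨g, mem_domain_dMu μ i g⟩
  map_smul' c f := (multiplier (dSymbol μ i)).map_smul c ⟨f, mem_domain_dMu μ i f⟩

lemma coeff_dMu (μ : EuclideanSpace ℝ (Fin 2)) (i : Fin 2) (f : H1) (j : Fin 2 → ℤ) :
    coeff (dMu μ i f) j = Complex.I * (((vec j + μ) i : ℝ) : ℂ) * coeff f j :=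
  coeff_multiplier (dSymbol μ i) ⟨f, mem_domain_dMu μ i f⟩ j

lemma finite_norm_vec_add_lt (μ : EuclideanSpace ℝ (Fin 2)) :
    {j : Fin 2 → ℤ | ‖vec j + μ‖ < 1}.Finite := by
  have hfin : (Set.Icc (fun _ : Fin 2 => -⌈1 + ‖μ‖⌉) (fun _ => ⌈1 + ‖μ‖⌉)).Finite :=
    Set.finite_Icc _ _
  refine hfin.subset fun j hj => ?_
  have hb : ∀ i, |(j i : ℝ)| ≤ 1 + ‖μ‖ := by
    intro i
    have h1 : |(j i : ℝ)| ≤ ‖vec j‖ := abs_coord_le (vec j) i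
    have h2 : ‖vec j‖ ≤ ‖vec j + μ‖ + ‖μ‖ := by
      simpa using norm_sub_le (vec j + μ) μ
    have h3 : ‖vec j + μ‖ < 1 := hj
    linarith
  have hc : (1 + ‖μ‖ : ℝ) ≤ (⌈1 + ‖μ‖⌉ : ℤ) := Int.le_ceil _
  constructor
  · intro i
    have := (abs_le.mp ((hb i).trans hc)).1
    change -⌈1 + ‖μ‖⌉ ≤ j i
    exact_mod_cast this
  · intro i
    have := (abs_le.mp ((hb i).trans hc)).2
    change j i ≤ ⌈1 + ‖μ‖⌉
    exact_mod_cast this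

lemma exists_invLaplaceBound (μ : EuclideanSpace ℝ (Fin 2)) :
    ∃ C : ℝ, ∀ j : Fin 2 → ℤ, √(1 + ‖vec j‖ ^ 2) * (‖vec j + μ‖ ^ 2)⁻¹ ≤ C := by
  obtain ⟨C₀, hC₀⟩ := ((finite_norm_vec_add_lt μ).image
    fun j => √(1 + ‖vec j‖ ^ 2) * (‖vec j + μ‖ ^ 2)⁻¹).bddAbove
  refine ⟨max C₀ (2 + ‖μ‖), fun j => ?_⟩
  by_cases hj : ‖vec j + μ‖ < 1
  · exact le_max_of_le_left (hC₀ ⟨j, hj, rfl⟩)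
  · refine le_max_of_le_right ?_
    push Not at hj
    have h2 : ‖vec j‖ ≤ ‖vec j + μ‖ + ‖μ‖ := by
      simpa using norm_sub_le (vec j + μ) μ
    have h3 : √(1 + ‖vec j‖ ^ 2) ≤ 1 + ‖vec j‖ := by
      rw [Real.sqrt_le_left (by positivity)]
      nlinarith [norm_nonneg (vec j)]
    rw [← div_eq_mul_inv, div_le_iff₀ (by positivity)]
    nlinarith [norm_nonneg μ, mul_nonneg (norm_nonneg μ) (sub_nonneg.mpr hj)]

/-- The symbol of `|D + μ|⁻²`. -/
def invLapSymbol (μ : EuclideanSpace ℝ (Fin 2)) (j : Fin 2 → ℤ) : ℂ :=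
  (((‖vec j + μ‖ ^ 2)⁻¹ : ℝ) : ℂ)

lemma norm_invLapSymbol (μ : EuclideanSpace ℝ (Fin 2)) (j : Fin 2 → ℤ) :
    ‖invLapSymbol μ j‖ = (‖vec j + μ‖ ^ 2)⁻¹ := by
  rw [invLapSymbol, Complex.norm_real, Real.norm_eq_abs, abs_of_nonneg (by positivity)]

lemma mem_domain_invLap (μ : EuclideanSpace ℝ (Fin 2)) (f : L2T) :
    f ∈ (multiplier (invLapSymbol μ)).domain := by
  obtain ⟨C, hC⟩ := exists_invLaplaceBound μ
  have hf : Memℓp (fun j => coeff f j) 2 := (fourierBasis.repr f).2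
  refine (hf.const_smul (C : ℂ)).mono' fun j => ?_
  have h1 : 1 ≤ √(1 + ‖vec j‖ ^ 2) := Real.le_sqrt_of_sq_le (by nlinarith [sq_nonneg ‖vec j‖])
  have h2 : (‖vec j + μ‖ ^ 2)⁻¹ ≤ |C| :=
    (le_mul_of_one_le_left (by positivity) h1).trans ((hC j).trans (le_abs_self C))
  simp only [Pi.smul_apply, smul_eq_mul, norm_mul, Complex.norm_real, Real.norm_eq_abs,
    norm_invLapSymbol]
  exact mul_le_mul_of_nonneg_right h2 (norm_nonneg _)

lemma invLap_mem_H1 (μ : EuclideanSpace ℝ (Fin 2)) (f : (multiplier (invLapSymbol μ)).domain) :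
    multiplier (invLapSymbol μ) f ∈ H1 := by
  obtain ⟨C, hC⟩ := exists_invLaplaceBound μ
  have hf : Memℓp (fun j => coeff (f : L2T) j) 2 := (fourierBasis.repr (f : L2T)).2
  change Memℓp (fun j => ((√(1 + ‖vec j‖ ^ 2) : ℝ) : ℂ) * coeff (multiplier _ f) j) 2
  refine (hf.const_smul (C : ℂ)).mono' fun j => ?_
  have h0 := Real.sqrt_nonneg (1 + ‖vec j‖ ^ 2)
  rw [coeff_multiplier]
  simp only [Pi.smul_apply, smul_eq_mul, norm_mul, Complex.norm_real, Real.norm_eq_abs,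
    abs_of_nonneg h0, norm_invLapSymbol]
  rw [← mul_assoc]
  exact mul_le_mul_of_nonneg_right ((hC j).trans (le_abs_self C)) (norm_nonneg _)

/-- `|D + μ|⁻² : L² → H¹`, the inverse of `-Δ` conjugated by `e^{iμ·x}`.  A mode `j` with
`j + μ = 0` is sent to `0`. -/
def invLap (μ : EuclideanSpace ℝ (Fin 2)) : L2T →ₗ[ℂ] H1 where
  toFun f := ⟨multiplier (invLapSymbol μ) ⟨f, mem_domain_invLap μ f⟩, invLap_mem_H1 μ _⟩
  map_add' f g := Subtype.ext
    ((multiplier (invLapSymbol μ)).map_add ⟨f, mem_domain_invLap μ f⟩ ⟨g, mem_domain_invLap μ g⟩)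
  map_smul' c f := Subtype.ext
    ((multiplier (invLapSymbol μ)).map_smul c ⟨f, mem_domain_invLap μ f⟩)

lemma coeff_invLap (μ : EuclideanSpace ℝ (Fin 2)) (f : L2T) (j : Fin 2 → ℤ) :
    coeff (invLap μ f : L2T) j = (((‖vec j + μ‖ ^ 2)⁻¹ : ℝ) : ℂ) * coeff f j :=
  coeff_multiplier _ _ _

/-- The function `cos (k·x)` on the torus, as the real part of `e^{i k·x}`. -/
def cosWave (k : Fin 2 → ℤ) : C(UnitAddTorus (Fin 2), ℂ) where
  toFun x := ((UnitAddTorus.mFourier k x).re : ℂ)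
  continuous_toFun := by fun_prop

lemma memLp_cosWave_mul (k : Fin 2 → ℤ) (f : L2T) :
    MemLp (fun x => cosWave k x * f x) 2 torusMeasure := by
  refine (Lp.memLp f).of_le_mul (c := ‖cosWave k‖)
    ((cosWave k).continuous.aestronglyMeasurable.mul (Lp.memLp f).1)
    (Eventually.of_forall fun x => ?_)
  rw [norm_mul]
  exact mul_le_mul_of_nonneg_right ((cosWave k).norm_coe_le_norm x) (norm_nonneg _)

/-- Multiplication by `cos (k·x)` on `L²(𝕋², ℂ)`. -/
def mulCos (k : Fin 2 → ℤ) : L2T →ₗ[ℂ] L2T where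
  toFun f := (memLp_cosWave_mul k f).toLp _
  map_add' f g := by
    rw [← MemLp.toLp_add]
    apply MemLp.toLp_congr
    filter_upwards [Lp.coeFn_add f g] with x hx
    simp only [hx, Pi.add_apply, mul_add]
  map_smul' c f := by
    rw [RingHom.id_apply, ← MemLp.toLp_const_smul]
    apply MemLp.toLp_congr
    filter_upwards [Lp.coeFn_smul c f] with x hx
    simp only [hx, Pi.smul_apply, smul_eq_mul]
    ring

lemma coeff_eq_integral (f : L2T) (j : Fin 2 → ℤ) :
    coeff f j = ∫ x, UnitAddTorus.mFourier (-j) x * f x ∂torusMeasure :=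
  UnitAddTorus.mFourierBasis_repr f j

lemma mulCos_ae (k : Fin 2 → ℤ) (f : L2T) :
    mulCos k f =ᵐ[torusMeasure] fun x => cosWave k x * f x :=
  (memLp_cosWave_mul k f).coeFn_toLp

lemma integrable_mFourier_mul (f : L2T) (j : Fin 2 → ℤ) :
    Integrable (fun x => UnitAddTorus.mFourier j x * f x) torusMeasure := by
  have hf : Integrable f torusMeasure := (Lp.memLp f).integrable (by norm_num)
  refine hf.bdd_mul (c := 1) (UnitAddTorus.mFourier j).continuous.aestronglyMeasurable
    (Eventually.of_forall fun x => ?_)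
  exact ((UnitAddTorus.mFourier j).norm_coe_le_norm x).trans UnitAddTorus.mFourier_norm.le

lemma coeff_mulCos (k : Fin 2 → ℤ) (f : L2T) (j : Fin 2 → ℤ) :
    coeff (mulCos k f) j = (1 / 2 : ℂ) * (coeff f (j - k) + coeff f (j + k)) := by
  rw [coeff_eq_integral, coeff_eq_integral, coeff_eq_integral,
    ← integral_add (integrable_mFourier_mul f _) (integrable_mFourier_mul f _),
    ← integral_const_mul]
  refine integral_congr_ae ?_
  filter_upwards [mulCos_ae k f] with x hx
  have h1 : cosWave k x
      = (1 / 2 : ℂ) * (UnitAddTorus.mFourier k x + UnitAddTorus.mFourier (-k) x) := by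
    change ((UnitAddTorus.mFourier k x).re : ℂ) = _
    rw [UnitAddTorus.mFourier_neg, Complex.re_eq_add_conj]
    ring
  have h2 : UnitAddTorus.mFourier (-(j - k)) x
      = UnitAddTorus.mFourier (-j) x * UnitAddTorus.mFourier k x := by
    rw [← UnitAddTorus.mFourier_add]; congr 2; abel
  have h3 : UnitAddTorus.mFourier (-(j + k)) x
      = UnitAddTorus.mFourier (-j) x * UnitAddTorus.mFourier (-k) x := by
    rw [← UnitAddTorus.mFourier_add]; congr 2; abel
  rw [hx, h1, h2, h3]
  ring

/-! ## The linearised operator -/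

/-- `X = L²(𝕋²) × L²(𝕋²)` with `⟨f, g⟩ = (2π)⁻² ∫ (f₁ ḡ₁ + f₂ ḡ₂)`; component `0` is the buoyancy
`b`, component `1` the vorticity `ω`. -/
abbrev X : Type := PiLp 2 fun _ : Fin 2 => L2T

/-- `Y = H¹(𝕋²) × H¹(𝕋²)`. -/
def Y : Submodule ℂ X where
  carrier := {f | ∀ i, f i ∈ H1}
  zero_mem' := fun _ => H1.zero_mem
  add_mem' := fun hf hg i => H1.add_mem (hf i) (hg i)
  smul_mem' := fun c _ hf i => H1.smul_mem c (hf i)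

/-- The component maps `Y → H¹`. -/
def Y.comp (i : Fin 2) : Y →ₗ[ℂ] H1 where
  toFun f := ⟨(f : X) i, f.2 i⟩
  map_add' _ _ := rfl
  map_smul' _ _ := rfl

/-- `a · (∇ + iμ) : H¹ → L²` for a constant vector `a`. -/
def dotGrad (μ a : EuclideanSpace ℝ (Fin 2)) : H1 →ₗ[ℂ] L2T :=
  ((a 0 : ℝ) : ℂ) • dMu μ 0 + ((a 1 : ℝ) : ℂ) • dMu μ 1

/-- `a · (∇^⊥ + iμ^⊥) : H¹ → L²` for a constant vector `a`, where `∇^⊥ = (∂_y, -∂_x)`. -/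
def dotGradPerp (μ a : EuclideanSpace ℝ (Fin 2)) : H1 →ₗ[ℂ] L2T :=
  ((a 0 : ℝ) : ℂ) • dMu μ 1 - ((a 1 : ℝ) : ℂ) • dMu μ 0

/-- The phase velocity `c = N k₁ |k|⁻³ k` of the primary wave. -/
def phaseVelocity (N : ℝ) (k : Fin 2 → ℤ) : EuclideanSpace ℝ (Fin 2) :=
  (N * (k 0 : ℝ) / ‖vec k‖ ^ 3) • vec k

/-- `∇^⊥ψ_ε · (∇ + iμ)` for the primary wave `ψ_ε = ε (N|k|)⁻¹ sin (k·x)`, for which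
`∇^⊥ψ_ε = ε (N|k|)⁻¹ cos (k·x) k^⊥`. -/
def advection (N : ℝ) (k : Fin 2 → ℤ) (μ : EuclideanSpace ℝ (Fin 2)) (ε : ℝ) : H1 →ₗ[ℂ] L2T :=
  ((ε * (N * ‖vec k‖)⁻¹ : ℝ) : ℂ) • (mulCos k ∘ₗ dotGrad μ (perp (vec k)))

/-- `∇b_ε · (∇^⊥ + iμ^⊥)` for the primary wave `b_ε = ε sin (k·x)`, for which
`∇b_ε = ε cos (k·x) k`. -/
def buoyancyShear (k : Fin 2 → ℤ) (μ : EuclideanSpace ℝ (Fin 2)) (ε : ℝ) : H1 →ₗ[ℂ] L2T :=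
  ((ε : ℝ) : ℂ) • (mulCos k ∘ₗ dotGradPerp μ (vec k))

/-- `∇ω_ε · (∇^⊥ + iμ^⊥)` for the primary wave `ω_ε = ε |k| N⁻¹ sin (k·x)`, for which
`∇ω_ε = ε |k| N⁻¹ cos (k·x) k`. -/
def vorticityShear (N : ℝ) (k : Fin 2 → ℤ) (μ : EuclideanSpace ℝ (Fin 2)) (ε : ℝ) :
    H1 →ₗ[ℂ] L2T :=
  ((ε * (‖vec k‖ / N) : ℝ) : ℂ) • (mulCos k ∘ₗ dotGradPerp μ (vec k))

/-- First row of `𝓛_{μ,ε}`. -/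
def opB (N : ℝ) (k : Fin 2 → ℤ) (μ : EuclideanSpace ℝ (Fin 2)) (ε : ℝ) (b ω : H1) : L2T :=
  dotGrad μ (phaseVelocity N k) b - advection N k μ ε b
    + (-(((N ^ 2 : ℝ) : ℂ) • dMu μ 0 (invLap μ ω)) - buoyancyShear k μ ε (invLap μ ω))

/-- Second row of `𝓛_{μ,ε}`. -/
def opW (N : ℝ) (k : Fin 2 → ℤ) (μ : EuclideanSpace ℝ (Fin 2)) (ε : ℝ) (b ω : H1) : L2T :=
  -dMu μ 0 b + (dotGrad μ (phaseVelocity N k) ω - advection N k μ ε ω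
    - vorticityShear N k μ ε (invLap μ ω))

/-- The Bloch operator `𝓛_{μ,ε} = e^{-iμ·x} 𝓛_ε e^{iμ·x}` with domain `Y`, where `𝓛_ε` is the
Boussinesq system linearised at the plane wave of wavevector `k` and amplitude `ε` in the frame
moving with that wave. -/
def opL (N : ℝ) (k : Fin 2 → ℤ) (μ : EuclideanSpace ℝ (Fin 2)) (ε : ℝ) : X →ₗ.[ℂ] X where
  domain := Y
  toFun :=
    { toFun := fun f => !₂[opB N k μ ε (Y.comp 0 f) (Y.comp 1 f),
        opW N k μ ε (Y.comp 0 f) (Y.comp 1 f)]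
      map_add' := by
        intro f g
        ext1 i
        fin_cases i
        · simp only [opB, map_add]
          simp
          abel
        · simp only [opW, map_add]
          simp
          abel
      map_smul' := by
        intro c f
        ext1 i
        fin_cases i
        · change opB N k μ ε (Y.comp 0 (c • f)) (Y.comp 1 (c • f))
            = c • opB N k μ ε (Y.comp 0 f) (Y.comp 1 f)
          have h : invLap μ ((c • Y.comp 1 f : H1) : L2T) = c • invLap μ (Y.comp 1 f : H1) :=
            map_smul (invLap μ) c _
          simp only [opB, map_smul, h, smul_sub, smul_add, smul_neg, smul_comm _ c]
        · change opW N k μ ε (Y.comp 0 (c • f)) (Y.comp 1 (c • f))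
            = c • opW N k μ ε (Y.comp 0 f) (Y.comp 1 f)
          have h : invLap μ ((c • Y.comp 1 f : H1) : L2T) = c • invLap μ (Y.comp 1 f : H1) :=
            map_smul (invLap μ) c _
          simp only [opW, map_smul, h, smul_sub, smul_add, smul_neg] }

/-! ## Restriction to the modes along `k` -/

/-- The `f ∈ L²(𝕋², ℂ)` with Fourier coefficients supported on `k ℤ`. -/
def lineSub (k : Fin 2 → ℤ) : Submodule ℂ L2T where
  carrier := {f | ∀ j, (∀ n : ℤ, j ≠ n • k) → coeff f j = 0}
  zero_mem' := by intro j _; simp [coeff]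
  add_mem' := by intro f g hf hg j hj; rw [coeff_add, hf j hj, hg j hj, add_zero]
  smul_mem' := by intro c f hf j hj; rw [coeff_smul, hf j hj, mul_zero]

/-- `X_k = H⁰_k`, the `f ∈ L²(𝕋², ℂ²)` with Fourier coefficients supported on `k ℤ`. -/
def Xk (k : Fin 2 → ℤ) : Submodule ℂ X where
  carrier := {f | ∀ i, f i ∈ lineSub k}
  zero_mem' := fun _ => (lineSub k).zero_mem
  add_mem' := fun hf hg i => (lineSub k).add_mem (hf i) (hg i)
  smul_mem' := fun c _ hf i => (lineSub k).smul_mem c (hf i)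

lemma continuous_coeff (j : Fin 2 → ℤ) : Continuous fun f : L2T => coeff f j := by
  have h : (fun f : L2T => coeff f j) = fun f => inner ℂ (fourierBasis j) f := by
    funext f; exact fourierBasis.repr_apply_apply f j
  rw [h]
  fun_prop

lemma isClosed_Xk (k : Fin 2 → ℤ) : IsClosed (Xk k : Set X) := by
  have h : (Xk k : Set X)
      = ⋂ (i : Fin 2) (j : Fin 2 → ℤ) (_ : ∀ n : ℤ, j ≠ n • k), {f : X | coeff (f i) j = 0} := by
    ext f
    simp only [mem_iInter, mem_ofPred_eq]
    rfl
  rw [h]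
  refine isClosed_iInter fun i => isClosed_iInter fun j => isClosed_iInter fun _ => ?_
  refine isClosed_eq ((continuous_coeff j).comp ?_) continuous_const
  exact PiLp.continuous_apply 2 _ i

instance (k : Fin 2 → ℤ) : CompleteSpace (Xk k) := (isClosed_Xk k).completeSpace_coe

lemma dMu_mem_line {k : Fin 2 → ℤ} (μ : EuclideanSpace ℝ (Fin 2)) (i : Fin 2) {f : H1}
    (hf : (f : L2T) ∈ lineSub k) : dMu μ i f ∈ lineSub k := by
  intro j hj
  rw [coeff_dMu, hf j hj, mul_zero]

lemma invLap_mem_line {k : Fin 2 → ℤ} (μ : EuclideanSpace ℝ (Fin 2)) {f : L2T}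
    (hf : f ∈ lineSub k) : (invLap μ f : L2T) ∈ lineSub k := by
  intro j hj
  rw [coeff_invLap, hf j hj, mul_zero]

lemma mulCos_mem_line {k : Fin 2 → ℤ} {f : L2T} (hf : f ∈ lineSub k) :
    mulCos k f ∈ lineSub k := by
  intro j hj
  have h1 : ∀ n : ℤ, j - k ≠ n • k := fun n h => hj (n + 1) (by
    rw [add_smul, one_smul, ← h]; abel)
  have h2 : ∀ n : ℤ, j + k ≠ n • k := fun n h => hj (n - 1) (by
    rw [sub_smul, one_smul, ← h]; abel)
  rw [coeff_mulCos, hf _ h1, hf _ h2]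
  simp

lemma dotGrad_mem_line {k : Fin 2 → ℤ} (μ a : EuclideanSpace ℝ (Fin 2)) {f : H1}
    (hf : (f : L2T) ∈ lineSub k) : dotGrad μ a f ∈ lineSub k :=
  (lineSub k).add_mem ((lineSub k).smul_mem _ (dMu_mem_line μ 0 hf))
    ((lineSub k).smul_mem _ (dMu_mem_line μ 1 hf))

lemma dotGradPerp_mem_line {k : Fin 2 → ℤ} (μ a : EuclideanSpace ℝ (Fin 2)) {f : H1}
    (hf : (f : L2T) ∈ lineSub k) : dotGradPerp μ a f ∈ lineSub k :=
  (lineSub k).sub_mem ((lineSub k).smul_mem _ (dMu_mem_line μ 1 hf))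
    ((lineSub k).smul_mem _ (dMu_mem_line μ 0 hf))

/-- `𝓛_{μ,ε}` maps `Y ∩ X_k` into `X_k`. -/
lemma opL_mem_Xk (N : ℝ) (k : Fin 2 → ℤ) (μ : EuclideanSpace ℝ (Fin 2)) (ε : ℝ)
    (f : (opL N k μ ε).domain) (hf : (f : X) ∈ Xk k) : opL N k μ ε f ∈ Xk k := by
  have h0 : ((Y.comp 0 f : H1) : L2T) ∈ lineSub k := hf 0
  have h1 : ((Y.comp 1 f : H1) : L2T) ∈ lineSub k := hf 1
  have h2 := invLap_mem_line μ h1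
  have hadv : ∀ g : H1, (g : L2T) ∈ lineSub k → advection N k μ ε g ∈ lineSub k := fun g hg =>
    (lineSub k).smul_mem _ (mulCos_mem_line (dotGrad_mem_line μ _ hg))
  intro i
  fin_cases i
  · change opB N k μ ε (Y.comp 0 f) (Y.comp 1 f) ∈ lineSub k
    exact (lineSub k).add_mem
      ((lineSub k).sub_mem (dotGrad_mem_line μ _ h0) (hadv _ h0))
      ((lineSub k).sub_mem
        ((lineSub k).neg_mem ((lineSub k).smul_mem _ (dMu_mem_line μ 0 h2)))
        ((lineSub k).smul_mem _ (mulCos_mem_line (dotGradPerp_mem_line μ _ h2))))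
  · change opW N k μ ε (Y.comp 0 f) (Y.comp 1 f) ∈ lineSub k
    exact (lineSub k).add_mem ((lineSub k).neg_mem (dMu_mem_line μ 0 h0))
      ((lineSub k).sub_mem
        ((lineSub k).sub_mem (dotGrad_mem_line μ _ h1) (hadv _ h1))
        ((lineSub k).smul_mem _ (mulCos_mem_line (dotGradPerp_mem_line μ _ h2))))

/-- `ℒ_{μ,ε} = 𝓛_{μ,ε}|_{H¹_k}`, an operator in `X_k` with domain `H¹_k = Y ∩ X_k`. -/
def opLk (N : ℝ) (k : Fin 2 → ℤ) (μ : EuclideanSpace ℝ (Fin 2)) (ε : ℝ) : Xk k →ₗ.[ℂ] Xk k where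
  domain := Y.comap (Xk k).subtype
  toFun :=
    { toFun := fun f => ⟨opL N k μ ε ⟨(f : Xk k), f.2⟩, opL_mem_Xk N k μ ε _ (f : Xk k).2⟩
      map_add' := fun f g => Subtype.ext
        ((opL N k μ ε).map_add ⟨(f : Xk k), f.2⟩ ⟨(g : Xk k), g.2⟩)
      map_smul' := fun c f => Subtype.ext
        ((opL N k μ ε).map_smul c ⟨(f : Xk k), f.2⟩) }

/-! ## Resolvents and spectral projectors of unbounded operators -/

section Spectral

variable {E : Type*} [NormedAddCommGroup E] [InnerProductSpace ℂ E] [CompleteSpace E]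

/-- `R` is the bounded inverse of `T - z : D(T) → E`. -/
def IsResolventAt (T : E →ₗ.[ℂ] E) (z : ℂ) (R : E →L[ℂ] E) : Prop :=
  (∀ g : E, ∃ h : R g ∈ T.domain, T ⟨R g, h⟩ - z • R g = g) ∧
    ∀ f : T.domain, R (T f - z • (f : E)) = f

/-- The spectrum of an unbounded operator. -/
def spec (T : E →ₗ.[ℂ] E) : Set ℂ := {z | ¬ ∃ R, IsResolventAt T z R}

open Classical in
/-- The resolvent `(T - z)⁻¹`, for `z` outside the spectrum. -/
def resolv (T : E →ₗ.[ℂ] E) (z : ℂ) : E →L[ℂ] E :=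
  if h : ∃ R, IsResolventAt T z R then h.choose else 0

/-- `-(2πi)⁻¹ ∮ (T - z)⁻¹ dz` over the counterclockwise circle of centre `c` and radius `r`. -/
def rieszProj (T : E →ₗ.[ℂ] E) (c : ℂ) (r : ℝ) : E →L[ℂ] E :=
  -((2 * (Real.pi : ℂ) * Complex.I)⁻¹ • ∮ z in C(c, r), resolv T z)

open Classical in
/-- The value `T f`, for `f` in the domain of `T`. -/
def applyOp (T : E →ₗ.[ℂ] E) (f : E) : E := if h : f ∈ T.domain then T ⟨f, h⟩ else 0

end Spectral

/-! ## Resonances -/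

/-- The dispersion relation `Ω(v) = N v₁ / |v|`, with `Ω(0) = 0`. -/
def Omega (N : ℝ) (v : EuclideanSpace ℝ (Fin 2)) : ℝ := N * v 0 / ‖v‖

/-- `w^σ_{nk}(μ) = c·(nk + μ) + σ Ω(nk + μ)` with `σ = ±1`. -/
def freq (N : ℝ) (k : Fin 2 → ℤ) (μ : EuclideanSpace ℝ (Fin 2)) (σ : ℝ) (n : ℤ) : ℝ :=
  inner ℝ (phaseVelocity N k) (vec (n • k) + μ) + σ * Omega N (vec (n • k) + μ)

/-- The resonant set `𝓡_k`. -/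
def resonantSet (N : ℝ) (k : Fin 2 → ℤ) : Set (EuclideanSpace ℝ (Fin 2)) :=
  {0} ∪ {μ | μ ≠ 0 ∧ Omega N (vec k) - Omega N (vec k + μ) = Omega N μ}

/-- The exceptional set `𝓓_k`: the resonant `μ` at which the eigenvalue
`i w^-_k(μ) = i w^+_0(μ)` is not separated from the other ones. -/
def exceptionalSet (N : ℝ) (k : Fin 2 → ℤ) : Set (EuclideanSpace ℝ (Fin 2)) :=
  {μ ∈ resonantSet N k | ¬ ∃ α > 0,
    (∀ l : ℤ, l ≠ 0 → α ≤ |freq N k μ 1 l - freq N k μ 1 0|) ∧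
    (∀ l : ℤ, l ≠ 1 → α ≤ |freq N k μ (-1) l - freq N k μ (-1) 1|)}

/-- The double eigenvalue `λ⁺ = i w^+_0(μ)`. -/
def lamPlus (N : ℝ) (k : Fin 2 → ℤ) (μ : EuclideanSpace ℝ (Fin 2)) : ℂ :=
  Complex.I * ((freq N k μ 1 0 : ℝ) : ℂ)

/-- The circle of centre `λ⁺` and radius `r` separates `{λ⁺}` from the rest of the spectrum of
`ℒ_{μ,0}`. -/
def Separates (N : ℝ) (k : Fin 2 → ℤ) (μ : EuclideanSpace ℝ (Fin 2)) (r : ℝ) : Prop :=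
  0 < r ∧ spec (opLk N k μ 0) ∩ Metric.closedBall (lamPlus N k μ) r = {lamPlus N k μ}

/-! ## The Gram matrix and the action matrix -/

lemma fourierBasis_mem_line (k : Fin 2 → ℤ) (n : ℤ) : fourierBasis (n • k) ∈ lineSub k := by
  intro j hj
  rw [coeff, fourierBasis.repr_self]
  rw [lp.single_apply, Pi.single_apply, if_neg (hj n)]

/-- `f^σ_{nk}(μ) = 2^{-1/2} (N, -σ |nk + μ|) e^{i nk·x}`. -/
def eigvec (N : ℝ) (k : Fin 2 → ℤ) (μ : EuclideanSpace ℝ (Fin 2)) (σ : ℝ) (n : ℤ) : Xk k :=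
  ⟨!₂[((N / √2 : ℝ) : ℂ) • fourierBasis (n • k),
      ((-σ * ‖vec (n • k) + μ‖ / √2 : ℝ) : ℂ) • fourierBasis (n • k)], by
    intro i
    fin_cases i
    · exact (lineSub k).smul_mem _ (fourierBasis_mem_line k n)
    · exact (lineSub k).smul_mem _ (fourierBasis_mem_line k n)⟩

/-- The unperturbed basis, indexed as the matrix entries: `1 ↦ f^-_k(μ)` and `0 ↦ f^+_0(μ)`. -/
def baseVec (N : ℝ) (k : Fin 2 → ℤ) (μ : EuclideanSpace ℝ (Fin 2)) : Fin 2 → Xk k :=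
  ![eigvec N k μ 1 0, eigvec N k μ (-1) 1]

/-- The spectral projector `P_{μ,ε}` of `ℒ_{μ,ε}`, over the circle of centre `λ⁺` and radius `r`. -/
def proj (N : ℝ) (k : Fin 2 → ℤ) (μ : EuclideanSpace ℝ (Fin 2)) (r ε : ℝ) : Xk k →L[ℂ] Xk k :=
  rieszProj (opLk N k μ ε) (lamPlus N k μ) r

/-- `𝔍(μ,ε) = P_{μ,0}^* P_{μ,ε}^* P_{μ,ε} P_{μ,0}`. -/
def gramOp (N : ℝ) (k : Fin 2 → ℤ) (μ : EuclideanSpace ℝ (Fin 2)) (r ε : ℝ) (f : Xk k) : Xk k :=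
  (proj N k μ r 0).adjoint ((proj N k μ r ε).adjoint (proj N k μ r ε (proj N k μ r 0 f)))

/-- `𝔏(μ,ε) = P_{μ,0}^* P_{μ,ε}^* ℒ_{μ,ε} P_{μ,ε} P_{μ,0}`. -/
def actionOp (N : ℝ) (k : Fin 2 → ℤ) (μ : EuclideanSpace ℝ (Fin 2)) (r ε : ℝ) (f : Xk k) :
    Xk k :=
  (proj N k μ r 0).adjoint ((proj N k μ r ε).adjoint
    (applyOp (opLk N k μ ε) (proj N k μ r ε (proj N k μ r 0 f))))

/-- `⟨𝔍(μ,ε) f_i, f_j⟩`, linear in `f_i`; for `i, j = 0, 1` these are the entries of the Gram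
matrix. -/
def gramEntry (N : ℝ) (k : Fin 2 → ℤ) (μ : EuclideanSpace ℝ (Fin 2)) (r : ℝ) (i j : Fin 2)
    (ε : ℝ) : ℂ :=
  inner ℂ (baseVec N k μ j) (gramOp N k μ r ε (baseVec N k μ i))

/-- `⟨𝔏(μ,ε) f_i, f_j⟩`, linear in `f_i`; for `i, j = 0, 1` these are the entries of the action
matrix. -/
def actionEntry (N : ℝ) (k : Fin 2 → ℤ) (μ : EuclideanSpace ℝ (Fin 2)) (r : ℝ) (i j : Fin 2)
    (ε : ℝ) : ℂ :=
  inner ℂ (baseVec N k μ j) (actionOp N k μ r ε (baseVec N k μ i))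

end InternalWave

end

open InternalWave

noncomputable section

namespace InternalWave

/-! ## Perturbation of resolvents -/

section Resolvent

variable {E : Type*} [NormedAddCommGroup E] [InnerProductSpace ℂ E]

/-! The wave enters only through transport along k^⊥ and through gradients parallel to k. On modes
nk + μ every derivative it produces has the symbol i k^⊥·(nk + μ) = i k^⊥·μ, independent of n
(`inner_perp_line`). Hence on X_k the operator is exactly ℒ_0 + εB, where B is bounded and shifts
modes by ±1 (`isBoundedPerturbation_opLk`, `pert_eigvec`).

On a circle Γ in the resolvent set of ℒ_0, the resolvent of ℒ_0 + εB is R(1 + εBR)⁻¹, an analytic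
function of ε with values in the Banach algebra C(Γ, B(X_k)). Therefore P_ε f and ℒ_ε P_ε f, the
contour integrals of R_ε f and z R_ε f, are analytic in ε. Since P_0 fixes f_0 and f_1, moving the
adjoints across turns the entries into ⟨P_ε f_i, P_ε f_j⟩ and ⟨ℒ_ε P_ε f_i, P_ε f_j⟩.

For an eigenvector f at λ⁺ the first Neumann term -RBR f collapses to -(λ⁺ - z)⁻¹ R(z) B f. With S
the reduced resolvent, residues give d/dε P_ε f = S B f and d/dε ℒ_ε P_ε f = λ⁺ S B f + P_0 B f at ε
= 0 (`hasDerivAt_rieszProj_apply`, `hasDerivAt_applyOp_rieszProj`). As B f is a sum of four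
eigenvectors in neighbouring modes, S and P_0 act on it explicitly. So a_ij has slope w times the
slope of ι_ij plus a coupling term read off from ⟨P_0 B f_i, f_j⟩. Because μ is not exceptional, P_0
B f_1 is a multiple of f_0 and P_0 B f_0 a multiple of f_1; these two coefficients are the closed
formulas. The diagonal slopes vanish by orthogonality of distinct modes.

Reality comes from conjugation J of the Fourier coefficients: ℒ_ε J = -J ℒ_ε, J f_i = f_i, and Γ is
symmetric under z ↦ -z̄, so J commutes with P_ε (`rieszProj_conj`). Separating circles exist because
ℒ_0 is block diagonal with 2×2 blocks, and a point at positive distance from all i w^±_{nk} has a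
bounded inverse built from the inverse blocks (`notMem_spec_of_separated`). -/

lemma IsResolventAt.unique {T : E →ₗ.[ℂ] E} {z : ℂ} {R R' : E →L[ℂ] E}
    (h : IsResolventAt T z R) (h' : IsResolventAt T z R') : R = R' := by
  ext g
  obtain ⟨hd, e⟩ := h.1 g
  have := h'.2 ⟨R g, hd⟩
  rw [e] at this
  exact this.symm

lemma IsResolventAt.resolv_eq {T : E →ₗ.[ℂ] E} {z : ℂ} {R : E →L[ℂ] E}
    (h : IsResolventAt T z R) : resolv T z = R := by
  have hex : ∃ R, IsResolventAt T z R := ⟨R, h⟩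
  rw [resolv, dif_pos hex]
  exact hex.choose_spec.unique h

lemma isResolventAt_resolv {T : E →ₗ.[ℂ] E} {z : ℂ} (hz : z ∉ spec T) :
    IsResolventAt T z (resolv T z) := by
  obtain ⟨R, hR⟩ := not_not.mp hz
  rwa [hR.resolv_eq]

lemma IsResolventAt.notMem_spec {T : E →ₗ.[ℂ] E} {z : ℂ} {R : E →L[ℂ] E}
    (h : IsResolventAt T z R) : z ∉ spec T := not_not.mpr ⟨R, h⟩

/-- If `T' - z' = T - z + B` with `B` bounded, the second Neumann factor gives the resolvent. -/
lemma IsResolventAt.perturb {T T' : E →ₗ.[ℂ] E} {z z' : ℂ} {R : E →L[ℂ] E}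
    (h : IsResolventAt T z R) (hdom : T'.domain = T.domain) (B : E →L[ℂ] E)
    (hT : ∀ f (hf : f ∈ T.domain) (hf' : f ∈ T'.domain),
      T' ⟨f, hf'⟩ - z' • f = T ⟨f, hf⟩ - z • f + B f)
    {V : E →L[ℂ] E} (hV : (1 + B * R) * V = 1) (hV' : V * (1 + B * R) = 1) :
    IsResolventAt T' z' (R * V) := by
  refine ⟨fun g => ?_, fun f => ?_⟩
  · obtain ⟨hd, e⟩ := h.1 (V g)
    have hd' : R (V g) ∈ T'.domain := hdom ▸ hd
    refine ⟨hd', ?_⟩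
    have := hT _ hd hd'
    change T' ⟨R (V g), hd'⟩ - z' • R (V g) = g
    rw [this, e]
    exact congrArg (fun A : E →L[ℂ] E => A g) hV
  · obtain ⟨f, hf'⟩ := f
    have hf : f ∈ T.domain := hdom ▸ hf'
    have e := h.2 ⟨f, hf⟩
    simp only at e ⊢
    rw [hT f hf hf']
    set g := T ⟨f, hf⟩ - z • f
    have hV'' : V (g + B (R g)) = g := congrArg (fun A : E →L[ℂ] E => A g) hV'
    rw [e] at hV''
    change R (V (g + B f)) = f
    rw [hV'', e]

/-- Moving the spectral parameter is itself a bounded perturbation, by the scalar -(z' - z); the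
resolvent at z' is thus R (1 - (z' - z) R)⁻¹, and inversion is continuous at 1. -/
lemma IsResolventAt.continuousAt_resolv [CompleteSpace E] {T : E →ₗ.[ℂ] E} {z : ℂ} {R : E →L[ℂ] E}
    (h : IsResolventAt T z R) : ContinuousAt (resolv T) z := by
  set u : ℂ → E →L[ℂ] E := fun z' => 1 + (-(z' - z)) • R with hu
  have hu0 : u z = ((1 : (E →L[ℂ] E)ˣ) : E →L[ℂ] E) := by simp [hu]
  have huc : ContinuousAt u z := by fun_prop
  have hev : ∀ᶠ z' in 𝓝 z, IsUnit (u z') := by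
    refine huc.eventually_mem (Units.isOpen.mem_nhds ?_)
    rw [hu0]; exact Units.isUnit _
  have hc : ContinuousAt (fun z' => R * Ring.inverse (u z')) z := by
    have h1 : ContinuousAt Ring.inverse (u z) := hu0 ▸ NormedRing.inverse_continuousAt 1
    exact continuousAt_const.mul (h1.comp huc)
  refine hc.congr ?_
  filter_upwards [hev] with z' hz'
  refine (IsResolventAt.resolv_eq (h.perturb rfl ((-(z' - z)) • 1) ?_ ?_ ?_)).symm
  · intro f hf hf'
    simp only [smul_apply, one_apply_eq_self]
    module
  · rw [smul_mul_assoc, one_mul]; exact Ring.mul_inverse_cancel _ hz'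
  · rw [smul_mul_assoc, one_mul]; exact Ring.inverse_mul_cancel _ hz'

lemma IsResolventAt.apply_eigenvector {T : E →ₗ.[ℂ] E} {z ν : ℂ} {R : E →L[ℂ] E}
    (h : IsResolventAt T z R) {e : E} (he : e ∈ T.domain) (hT : T ⟨e, he⟩ = ν • e)
    (hν : ν ≠ z) : R e = (ν - z)⁻¹ • e := by
  have h2 := h.2 ⟨e, he⟩
  simp only [hT, ← sub_smul, map_smul] at h2
  rw [eq_inv_smul_iff₀ (sub_ne_zero.mpr hν), h2]

lemma mem_spec_of_eigenvector {T : E →ₗ.[ℂ] E} {ν : ℂ} {e : E} (he0 : e ≠ 0)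
    (he : e ∈ T.domain) (hT : T ⟨e, he⟩ = ν • e) : ν ∈ spec T := by
  rintro ⟨R, hR⟩
  have h2 := hR.2 ⟨e, he⟩
  simp only [hT, sub_self, map_zero] at h2
  exact he0 h2.symm

/-- Antilinearity of J and TJ = -JT give (T + z̄) J = -J (T - z); inverting both sides yields the
relation. -/
lemma resolv_neg_conj {T : E →ₗ.[ℂ] E} (J : E →L[ℝ] E)
    (hJ : ∀ (a : ℂ) f, J (a • f) = (starRingEnd ℂ) a • J f)
    (hT : ∀ f (hf : f ∈ T.domain), ∃ hf' : J f ∈ T.domain, T ⟨J f, hf'⟩ = -J (T ⟨f, hf⟩))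
    {z : ℂ} (hz : z ∉ spec T) (hz' : -(starRingEnd ℂ) z ∉ spec T) (f : E) :
    resolv T (-(starRingEnd ℂ) z) (J f) = -J (resolv T z f) := by
  obtain ⟨hd, e⟩ := (isResolventAt_resolv hz).1 f
  obtain ⟨hd', e'⟩ := hT _ hd
  have h2 := (isResolventAt_resolv hz').2 ⟨_, hd'⟩
  simp only at h2
  have h3 : J f = -(-J (T ⟨resolv T z f, hd⟩) - -(starRingEnd ℂ) z • J (resolv T z f)) := by
    rw [neg_smul, ← hJ, sub_neg_eq_add, neg_add, neg_neg, ← sub_eq_add_neg, ← map_sub, e]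
  rw [h3, ← e', map_neg, h2]

end Resolvent

/-! ## Contour integrals over a circle -/

section Contour

variable {A : Type*} [NormedAddCommGroup A] [NormedSpace ℂ A]

lemma continuous_circle_integrand {c : ℂ} {r : ℝ} (hr : 0 ≤ r) (F : C(Metric.sphere c r, A)) :
    Continuous fun θ : ℝ => deriv (circleMap c r) θ • F ⟨circleMap c r θ,
      circleMap_mem_sphere c hr θ⟩ := by
  simp only [deriv_circleMap]
  have h : Continuous fun θ : ℝ => (⟨circleMap c r θ, circleMap_mem_sphere c hr θ⟩ :
      Metric.sphere c r) := (continuous_circleMap c r).subtype_mk _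
  exact ((continuous_circleMap 0 r).mul continuous_const).smul (F.continuous.comp h)

/-- The functional `F ↦ -(2πi)⁻¹ ∮ F(z) dz`. -/
def contour (A : Type*) [NormedAddCommGroup A] [NormedSpace ℂ A] (c : ℂ) {r : ℝ} (hr : 0 ≤ r) :
    C(Metric.sphere c r, A) →L[ℂ] A :=
  LinearMap.mkContinuous
    { toFun := fun F => -((2 * (Real.pi : ℂ) * Complex.I)⁻¹ • ∫ θ in (0 : ℝ)..2 * Real.pi,
        deriv (circleMap c r) θ • F ⟨circleMap c r θ, circleMap_mem_sphere c hr θ⟩)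
      map_add' := fun F G => by
        rw [← neg_add, ← smul_add, ← intervalIntegral.integral_add
          ((continuous_circle_integrand hr F).intervalIntegrable _ _)
          ((continuous_circle_integrand hr G).intervalIntegrable _ _)]
        simp only [ContinuousMap.add_apply, smul_add]
      map_smul' := fun a F => by
        simp only [ContinuousMap.smul_apply, RingHom.id_apply, smul_comm _ a,
          intervalIntegral.integral_smul, smul_neg] }
    -- The bound is the circumference 2πr divided by 2π.
    r fun F => by
      have hb : ∀ θ ∈ Set.uIoc (0 : ℝ) (2 * Real.pi), ‖deriv (circleMap c r) θ •
          F ⟨circleMap c r θ, circleMap_mem_sphere c hr θ⟩‖ ≤ r * ‖F‖ := fun θ _ => by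
        rw [norm_smul, deriv_circleMap, norm_mul, norm_circleMap_zero, Complex.norm_I, mul_one,
          abs_of_nonneg hr]
        exact mul_le_mul_of_nonneg_left (F.norm_coe_le_norm _) hr
      have h1 := intervalIntegral.norm_integral_le_of_norm_le_const hb
      have hpi := Real.pi_pos
      simp only [LinearMap.coe_mk, AddHom.coe_mk, norm_neg, norm_smul, norm_inv, norm_mul,
        Complex.norm_ofNat, Complex.norm_real, Real.norm_eq_abs, Complex.norm_I, mul_one]
      rw [sub_zero, abs_of_pos (by positivity : (0 : ℝ) < 2 * Real.pi)] at h1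
      rw [abs_of_pos hpi, inv_mul_le_iff₀ (by positivity)]
      linarith

lemma contour_eq {c : ℂ} {r : ℝ} (hr : 0 ≤ r) (F : C(Metric.sphere c r, A)) (G : ℂ → A)
    (h : ∀ z, F z = G z) :
    contour A c hr F = -((2 * (Real.pi : ℂ) * Complex.I)⁻¹ • ∮ z in C(c, r), G z) := by
  change -((2 * (Real.pi : ℂ) * Complex.I)⁻¹ • ∫ θ in (0 : ℝ)..2 * Real.pi,
        deriv (circleMap c r) θ • F ⟨circleMap c r θ, circleMap_mem_sphere c hr θ⟩) = _
  simp only [h, circleIntegral]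

lemma map_contour {A' : Type*} [NormedAddCommGroup A'] [NormedSpace ℂ A'] [CompleteSpace A]
    [CompleteSpace A'] (L : A →L[ℂ] A') {c : ℂ} {r : ℝ} (hr : 0 ≤ r)
    (F : C(Metric.sphere c r, A)) :
    L (contour A c hr F) = contour A' c hr ((L : C(A, A')).comp F) := by
  change L (-((2 * (Real.pi : ℂ) * Complex.I)⁻¹ • ∫ θ in (0 : ℝ)..2 * Real.pi,
        deriv (circleMap c r) θ • F ⟨circleMap c r θ, circleMap_mem_sphere c hr θ⟩)) =
    -((2 * (Real.pi : ℂ) * Complex.I)⁻¹ • ∫ θ in (0 : ℝ)..2 * Real.pi,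
        deriv (circleMap c r) θ • L (F ⟨circleMap c r θ, circleMap_mem_sphere c hr θ⟩))
  rw [map_neg, map_smul, ← ContinuousLinearMap.intervalIntegral_comp_comm _
    ((continuous_circle_integrand hr F).intervalIntegrable _ _)]
  simp only [map_smul]

/-- If `F(z) f = h(z) e` on the circle, then `(-(2πi)⁻¹ ∮ F) f = (-(2πi)⁻¹ ∮ h) e`. -/
lemma contour_apply_eq_smul {E : Type*} [NormedAddCommGroup E] [NormedSpace ℂ E]
    [CompleteSpace E] {c : ℂ} {r : ℝ} (hr : 0 ≤ r) (F : C(Metric.sphere c r, E →L[ℂ] E)) (f e : E)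
    (h : ℂ → ℂ) (hF : ∀ z, F z f = h z • e) :
    contour (E →L[ℂ] E) c hr F f
      = (-((2 * (Real.pi : ℂ) * Complex.I)⁻¹ * ∮ z in C(c, r), h z)) • e := by
  have h1 := map_contour (ContinuousLinearMap.apply ℂ E f) hr F
  rw [ContinuousLinearMap.apply_apply] at h1
  rw [h1, contour_eq hr _ (fun z => h z • e) hF, circleIntegral.integral_smul_const, neg_smul,
    smul_smul]

lemma circleIntegral_neg (h : ℂ → ℂ) (c : ℂ) (r : ℝ) :
    ∮ z in C(c, r), -h z = -∮ z in C(c, r), h z := by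
  simp only [circleIntegral, smul_neg, intervalIntegral.integral_neg]

lemma circleIntegral_inv_sub_of_notMem {c ν : ℂ} {r : ℝ} (hr : 0 < r)
    (hν : ν ∉ Metric.closedBall c r) : ∮ z in C(c, r), (ν - z)⁻¹ = 0 := by
  refine DiffContOnCl.circleIntegral_eq_zero hr.le (DifferentiableOn.diffContOnCl fun z hz => ?_)
  rw [closure_ball _ hr.ne'] at hz
  have : ν - z ≠ 0 := sub_ne_zero.mpr fun h => hν (h ▸ hz)
  exact DifferentiableAt.differentiableWithinAt (by fun_prop (disch := assumption))

open Classical in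
/-- `-(2πi)⁻¹ ∮ (ν - z)⁻¹ dz` is `1` if `ν` is the centre and `0` if `ν` is outside. -/
lemma contour_inv_sub {c ν : ℂ} {r : ℝ} (hr : 0 < r) (hν : ν = c ∨ ν ∉ Metric.closedBall c r) :
    -((2 * (Real.pi : ℂ) * Complex.I)⁻¹ * ∮ z in C(c, r), (ν - z)⁻¹)
      = if ν = c then 1 else 0 := by
  split_ifs with h
  · subst h
    have : ∀ z, (ν - z)⁻¹ = -(z - ν)⁻¹ := fun z => by rw [← inv_neg, neg_sub]
    simp only [this]
    rw [circleIntegral_neg, circleIntegral.integral_sub_center_inv _ hr.ne']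
    field_simp [Complex.two_pi_I_ne_zero]
  · rw [circleIntegral_inv_sub_of_notMem hr (hν.resolve_left h)]; simp

/-- `-(2πi)⁻¹ ∮ -(ν - z)⁻¹ (c - z)⁻¹ dz = (c - ν)⁻¹`, which reads `0` if `ν = c`. -/
lemma contour_neg_inv_sub_mul {c ν : ℂ} {r : ℝ} (hr : 0 < r)
    (hν : ν = c ∨ ν ∉ Metric.closedBall c r) :
    -((2 * (Real.pi : ℂ) * Complex.I)⁻¹ * ∮ z in C(c, r), -((ν - z)⁻¹ * (c - z)⁻¹))
      = (c - ν)⁻¹ := by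
  rw [circleIntegral_neg, mul_neg, neg_neg]
  by_cases h : ν = c
  · subst h
    -- A double pole has no residue, in agreement with the convention `0⁻¹ = 0` on the right.
    have : ∀ z, (ν - z)⁻¹ * (ν - z)⁻¹ = (z - ν) ^ (-2 : ℤ) := fun z => by
      rw [zpow_neg, ← mul_inv]; congr 1; rw [zpow_ofNat]; ring
    simp only [this]
    rw [circleIntegral.integral_sub_zpow_of_ne (by norm_num)]
    simp
  -- Here only the pole at the centre lies inside, so Cauchy's formula evaluates the holomorphic
  -- factor (z - ν)⁻¹ at c.
  · have hd : DiffContOnCl ℂ (fun z => (z - ν)⁻¹) (Metric.ball c r) := by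
      refine DifferentiableOn.diffContOnCl fun z hz => ?_
      rw [closure_ball _ hr.ne'] at hz
      have : z - ν ≠ 0 := sub_ne_zero.mpr fun h' => hν.resolve_left h (h' ▸ hz)
      exact DifferentiableAt.differentiableWithinAt (by fun_prop (disch := assumption))
    have := hd.circleIntegral_sub_inv_smul (Metric.mem_ball_self hr)
    have h2 : ∀ z, (ν - z)⁻¹ * (c - z)⁻¹ = (z - c)⁻¹ • (z - ν)⁻¹ := fun z => by
      rw [smul_eq_mul, ← neg_sub z c, ← neg_sub z ν, inv_neg, inv_neg]; ring
    simp only [h2]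
    rw [this, smul_eq_mul, inv_mul_cancel_left₀ Complex.two_pi_I_ne_zero]

end Contour
end InternalWave

end

noncomputable section
namespace InternalWave

/-! ## Riesz projectors -/

section Riesz

variable {E : Type*} [NormedAddCommGroup E] [InnerProductSpace ℂ E] [CompleteSpace E]

/-- The resolvent as a continuous function on a circle in the resolvent set. -/
def resolvOn {T : E →ₗ.[ℂ] E} {c : ℂ} {r : ℝ} (h : Disjoint (spec T) (Metric.sphere c r)) :
    C(Metric.sphere c r, E →L[ℂ] E) where
  toFun z := resolv T z
  continuous_toFun := continuous_iff_continuousAt.2 fun z =>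
    (isResolventAt_resolv (h.notMem_of_mem_right z.2)).continuousAt_resolv.comp
      continuous_subtype_val.continuousAt

/-- The scalar function `z` on a circle. -/
def scalarOn (E : Type*) [NormedAddCommGroup E] [InnerProductSpace ℂ E] (c : ℂ) (r : ℝ) :
    C(Metric.sphere c r, E →L[ℂ] E) where
  toFun z := (z : ℂ) • 1
  continuous_toFun := by fun_prop

lemma circleIntegrable_resolv {T : E →ₗ.[ℂ] E} {c : ℂ} {r : ℝ} (hr : 0 ≤ r)
    (h : Disjoint (spec T) (Metric.sphere c r)) : CircleIntegrable (resolv T) c r := by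
  refine ContinuousOn.circleIntegrable hr fun z hz => ?_
  exact (isResolventAt_resolv
    (h.notMem_of_mem_right hz)).continuousAt_resolv.continuousWithinAt

lemma rieszProj_eq_contour {T : E →ₗ.[ℂ] E} {c : ℂ} {r : ℝ} (hr : 0 ≤ r)
    (h : Disjoint (spec T) (Metric.sphere c r)) :
    rieszProj T c r = contour (E →L[ℂ] E) c hr (resolvOn h) :=
  (contour_eq hr _ _ fun _ => rfl).symm

lemma rieszProj_apply {T : E →ₗ.[ℂ] E} {c : ℂ} {r : ℝ} (hr : 0 ≤ r)
    (h : Disjoint (spec T) (Metric.sphere c r)) (f : E) :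
    rieszProj T c r f = -((2 * (Real.pi : ℂ) * Complex.I)⁻¹ • ∮ z in C(c, r), resolv T z f) := by
  rw [rieszProj_eq_contour hr h]
  have h1 := map_contour (ContinuousLinearMap.apply ℂ E f) hr (resolvOn h)
  rw [ContinuousLinearMap.apply_apply] at h1
  rw [h1]
  exact contour_eq hr _ _ fun _ => rfl

/-- By Cauchy's theorem the identity in T R(z) = 1 + z R(z) contributes nothing to T P. -/
lemma contour_one (c : ℂ) {r : ℝ} (hr : 0 ≤ r) : contour (E →L[ℂ] E) c hr 1 = 0 := by
  rw [contour_eq hr _ (fun _ => 1) fun _ => rfl,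
    DiffContOnCl.circleIntegral_eq_zero hr diffContOnCl_const, smul_zero, neg_zero]

/-- The Riesz projector maps into the domain, and `T P = -(2πi)⁻¹ ∮ z (T - z)⁻¹ dz`. -/
lemma rieszProj_mem_domain {T : E →ₗ.[ℂ] E} {c : ℂ} {r : ℝ} (hr : 0 ≤ r)
    (h : Disjoint (spec T) (Metric.sphere c r)) (f : E) :
    ∃ hd : rieszProj T c r f ∈ T.domain, T ⟨rieszProj T c r f, hd⟩ =
      contour (E →L[ℂ] E) c hr (scalarOn E c r * resolvOn h) f := by
  have hz₀ : c + r ∈ Metric.sphere c r := by simp [abs_of_nonneg hr]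
  set z₀ : ℂ := c + r
  set R₀ := resolv T z₀
  have hR₀ : IsResolventAt T z₀ R₀ := isResolventAt_resolv (h.notMem_of_mem_right hz₀)
  -- Any z₀ on the circle would serve. From R(z) = R₀ (1 + (z - z₀) R(z)), integration gives P = R₀
  -- S, so the range of P lies in that of R₀, hence in the domain. This avoids moving the unbounded
  -- T through the integral.
  set S : E →L[ℂ] E := contour (E →L[ℂ] E) c hr (scalarOn E c r * resolvOn h)
    - z₀ • rieszProj T c r
  have hS : rieszProj T c r = R₀ * S := by
    have h1 : resolvOn h = ContinuousMap.const _ R₀ *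
        (1 + scalarOn E c r * resolvOn h - z₀ • resolvOn h) := by
      ext z g
      change resolv T z g = R₀ (g + (z : ℂ) • resolv T z g - z₀ • resolv T z g)
      obtain ⟨hd, e⟩ := (isResolventAt_resolv (h.notMem_of_mem_right z.2)).1 g
      have h2 := hR₀.2 ⟨_, hd⟩
      simp only at h2
      have h3 : T ⟨resolv T z g, hd⟩ = g + (z : ℂ) • resolv T z g := sub_eq_iff_eq_add.mp e
      rw [← h3, h2]
    have h3 : S = contour (E →L[ℂ] E) c hr
        (1 + scalarOn E c r * resolvOn h - z₀ • resolvOn h) := by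
      rw [map_sub, map_add, map_smul, contour_one, zero_add, ← rieszProj_eq_contour]
    have h4 := map_contour (ContinuousLinearMap.mul ℂ (E →L[ℂ] E) R₀) hr
        (1 + scalarOn E c r * resolvOn h - z₀ • resolvOn h)
    rw [← h3] at h4
    change R₀ * S = _ at h4
    rw [h4, rieszProj_eq_contour hr h]
    congr 1
  have hf : rieszProj T c r f = R₀ (S f) := by rw [hS]; rfl
  obtain ⟨hd, e⟩ := hR₀.1 (S f)
  have hd' : rieszProj T c r f ∈ T.domain := by rw [hf]; exact hd
  refine ⟨hd', ?_⟩
  have he : T ⟨rieszProj T c r f, hd'⟩ = T ⟨R₀ (S f), hd⟩ := by congr 1; exact Subtype.ext hf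
  rw [he, sub_eq_iff_eq_add.mp e, ← hf]
  simp [S]

lemma applyOp_rieszProj {T : E →ₗ.[ℂ] E} {c : ℂ} {r : ℝ} (hr : 0 ≤ r)
    (h : Disjoint (spec T) (Metric.sphere c r)) (f : E) :
    applyOp T (rieszProj T c r f) =
      contour (E →L[ℂ] E) c hr (scalarOn E c r * resolvOn h) f := by
  obtain ⟨hd, e⟩ := rieszProj_mem_domain hr h f
  rw [applyOp, dif_pos hd, e]

/-! ## Conjugation symmetry -/

/-- The reflection z ↦ -z̄ preserves the circle and acts on angles as θ ↦ π - θ. The minus sign in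
`resolv_neg_conj` cancels the one from conjugating (2πi)⁻¹. -/
lemma rieszProj_conj {T : E →ₗ.[ℂ] E} (J : E →L[ℝ] E)
    (hJ : ∀ (a : ℂ) f, J (a • f) = (starRingEnd ℂ) a • J f)
    (hT : ∀ f (hf : f ∈ T.domain), ∃ hf' : J f ∈ T.domain, T ⟨J f, hf'⟩ = -J (T ⟨f, hf⟩))
    {c : ℂ} {r : ℝ} (hr : 0 ≤ r) (h : Disjoint (spec T) (Metric.sphere c r))
    (hc : -(starRingEnd ℂ) c = c) (f : E) :
    rieszProj T c r (J f) = J (rieszProj T c r f) := by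
  have h0 : ∀ θ : ℝ, -(starRingEnd ℂ) (circleMap 0 r θ) = circleMap 0 r (Real.pi - θ) := by
    intro θ
    simp only [circleMap, zero_add, map_mul, Complex.conj_ofReal, ← Complex.exp_conj,
      Complex.conj_I]
    push_cast
    rw [sub_mul, Complex.exp_sub, Complex.exp_pi_mul_I, mul_neg, Complex.exp_neg]
    ring
  have h1 : ∀ θ : ℝ, -(starRingEnd ℂ) (circleMap c r θ) = circleMap c r (Real.pi - θ) := by
    intro θ
    have e : ∀ φ, circleMap c r φ = c + circleMap 0 r φ := fun φ => by simp [circleMap]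
    rw [e, e, map_add, neg_add, hc, h0]
  have hs : ∀ θ, circleMap c r θ ∉ spec T := fun θ =>
    h.notMem_of_mem_right (circleMap_mem_sphere c hr θ)
  set G : ℝ → E := fun θ => deriv (circleMap c r) θ • resolv T (circleMap c r θ) (J f) with hG
  have hint : ∀ g : E, Continuous fun θ : ℝ => deriv (circleMap c r) θ •
      resolv T (circleMap c r θ) g := fun g =>
    continuous_circle_integrand hr
      (((ContinuousLinearMap.apply ℂ E g : (E →L[ℂ] E) →L[ℂ] E) : C(E →L[ℂ] E, E)).comp
        (resolvOn h))
  have h2 : J (∮ z in C(c, r), resolv T z f) = -∮ z in C(c, r), resolv T z (J f) := by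
    have h3 : J (∮ z in C(c, r), resolv T z f) = ∫ θ in (0 : ℝ)..2 * Real.pi,
        J (deriv (circleMap c r) θ • resolv T (circleMap c r θ) f) :=
      (ContinuousLinearMap.intervalIntegral_comp_comm J
        ((hint f).intervalIntegrable _ _)).symm
    have h4 : ∀ θ, J (deriv (circleMap c r) θ • resolv T (circleMap c r θ) f)
        = -G (Real.pi - θ) := by
      intro θ
      have h5 := resolv_neg_conj J hJ hT (hs θ) (by rw [h1]; exact hs _) f
      rw [h1] at h5
      rw [hJ, hG]
      simp only [h5, smul_neg, neg_neg, deriv_circleMap, ← h0, map_mul, Complex.conj_I]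
      congr 1
      ring
    rw [h3]
    simp only [h4]
    rw [intervalIntegral.integral_neg, intervalIntegral.integral_comp_sub_left (fun θ => G θ)]
    -- The substitution θ ↦ π - θ leaves an integral over [-π, π]; periodicity moves it back to [0,
    -- 2π].
    have hper : Function.Periodic G (2 * Real.pi) := fun θ => by
      simp only [hG, deriv_circleMap, periodic_circleMap c r θ, periodic_circleMap 0 r θ]
    have h6 := hper.intervalIntegral_add_eq (-Real.pi) 0
    have e1 : -Real.pi + 2 * Real.pi = Real.pi - 0 := by ring
    have e2 : -Real.pi = Real.pi - 2 * Real.pi := by ring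
    rw [e1, e2, zero_add] at h6
    rw [h6]
    rfl
  rw [rieszProj_apply hr h, rieszProj_apply hr h, map_neg, hJ, h2]
  simp only [map_inv₀, map_mul, Complex.conj_ofReal, Complex.conj_I, Complex.conj_ofNat, mul_neg,
    inv_neg, neg_smul, smul_neg, neg_neg]

/-! ## Analyticity of the Riesz projector under a bounded perturbation -/

section Neumann

variable {A : Type*} [NormedRing A] [NormedAlgebra ℂ A] [CompleteSpace A]

/-- `R (1 + ζ B R)⁻¹`. -/
def neumann (R B : A) (ζ : ℂ) : A := R * Ring.inverse (1 + ζ • (B * R))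

lemma isUnit_one_add_smul {R B : A} {ζ : ℂ} (h : ‖ζ‖ < (‖B * R‖ + 1)⁻¹) :
    IsUnit (1 + ζ • (B * R)) := by
  rw [← sub_neg_eq_add]
  refine isUnit_one_sub_of_norm_lt_one ?_
  rw [norm_neg, norm_smul]
  have h0 := norm_nonneg (B * R)
  have h1 : ‖ζ‖ * (‖B * R‖ + 1) < 1 := by rwa [← lt_div_iff₀ (by positivity), one_div]
  nlinarith [norm_nonneg ζ]

lemma analyticAt_neumann {R B : A} {ζ : ℂ} (h : IsUnit (1 + ζ • (B * R))) :
    AnalyticAt ℂ (neumann R B) ζ := by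
  have h1 : AnalyticAt ℂ (fun ζ : ℂ => 1 + ζ • (B * R)) ζ :=
    analyticAt_const.add (analyticAt_id.smul analyticAt_const)
  obtain ⟨u, hu⟩ := h
  have h2 : AnalyticAt ℂ Ring.inverse (1 + ζ • (B * R)) := hu ▸ analyticAt_inverse u
  exact analyticAt_const.mul (AnalyticAt.comp (f := fun ζ : ℂ => 1 + ζ • (B * R)) h2 h1)

lemma hasDerivAt_neumann (R B : A) : HasDerivAt (neumann R B) (-(R * B * R)) 0 := by
  have h1 : HasDerivAt (fun ζ : ℂ => 1 + ζ • (B * R)) (B * R) 0 := by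
    simpa using ((hasDerivAt_id (0 : ℂ)).smul_const (B * R)).const_add 1
  have h2 := hasFDerivAt_ringInverse (𝕜 := ℂ) (1 : Aˣ)
  have h3 : HasDerivAt (fun ζ : ℂ => Ring.inverse (1 + ζ • (B * R))) (-(B * R)) 0 := by
    have := HasFDerivAt.comp_hasDerivAt_of_eq (x := (0 : ℂ)) h2 h1 (by simp)
    exact this.congr_deriv (by simp)
  exact (h3.const_mul R).congr_deriv (by simp [mul_assoc])

end Neumann

/-- `T' = T + B` with `B` bounded. -/
structure IsBoundedPerturbation (T T' : E →ₗ.[ℂ] E) (B : E →L[ℂ] E) : Prop where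
  domain_eq : T'.domain = T.domain
  apply_eq : ∀ f (hf : f ∈ T.domain) (hf' : f ∈ T'.domain), T' ⟨f, hf'⟩ = T ⟨f, hf⟩ + B f

/-- The inversion takes place in the algebra of continuous operator-valued functions on the circle.
Evaluation at z is multiplicative, so a single unit there supplies the resolvents at all points of
the circle at once. -/
lemma IsBoundedPerturbation.isResolventAt_neumann {T T' : E →ₗ.[ℂ] E} {B : E →L[ℂ] E} {ζ : ℂ}
    (hT : IsBoundedPerturbation T T' (ζ • B)) {c : ℂ} {r : ℝ}
    (h : Disjoint (spec T) (Metric.sphere c r))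
    (hu : IsUnit (1 + ζ • (ContinuousMap.const (Metric.sphere c r) B * resolvOn h)))
    (z : Metric.sphere c r) :
    IsResolventAt T' z (neumann (resolvOn h) (ContinuousMap.const _ B) ζ z) := by
  have hz := isResolventAt_resolv (h.notMem_of_mem_right z.2)
  refine hz.perturb hT.domain_eq (ζ • B) (fun f hf hf' => ?_) ?_ ?_
  · rw [hT.apply_eq f hf hf']; abel
  · have := congrArg (fun F : C(Metric.sphere c r, E →L[ℂ] E) => F z) (Ring.mul_inverse_cancel _ hu)
    rw [smul_mul_assoc]
    exact this
  · have := congrArg (fun F : C(Metric.sphere c r, E →L[ℂ] E) => F z) (Ring.inverse_mul_cancel _ hu)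
    rw [smul_mul_assoc]
    exact this

lemma IsBoundedPerturbation.disjoint_spec {T T' : E →ₗ.[ℂ] E} {B : E →L[ℂ] E} {ζ : ℂ}
    (hT : IsBoundedPerturbation T T' (ζ • B)) {c : ℂ} {r : ℝ}
    (h : Disjoint (spec T) (Metric.sphere c r))
    (hu : IsUnit (1 + ζ • (ContinuousMap.const (Metric.sphere c r) B * resolvOn h))) :
    Disjoint (spec T') (Metric.sphere c r) :=
  Set.disjoint_right.mpr fun z hz => (hT.isResolventAt_neumann h hu ⟨z, hz⟩).notMem_spec

lemma IsBoundedPerturbation.resolvOn_eq {T T' : E →ₗ.[ℂ] E} {B : E →L[ℂ] E} {ζ : ℂ}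
    (hT : IsBoundedPerturbation T T' (ζ • B)) {c : ℂ} {r : ℝ}
    (h : Disjoint (spec T) (Metric.sphere c r)) (h' : Disjoint (spec T') (Metric.sphere c r))
    (hu : IsUnit (1 + ζ • (ContinuousMap.const (Metric.sphere c r) B * resolvOn h))) :
    resolvOn h' = neumann (resolvOn h) (ContinuousMap.const _ B) ζ := by
  ext1 z
  exact (hT.isResolventAt_neumann h hu z).resolv_eq

end Riesz
end InternalWave

end

noncomputable section

namespace InternalWave

/-! ## First order expansion of the perturbed eigenvectors -/

/-- The power series is truncated at degree two; its first two coefficients are the value and the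
derivative. -/
lemma isBigO_sub_sub_of_hasDerivAt {φ : ℝ → ℝ} {γ : ℝ} (hφ : AnalyticAt ℝ φ 0)
    (hd : HasDerivAt φ γ 0) : (fun ε => φ ε - φ 0 - γ * ε) =O[𝓝 0] fun ε => ε ^ 2 := by
  obtain ⟨p, hp⟩ := hφ
  have h := hp.isBigO_sub_partialSum_pow 2
  have h1 : (p 1 fun _ => 1) = γ := hp.hasDerivAt.unique hd
  have h0 : (p 0 fun _ => 0) = φ 0 := hp.coeff_zero _
  have h2 : ∀ ε : ℝ, p 1 (fun _ => ε) = γ * ε := fun ε => by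
    have := (p 1).map_smul_univ (fun _ => ε) (fun _ => 1)
    simpa [h1, mul_comm] using this
  refine (h.congr (fun ε => ?_) (fun ε => ?_))
  · rw [zero_add, FormalMultilinearSeries.partialSum, Finset.sum_range_succ,
      Finset.sum_range_one, h2, ← h0, sub_sub]
    congr 3
    ext i; exact i.elim0
  · simp

section Neumann

variable {A F : Type*} [NormedRing A] [NormedAlgebra ℂ A] [CompleteSpace A]
  [NormedAddCommGroup F] [NormedSpace ℂ F]

lemma analyticAt_map_neumann (L : A →L[ℂ] F) {R B : A} {ε : ℝ}
    (h : IsUnit (1 + (ε : ℂ) • (B * R))) :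
    AnalyticAt ℝ (fun ε : ℝ => L (neumann R B ε)) ε := by
  have h1 : AnalyticAt ℂ (fun ζ : ℂ => L (neumann R B ζ)) (ε : ℂ) :=
    AnalyticAt.comp (g := L) (L.analyticAt _) (analyticAt_neumann h)
  exact AnalyticAt.comp (g := fun ζ : ℂ => L (neumann R B ζ)) (f := fun ε : ℝ => (ε : ℂ))
    h1.restrictScalars (Complex.ofRealCLM.analyticAt ε)

lemma hasDerivAt_map_neumann (L : A →L[ℂ] F) (R B : A) :
    HasDerivAt (fun ε : ℝ => L (neumann R B ε)) (L (-(R * B * R))) 0 := by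
  have h1 : HasDerivAt (fun ζ : ℂ => L (neumann R B ζ)) (L (-(R * B * R))) ((0 : ℝ) : ℂ) := by
    rw [Complex.ofReal_zero]
    exact L.hasFDerivAt.comp_hasDerivAt _ (hasDerivAt_neumann R B)
  exact (HasDerivAt.scomp (0 : ℝ) h1 (Complex.ofRealCLM.hasDerivAt (x := (0 : ℝ)))).congr_deriv
    (by simp)

end Neumann

/-! ### Contour integrals of the first Neumann term on eigenvectors -/

section Expansion

lemma ne_of_eigenvector {E : Type*} [NormedAddCommGroup E] [InnerProductSpace ℂ E]
    {T : E →ₗ.[ℂ] E} {c : ℂ} {r : ℝ} (h : Disjoint (spec T) (Metric.sphere c r)) {ν : ℂ} {e : E}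
    (he0 : e ≠ 0) (he : e ∈ T.domain) (hT : T ⟨e, he⟩ = ν • e) (z : Metric.sphere c r) :
    ν ≠ z := fun hz =>
  h.notMem_of_mem_right z.2 (hz ▸ mem_spec_of_eigenvector he0 he hT)

variable {E : Type*} [NormedAddCommGroup E] [InnerProductSpace ℂ E] [CompleteSpace E]

/-- The function `(c - z)⁻¹` on a circle with centre `c`. -/
def invCenterOn (E : Type*) [NormedAddCommGroup E] [InnerProductSpace ℂ E] (c : ℂ) {r : ℝ}
    (hr : 0 < r) : C(Metric.sphere c r, E →L[ℂ] E) where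
  toFun z := (c - (z : ℂ))⁻¹ • 1
  continuous_toFun := by
    have h : ∀ z : Metric.sphere c r, c - (z : ℂ) ≠ 0 := fun z => sub_ne_zero.mpr
      (Metric.ne_of_mem_sphere z.2 hr.ne').symm
    fun_prop (disch := exact h)

/-- `(2πi)⁻¹ ∮ (c - z)⁻¹ (T - z)⁻¹ dz`. -/
def reducedResolv {T : E →ₗ.[ℂ] E} {c : ℂ} {r : ℝ} (hr : 0 < r)
    (h : Disjoint (spec T) (Metric.sphere c r)) : E →L[ℂ] E :=
  contour (E →L[ℂ] E) c hr.le (-(invCenterOn E c hr * resolvOn h))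

/-- Evaluation at a vector passes through the integral, so a pointwise identity is enough even when
the two integrands act on different vectors. -/
lemma contour_apply_congr {c : ℂ} {r : ℝ} (hr : 0 ≤ r) (F F' : C(Metric.sphere c r, E →L[ℂ] E))
    (f f' : E) (hF : ∀ z, F z f = F' z f') :
    contour (E →L[ℂ] E) c hr F f = contour (E →L[ℂ] E) c hr F' f' := by
  have h1 := map_contour (ContinuousLinearMap.apply ℂ E f) hr F
  have h2 := map_contour (ContinuousLinearMap.apply ℂ E f') hr F'
  rw [ContinuousLinearMap.apply_apply] at h1 h2
  rw [h1, h2]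
  congr 1
  ext1 z
  exact hF z

variable {T : E →ₗ.[ℂ] E} {c : ℂ} {r : ℝ} (hr : 0 < r)
  (h : Disjoint (spec T) (Metric.sphere c r))

include hr h in
-- The resolvent acts on e as the scalar (ν - z)⁻¹, which leaves the residue of a simple pole.
lemma rieszProj_eigenvector {ν : ℂ} {e : E} (he0 : e ≠ 0) (he : e ∈ T.domain)
    (hT : T ⟨e, he⟩ = ν • e) (hν : ν = c ∨ ν ∉ Metric.closedBall c r) [Decidable (ν = c)] :
    rieszProj T c r e = (if ν = c then 1 else 0 : ℂ) • e := by
  rw [rieszProj_eq_contour hr.le h, contour_apply_eq_smul hr.le _ e e (fun z => (ν - z)⁻¹),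
    contour_inv_sub hr hν]
  · congr
  · exact fun z => (isResolventAt_resolv (h.notMem_of_mem_right z.2)).apply_eigenvector he hT
      (ne_of_eigenvector h he0 he hT z)

/-- On e the integrand is the scalar (ν - z)⁻¹ (c - z)⁻¹ up to sign. For ν = c the result is 0: the
reduced resolvent kills the eigenvectors at the centre and inverts c - T on the outer ones. -/
lemma reducedResolv_eigenvector {ν : ℂ} {e : E} (he0 : e ≠ 0) (he : e ∈ T.domain)
    (hT : T ⟨e, he⟩ = ν • e) (hν : ν = c ∨ ν ∉ Metric.closedBall c r) :
    reducedResolv hr h e = (c - ν)⁻¹ • e := by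
  rw [reducedResolv, contour_apply_eq_smul hr.le _ e e (fun z => -((ν - z)⁻¹ * (c - z)⁻¹)),
    contour_neg_inv_sub_mul hr hν]
  intro z
  have h1 := (isResolventAt_resolv (h.notMem_of_mem_right z.2)).apply_eigenvector he hT
      (ne_of_eigenvector h he0 he hT z)
  change -((c - (z : ℂ))⁻¹ • resolv T z e) = _
  rw [h1, smul_smul, neg_smul, mul_comm]

variable {f : E} (hf0 : f ≠ 0) (hf : f ∈ T.domain) (hTf : T ⟨f, hf⟩ = c • f)

include hf0 hTf in
-- The right-hand resolvent meets the eigenvector f and becomes the scalar (c - z)⁻¹.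
lemma contour_neg_resolv_mul_mul (B : E →L[ℂ] E) :
    contour (E →L[ℂ] E) c hr.le (-(resolvOn h * ContinuousMap.const _ B * resolvOn h)) f
      = reducedResolv hr h (B f) := by
  refine contour_apply_congr _ _ _ _ _ fun z => ?_
  have h1 := (isResolventAt_resolv (h.notMem_of_mem_right z.2)).apply_eigenvector hf hTf
      (ne_of_eigenvector h hf0 hf hTf z)
  change -(resolv T z (B (resolv T z f))) = -((c - (z : ℂ))⁻¹ • resolv T z (B f))
  rw [h1, map_smul, map_smul]

include hf0 hTf in
-- Writing z = c - (c - z), the weight -z (c - z)⁻¹ splits as -c (c - z)⁻¹ + 1; the 1 produces the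
-- Riesz projector.
lemma contour_scalarOn_mul_neg_resolv_mul_mul (B : E →L[ℂ] E) :
    contour (E →L[ℂ] E) c hr.le
        (scalarOn E c r * -(resolvOn h * ContinuousMap.const _ B * resolvOn h)) f
      = c • reducedResolv hr h (B f) + rieszProj T c r (B f) := by
  have h2 : c • reducedResolv hr h (B f) + rieszProj T c r (B f) =
      contour (E →L[ℂ] E) c hr.le (c • (-(invCenterOn E c hr * resolvOn h)) + resolvOn h)
        (B f) := by
    rw [map_add, map_smul, rieszProj_eq_contour hr.le h]; rfl
  rw [h2]
  refine contour_apply_congr _ _ _ _ _ fun z => ?_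
  have h1 := (isResolventAt_resolv (h.notMem_of_mem_right z.2)).apply_eigenvector hf hTf
      (ne_of_eigenvector h hf0 hf hTf z)
  have hz : c - (z : ℂ) ≠ 0 := sub_ne_zero.mpr (Metric.ne_of_mem_sphere z.2 hr.ne').symm
  change (z : ℂ) • -(resolv T z (B (resolv T z f))) =
    c • -((c - (z : ℂ))⁻¹ • resolv T z (B f)) + resolv T z (B f)
  rw [h1, map_smul, map_smul, ← sub_eq_zero]
  have h3 : (c - (z : ℂ)) * (c - (z : ℂ))⁻¹ = 1 := mul_inv_cancel₀ hz
  set g := resolv T z (B f)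
  have h4 : (z : ℂ) • -((c - (z : ℂ))⁻¹ • g) - (c • -((c - (z : ℂ))⁻¹ • g) + g)
      = ((c - (z : ℂ)) * (c - (z : ℂ))⁻¹ - 1) • g := by module
  rw [h4, h3, sub_self, zero_smul]

end Expansion

/-! ## Families `T ε = T 0 + ε B` -/

section Family

variable {E : Type*} [NormedAddCommGroup E] [InnerProductSpace ℂ E] [CompleteSpace E]
  {T : ℝ → E →ₗ.[ℂ] E} {B : E →L[ℂ] E}
  (hT : ∀ ε : ℝ, IsBoundedPerturbation (T 0) (T ε) ((ε : ℂ) • B))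
  {c : ℂ} {r : ℝ} (hr : 0 < r) (h : Disjoint (spec (T 0)) (Metric.sphere c r))

/-- Amplitudes for which the Neumann series on the circle converges. -/
def neumannRadius (B : E →L[ℂ] E) (h : Disjoint (spec (T 0)) (Metric.sphere c r)) : ℝ :=
  (‖ContinuousMap.const (Metric.sphere c r) B * resolvOn h‖ + 1)⁻¹

lemma neumannRadius_pos (B : E →L[ℂ] E) : 0 < neumannRadius B h := by
  unfold neumannRadius; positivity

lemma isUnit_of_mem_neumannRadius {ε : ℝ} (hε : ε ∈ Ioo (-neumannRadius B h) (neumannRadius B h)) :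
    IsUnit (1 + (ε : ℂ) • (ContinuousMap.const (Metric.sphere c r) B * resolvOn h)) := by
  refine isUnit_one_add_smul ?_
  rw [Complex.norm_real, Real.norm_eq_abs]
  exact abs_lt.mpr hε

include hT in
lemma disjoint_spec_of_mem {ε : ℝ} (hε : ε ∈ Ioo (-neumannRadius B h) (neumannRadius B h)) :
    Disjoint (spec (T ε)) (Metric.sphere c r) :=
  (hT ε).disjoint_spec h (isUnit_of_mem_neumannRadius h hε)

include hT in
lemma rieszProj_apply_eq_neumann (f : E) {ε : ℝ}
    (hε : ε ∈ Ioo (-neumannRadius B h) (neumannRadius B h)) :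
    rieszProj (T ε) c r f = ((ContinuousLinearMap.apply ℂ E f).comp (contour (E →L[ℂ] E) c hr.le))
      (neumann (resolvOn h) (ContinuousMap.const _ B) ε) := by
  have hd := disjoint_spec_of_mem hT h hε
  rw [rieszProj_eq_contour hr.le hd,
    (hT ε).resolvOn_eq h hd (isUnit_of_mem_neumannRadius h hε)]
  rfl

include hT in
lemma applyOp_rieszProj_eq_neumann (f : E) {ε : ℝ}
    (hε : ε ∈ Ioo (-neumannRadius B h) (neumannRadius B h)) :
    applyOp (T ε) (rieszProj (T ε) c r f) =
      (((ContinuousLinearMap.apply ℂ E f).comp (contour (E →L[ℂ] E) c hr.le)).comp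
        (ContinuousLinearMap.mul ℂ _ (scalarOn E c r)))
      (neumann (resolvOn h) (ContinuousMap.const _ B) ε) := by
  have hd := disjoint_spec_of_mem hT h hε
  rw [applyOp_rieszProj hr.le hd,
    (hT ε).resolvOn_eq h hd (isUnit_of_mem_neumannRadius h hε)]
  rfl

include hT hr in
lemma analyticAt_rieszProj_apply (f : E) {ε : ℝ}
    (hε : ε ∈ Ioo (-neumannRadius B h) (neumannRadius B h)) :
    AnalyticAt ℝ (fun ε => rieszProj (T ε) c r f) ε := by
  refine (analyticAt_map_neumann
    ((ContinuousLinearMap.apply ℂ E f).comp (contour (E →L[ℂ] E) c hr.le))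
    (isUnit_of_mem_neumannRadius h hε)).congr ?_
  filter_upwards [isOpen_Ioo.mem_nhds hε] with ε' hε'
  exact (rieszProj_apply_eq_neumann hT hr h f hε').symm

include hT hr in
lemma analyticAt_applyOp_rieszProj (f : E) {ε : ℝ}
    (hε : ε ∈ Ioo (-neumannRadius B h) (neumannRadius B h)) :
    AnalyticAt ℝ (fun ε => applyOp (T ε) (rieszProj (T ε) c r f)) ε := by
  refine (analyticAt_map_neumann
    (((ContinuousLinearMap.apply ℂ E f).comp (contour (E →L[ℂ] E) c hr.le)).comp
      (ContinuousLinearMap.mul ℂ _ (scalarOn E c r))) (isUnit_of_mem_neumannRadius h hε)).congr ?_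
  filter_upwards [isOpen_Ioo.mem_nhds hε] with ε' hε'
  exact (applyOp_rieszProj_eq_neumann hT hr h f hε').symm

lemma zero_mem_Ioo_neumannRadius (B : E →L[ℂ] E) :
    (0 : ℝ) ∈ Ioo (-neumannRadius B h) (neumannRadius B h) :=
  ⟨neg_neg_of_pos (neumannRadius_pos h B), neumannRadius_pos h B⟩

variable {f : E} (hf0 : f ≠ 0) (hf : f ∈ (T 0).domain) (hTf : T 0 ⟨f, hf⟩ = c • f)

include hT hf0 hTf in
lemma hasDerivAt_rieszProj_apply :
    HasDerivAt (fun ε => rieszProj (T ε) c r f) (reducedResolv hr h (B f)) 0 := by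
  have h1 := hasDerivAt_map_neumann
    ((ContinuousLinearMap.apply ℂ E f).comp (contour (E →L[ℂ] E) c hr.le)) (resolvOn h)
    (ContinuousMap.const _ B)
  rw [← contour_neg_resolv_mul_mul hr h hf0 hf hTf B]
  refine h1.congr_of_eventuallyEq ?_
  filter_upwards [isOpen_Ioo.mem_nhds (zero_mem_Ioo_neumannRadius h B)] with ε hε
  exact rieszProj_apply_eq_neumann hT hr h f hε

include hT hf0 hTf in
lemma hasDerivAt_applyOp_rieszProj :
    HasDerivAt (fun ε => applyOp (T ε) (rieszProj (T ε) c r f))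
      (c • reducedResolv hr h (B f) + rieszProj (T 0) c r (B f)) 0 := by
  have h1 := hasDerivAt_map_neumann
    (((ContinuousLinearMap.apply ℂ E f).comp (contour (E →L[ℂ] E) c hr.le)).comp
        (ContinuousLinearMap.mul ℂ _ (scalarOn E c r))) (resolvOn h)
    (ContinuousMap.const _ B)
  rw [← contour_scalarOn_mul_neg_resolv_mul_mul hr h hf0 hf hTf B]
  refine h1.congr_of_eventuallyEq ?_
  filter_upwards [isOpen_Ioo.mem_nhds (zero_mem_Ioo_neumannRadius h B)] with ε hε
  exact applyOp_rieszProj_eq_neumann hT hr h f hε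

end Family

/-- The inner product is conjugate linear in its first slot, so it is bilinear, and analytic, only
over ℝ. -/
lemma analyticAt_inner {E : Type*} [NormedAddCommGroup E] [InnerProductSpace ℂ E] {p q : ℝ → E}
    {ε : ℝ} (hp : AnalyticAt ℝ p ε) (hq : AnalyticAt ℝ q ε) :
    AnalyticAt ℝ (fun ε => inner ℂ (p ε) (q ε)) ε := by
  have h := (isBoundedBilinearMap_inner (𝕜 := ℂ) (E := E)).toContinuousLinearMap.analyticAt_bilinear
    (p ε, q ε)
  exact AnalyticAt.comp (f := fun ε => (p ε, q ε)) h (hp.prod hq)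

end InternalWave

end

noncomputable section

namespace InternalWave

/-! ## Fourier coordinates on `X_k` -/

lemma coeff_sub (f g : L2T) (j : Fin 2 → ℤ) : coeff (f - g) j = coeff f j - coeff g j := by
  simp [coeff]

lemma coeff_neg (f : L2T) (j : Fin 2 → ℤ) : coeff (-f) j = -coeff f j := by
  simp [coeff]

lemma L2T_ext {f g : L2T} (h : ∀ j, coeff f j = coeff g j) : f = g :=
  fourierBasis.repr.injective (lp.ext (funext h))

/-- The inner product of `X_k` as an inner product space; it takes precedence over the one that
instance search finds through Hilbert C⋆-modules. -/
instance (k : Fin 2 → ℤ) : Inner ℂ (Xk k) := InnerProductSpace.toInner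

/-- The coefficient of `e^{i nk·x}` in the component `i`. -/
def coord {k : Fin 2 → ℤ} (i : Fin 2) (n : ℤ) : Xk k →ₗ[ℂ] ℂ where
  toFun f := coeff ((f : X) i) (n • k)
  map_add' _ _ := coeff_add _ _ _
  map_smul' _ _ := coeff_smul _ _ _

lemma continuous_coord {k : Fin 2 → ℤ} (i : Fin 2) (n : ℤ) :
    Continuous (coord i n : Xk k → ℂ) :=
  (continuous_coeff _).comp ((PiLp.continuous_apply 2 _ i).comp continuous_subtype_val)

lemma Xk_ext {k : Fin 2 → ℤ} {f g : Xk k} (h : ∀ i n, coord i n f = coord i n g) : f = g := by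
  refine Subtype.ext (PiLp.ext fun i => L2T_ext fun j => ?_)
  by_cases hj : ∃ n : ℤ, j = n • k
  · obtain ⟨n, rfl⟩ := hj
    exact h i n
  · push Not at hj
    rw [f.2 i j hj, g.2 i j hj]

/-- A linear map on `X_k` with continuous coordinates is continuous. -/
lemma continuous_of_continuous_coord {k : Fin 2 → ℤ} (A : Xk k →ₗ[ℝ] Xk k)
    (h : ∀ i n, Continuous fun f => coord i n (A f)) : Continuous A := by
  -- Closed graph theorem: coordinates are continuous and separate points, so they identify the
  -- limit.
  refine A.continuous_of_seq_closed_graph fun u x y hu hy => Xk_ext fun i n => ?_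
  exact tendsto_nhds_unique (((continuous_coord i n).tendsto y).comp hy)
    (((h i n).tendsto x).comp hu)

/-- A complex linear map on `X_k` with continuous coordinates, as a bounded operator. -/
def clmOfCoord {k : Fin 2 → ℤ} (A : Xk k →ₗ[ℂ] Xk k)
    (h : ∀ i n, Continuous fun f => coord i n (A f)) : Xk k →L[ℂ] Xk k :=
  ⟨A, continuous_of_continuous_coord (A.restrictScalars ℝ) h⟩

lemma vec_zsmul (n : ℤ) (k : Fin 2 → ℤ) : vec (n • k) = (n : ℝ) • vec k := by
  ext i; simp [vec]

lemma inner_perp_self (v : EuclideanSpace ℝ (Fin 2)) : inner ℝ (perp v) v = 0 := by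
  simp [perp, PiLp.inner_apply, Fin.sum_univ_two]; ring

/-- Since k^⊥ is orthogonal to k, the component along k^⊥ is constant on the line of modes. This is
what makes the perturbation bounded on X_k, although it is of first order on the full space. -/
lemma inner_perp_line (k : Fin 2 → ℤ) (μ : EuclideanSpace ℝ (Fin 2)) (n : ℤ) :
    inner ℝ (perp (vec k)) (vec (n • k) + μ) = inner ℝ (perp (vec k)) μ := by
  rw [inner_add_right, vec_zsmul, inner_smul_right, inner_perp_self, mul_zero, zero_add]

lemma coeff_dotGrad (μ a : EuclideanSpace ℝ (Fin 2)) (f : H1) (j : Fin 2 → ℤ) :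
    coeff (dotGrad μ a f) j = Complex.I * ((inner ℝ a (vec j + μ) : ℝ) : ℂ) * coeff f j := by
  change coeff (((a 0 : ℝ) : ℂ) • dMu μ 0 f + ((a 1 : ℝ) : ℂ) • dMu μ 1 f) j = _
  rw [coeff_add, coeff_smul, coeff_smul, coeff_dMu, coeff_dMu, PiLp.inner_apply,
    Fin.sum_univ_two]
  simp only [RCLike.inner_apply, conj_trivial]
  push_cast
  ring

/-- The identity behind this is a·v^⊥ = -a^⊥·v; it brings the shear terms to the same constant
symbol as the advection. -/
lemma coeff_dotGradPerp (μ a : EuclideanSpace ℝ (Fin 2)) (f : H1) (j : Fin 2 → ℤ) :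
    coeff (dotGradPerp μ a f) j
      = -(Complex.I * ((inner ℝ (perp a) (vec j + μ) : ℝ) : ℂ) * coeff f j) := by
  change coeff (((a 0 : ℝ) : ℂ) • dMu μ 1 f - ((a 1 : ℝ) : ℂ) • dMu μ 0 f) j = _
  rw [coeff_sub, coeff_smul, coeff_smul, coeff_dMu, coeff_dMu, PiLp.inner_apply,
    Fin.sum_univ_two]
  simp only [RCLike.inner_apply, conj_trivial, perp]
  simp
  ring

lemma coeff_mulCos_line (k : Fin 2 → ℤ) (f : L2T) (n : ℤ) :
    coeff (mulCos k f) (n • k)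
      = 1 / 2 * (coeff f ((n - 1) • k) + coeff f ((n + 1) • k)) := by
  rw [coeff_mulCos, sub_smul, add_smul, one_smul]

/-- The squared wavenumber symbol `|nk + μ|⁻²`. -/
def invSq (k : Fin 2 → ℤ) (μ : EuclideanSpace ℝ (Fin 2)) (n : ℤ) : ℂ :=
  (((‖vec (n • k) + μ‖ ^ 2)⁻¹ : ℝ) : ℂ)

/-- The constant `i k^⊥·μ`. -/
def shearConst (k : Fin 2 → ℤ) (μ : EuclideanSpace ℝ (Fin 2)) : ℂ :=
  Complex.I * ((inner ℝ (perp (vec k)) μ : ℝ) : ℂ)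

/-- The mean of the two neighbouring coefficients. -/
def nbr (a : ℤ → ℂ) (n : ℤ) : ℂ := 1 / 2 * (a (n - 1) + a (n + 1))

variable (N : ℝ) (k : Fin 2 → ℤ) (μ : EuclideanSpace ℝ (Fin 2))

/-- The coordinates of `(ℒ_{μ,ε} - ℒ_{μ,0}) f / ε`. -/
def pertFun (f : Xk k) : Xk k :=
  ⟨!₂[-((shearConst k μ * (N * ‖vec k‖)⁻¹ : ℂ) • mulCos k ((f : X) 0))
        + shearConst k μ • mulCos k (invLap μ ((f : X) 1)),
      -((shearConst k μ * (N * ‖vec k‖)⁻¹ : ℂ) • mulCos k ((f : X) 1))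
        + (shearConst k μ * (‖vec k‖ / N) : ℂ) • mulCos k (invLap μ ((f : X) 1))], by
    have h2 := mulCos_mem_line (invLap_mem_line μ (f.2 1))
    intro i
    fin_cases i
    · exact (lineSub k).add_mem ((lineSub k).neg_mem ((lineSub k).smul_mem _
        (mulCos_mem_line (f.2 0)))) ((lineSub k).smul_mem _ h2)
    · exact (lineSub k).add_mem ((lineSub k).neg_mem ((lineSub k).smul_mem _
        (mulCos_mem_line (f.2 1)))) ((lineSub k).smul_mem _ h2)⟩

variable {N k μ}

lemma coord_pertFun_zero (f : Xk k) (n : ℤ) : coord 0 n (pertFun N k μ f) =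
    -(shearConst k μ * (N * ‖vec k‖)⁻¹ * nbr (fun m => coord 0 m f) n)
      + shearConst k μ * nbr (fun m => invSq k μ m * coord 1 m f) n := by
  change coeff (-((shearConst k μ * (N * ‖vec k‖)⁻¹ : ℂ) • mulCos k ((f : X) 0))
        + shearConst k μ • mulCos k (invLap μ ((f : X) 1))) (n • k) = _
  rw [coeff_add, coeff_neg, coeff_smul, coeff_smul, coeff_mulCos_line, coeff_mulCos_line,
    coeff_invLap, coeff_invLap]
  rfl

lemma coord_pertFun_one (f : Xk k) (n : ℤ) : coord 1 n (pertFun N k μ f) =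
    -(shearConst k μ * (N * ‖vec k‖)⁻¹ * nbr (fun m => coord 1 m f) n)
      + shearConst k μ * (‖vec k‖ / N) * nbr (fun m => invSq k μ m * coord 1 m f) n := by
  change coeff (-((shearConst k μ * (N * ‖vec k‖)⁻¹ : ℂ) • mulCos k ((f : X) 1))
        + (shearConst k μ * (‖vec k‖ / N) : ℂ) • mulCos k (invLap μ ((f : X) 1))) (n • k) = _
  rw [coeff_add, coeff_neg, coeff_smul, coeff_smul, coeff_mulCos_line, coeff_mulCos_line,
    coeff_invLap, coeff_invLap]
  rfl

variable (N k μ) in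
/-- The bounded operator `(ℒ_{μ,ε} - ℒ_{μ,0}) / ε` on `X_k`. -/
def pert : Xk k →L[ℂ] Xk k :=
  clmOfCoord
    { toFun := pertFun N k μ
      map_add' := fun f g => Xk_ext fun i n => by
        fin_cases i
        · simp only [Fin.zero_eta, map_add, coord_pertFun_zero, nbr]; ring
        · simp only [Fin.mk_one, map_add, coord_pertFun_one, nbr]; ring
      map_smul' := fun a f => Xk_ext fun i n => by
        fin_cases i
        · simp only [Fin.zero_eta, map_smul, coord_pertFun_zero, nbr, smul_eq_mul,
            RingHom.id_apply]; ring
        · simp only [Fin.mk_one, map_smul, coord_pertFun_one, nbr, smul_eq_mul,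
            RingHom.id_apply]; ring }
    (by
      intro i n
      have hc := fun i n => continuous_coord (k := k) i n
      fin_cases i
      · simp only [Fin.zero_eta, LinearMap.coe_mk, AddHom.coe_mk, coord_pertFun_zero, nbr]
        fun_prop
      · simp only [Fin.mk_one, LinearMap.coe_mk, AddHom.coe_mk, coord_pertFun_one, nbr]
        fun_prop)

lemma pert_apply (f : Xk k) : pert N k μ f = pertFun N k μ f := rfl

lemma coeff_opB (ε : ℝ) (b ω : H1) (n : ℤ) : coeff (opB N k μ ε b ω) (n • k) =
    Complex.I * ((inner ℝ (phaseVelocity N k) (vec (n • k) + μ) : ℝ) : ℂ) * coeff b (n • k)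
      - Complex.I * N ^ 2 * (((vec (n • k) + μ) 0 : ℝ) : ℂ) * invSq k μ n * coeff ω (n • k)
      + ε * (-(shearConst k μ * (N * ‖vec k‖)⁻¹ * nbr (fun m => coeff b (m • k)) n)
        + shearConst k μ * nbr (fun m => invSq k μ m * coeff ω (m • k)) n) := by
  have hl := inner_perp_line k μ
  simp only [opB, advection, buoyancyShear, LinearMap.smul_apply, LinearMap.comp_apply,
    coeff_add, coeff_sub, coeff_neg, coeff_smul, coeff_mulCos_line, coeff_dotGrad,
    coeff_dotGradPerp, coeff_dMu, coeff_invLap, hl, nbr, invSq, shearConst]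
  push_cast
  ring

lemma coeff_opW (ε : ℝ) (b ω : H1) (n : ℤ) : coeff (opW N k μ ε b ω) (n • k) =
    Complex.I * ((inner ℝ (phaseVelocity N k) (vec (n • k) + μ) : ℝ) : ℂ) * coeff ω (n • k)
      - Complex.I * (((vec (n • k) + μ) 0 : ℝ) : ℂ) * coeff b (n • k)
      + ε * (-(shearConst k μ * (N * ‖vec k‖)⁻¹ * nbr (fun m => coeff ω (m • k)) n)
        + shearConst k μ * (‖vec k‖ / N) * nbr (fun m => invSq k μ m * coeff ω (m • k)) n) := by
  have hl := inner_perp_line k μ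
  simp only [opW, advection, vorticityShear, LinearMap.smul_apply, LinearMap.comp_apply,
    coeff_add, coeff_sub, coeff_neg, coeff_smul, coeff_mulCos_line, coeff_dotGrad,
    coeff_dotGradPerp, coeff_dMu, coeff_invLap, hl, nbr, invSq, shearConst]
  push_cast
  ring

lemma coord_opLk_zero (ε : ℝ) (f : (opLk N k μ ε).domain) (n : ℤ) :
    coord 0 n (opLk N k μ ε f) =
      Complex.I * ((inner ℝ (phaseVelocity N k) (vec (n • k) + μ) : ℝ) : ℂ) * coord 0 n (f : Xk k)
      - Complex.I * N ^ 2 * (((vec (n • k) + μ) 0 : ℝ) : ℂ) * invSq k μ n * coord 1 n (f : Xk k)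
      + ε * coord 0 n (pertFun N k μ (f : Xk k)) := by
  rw [coord_pertFun_zero]
  exact coeff_opB ε (Y.comp 0 ⟨_, f.2⟩) (Y.comp 1 ⟨_, f.2⟩) n

lemma coord_opLk_one (ε : ℝ) (f : (opLk N k μ ε).domain) (n : ℤ) :
    coord 1 n (opLk N k μ ε f) =
      Complex.I * ((inner ℝ (phaseVelocity N k) (vec (n • k) + μ) : ℝ) : ℂ) * coord 1 n (f : Xk k)
      - Complex.I * (((vec (n • k) + μ) 0 : ℝ) : ℂ) * coord 0 n (f : Xk k)
      + ε * coord 1 n (pertFun N k μ (f : Xk k)) := by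
  rw [coord_pertFun_one]
  exact coeff_opW ε (Y.comp 0 ⟨_, f.2⟩) (Y.comp 1 ⟨_, f.2⟩) n

/-- In Fourier coordinates the operator is affine in ε, and all unbounded terms sit in the part
independent of ε. -/
lemma isBoundedPerturbation_opLk (ε : ℝ) :
    IsBoundedPerturbation (opLk N k μ 0) (opLk N k μ ε) ((ε : ℂ) • pert N k μ) where
  domain_eq := rfl
  apply_eq f hf hf' := Xk_ext fun i n => by
    have e : ((ε : ℂ) • pert N k μ) f = (ε : ℂ) • pertFun N k μ f := rfl
    rw [e]
    fin_cases i
    · simp only [Fin.zero_eta, map_add, map_smul, coord_opLk_zero, Complex.ofReal_zero,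
        smul_eq_mul]; ring
    · simp only [Fin.mk_one, map_add, map_smul, coord_opLk_one, Complex.ofReal_zero,
        smul_eq_mul]; ring

/-! ## Conjugation of the Fourier coefficients -/

/-- Conjugation of all Fourier coefficients on `L²`. -/
def conjL2 (f : L2T) : L2T := fourierBasis.repr.symm (star (fourierBasis.repr f))

lemma coeff_conjL2 (f : L2T) (j : Fin 2 → ℤ) :
    coeff (conjL2 f) j = (starRingEnd ℂ) (coeff f j) := by
  simp [coeff, conjL2]

variable (k) in
/-- Conjugation of all Fourier coefficients on `X_k`. -/
def conjXkFun (f : Xk k) : Xk k :=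
  ⟨!₂[conjL2 ((f : X) 0), conjL2 ((f : X) 1)], by
    intro i j hj
    fin_cases i
    · exact (coeff_conjL2 _ _).trans (by rw [f.2 0 j hj, map_zero])
    · exact (coeff_conjL2 _ _).trans (by rw [f.2 1 j hj, map_zero])⟩

lemma coord_conjXkFun (i : Fin 2) (n : ℤ) (f : Xk k) :
    coord i n (conjXkFun k f) = (starRingEnd ℂ) (coord i n f) := by
  fin_cases i
  · exact coeff_conjL2 _ _
  · exact coeff_conjL2 _ _

lemma conjXkFun_smul (a : ℂ) (f : Xk k) :
    conjXkFun k (a • f) = (starRingEnd ℂ) a • conjXkFun k f :=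
  Xk_ext fun i n => by simp only [coord_conjXkFun, map_smul, smul_eq_mul, map_mul]

variable (k) in
/-- Conjugation of all Fourier coefficients, as a bounded real linear operator. -/
def conjXk : Xk k →L[ℝ] Xk k :=
  let A : Xk k →ₗ[ℝ] Xk k :=
    { toFun := conjXkFun k
      map_add' := fun f g => Xk_ext fun i n => by simp only [coord_conjXkFun, map_add]
      map_smul' := fun a f => by
        have := conjXkFun_smul (a : ℂ) f
        rw [Complex.conj_ofReal] at this
        exact this }
  ⟨A, continuous_of_continuous_coord A fun i n => by
    have : ∀ f, coord i n (A f) = (starRingEnd ℂ) (coord i n f) := coord_conjXkFun i n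
    simp only [this]
    exact Complex.continuous_conj.comp (continuous_coord i n)⟩

lemma coord_conjXk (i : Fin 2) (n : ℤ) (f : Xk k) :
    coord i n (conjXk k f) = (starRingEnd ℂ) (coord i n f) := coord_conjXkFun i n f

lemma conjXk_smul (a : ℂ) (f : Xk k) : conjXk k (a • f) = (starRingEnd ℂ) a • conjXk k f :=
  conjXkFun_smul a f

lemma inner_L2T_eq_tsum (f g : L2T) :
    inner ℂ f g = ∑' j, (starRingEnd ℂ) (coeff f j) * coeff g j := by
  rw [← fourierBasis.repr.inner_map_map, lp.inner_eq_tsum]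
  simp only [RCLike.inner_apply, coeff, mul_comm]

lemma inner_conjL2 (f g : L2T) :
    inner ℂ (conjL2 f) (conjL2 g) = (starRingEnd ℂ) (inner ℂ f g) := by
  rw [inner_L2T_eq_tsum, inner_L2T_eq_tsum, Complex.conj_tsum]
  simp only [coeff_conjL2, map_mul]

lemma inner_Xk (f g : Xk k) : inner ℂ f g =
    inner ℂ ((f : X) 0) ((g : X) 0) + inner ℂ ((f : X) 1) ((g : X) 1) := by
  rw [Submodule.coe_inner, PiLp.inner_apply, Fin.sum_univ_two]

lemma inner_conjXk (f g : Xk k) :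
    inner ℂ (conjXk k f) (conjXk k g) = (starRingEnd ℂ) (inner ℂ f g) := by
  rw [inner_Xk, inner_Xk, map_add]
  exact congrArg₂ _ (inner_conjL2 _ _) (inner_conjL2 _ _)

lemma inner_Xk_smul_right (a : ℂ) (f g : Xk k) : inner ℂ f (a • g) = a * inner ℂ f g :=
  inner_smul_right (𝕜 := ℂ) (E := Xk k) f g a

lemma inner_Xk_add_right (f g h : Xk k) : inner ℂ f (g + h) = inner ℂ f g + inner ℂ f h :=
  inner_add_right (𝕜 := ℂ) (E := Xk k) f g h

lemma inner_Xk_conj_symm (f g : Xk k) : (starRingEnd ℂ) (inner ℂ g f) = inner ℂ f g :=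
  inner_conj_symm (𝕜 := ℂ) (E := Xk k) f g

lemma conjL2_mem_H1 {f : L2T} (hf : f ∈ H1) : conjL2 f ∈ H1 := by
  have hf' : Memℓp (fun j => ((√(1 + ‖vec j‖ ^ 2) : ℝ) : ℂ) * coeff f j) 2 := hf
  refine hf'.mono' fun j => ?_
  simp [coeff_conjL2]

lemma conj_invSq (n : ℤ) : (starRingEnd ℂ) (invSq k μ n) = invSq k μ n := Complex.conj_ofReal _

lemma conj_shearConst : (starRingEnd ℂ) (shearConst k μ) = -shearConst k μ := by
  simp [shearConst]

/-- `ℒ_{μ,ε}` is `i` times a real operator in Fourier coordinates. -/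
lemma opLk_conjXk (ε : ℝ) (f : Xk k) (hf : f ∈ (opLk N k μ ε).domain) :
    ∃ hf' : conjXk k f ∈ (opLk N k μ ε).domain,
      opLk N k μ ε ⟨conjXk k f, hf'⟩ = -conjXk k (opLk N k μ ε ⟨f, hf⟩) := by
  have hf' : conjXk k f ∈ (opLk N k μ ε).domain := by
    intro i
    fin_cases i
    · exact conjL2_mem_H1 (hf 0)
    · exact conjL2_mem_H1 (hf 1)
  refine ⟨hf', Xk_ext fun i n => ?_⟩
  fin_cases i
  · simp only [Fin.zero_eta, map_neg, coord_conjXk, coord_opLk_zero, coord_pertFun_zero, nbr,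
      map_add, map_sub, map_mul, map_pow, map_one, map_div₀, Complex.conj_ofReal,
      Complex.conj_I, conj_invSq, conj_shearConst, map_ofNat]
    ring
  · simp only [Fin.mk_one, map_neg, coord_conjXk, coord_opLk_one, coord_pertFun_one, nbr,
      map_add, map_sub, map_mul, map_one, map_div₀, Complex.conj_ofReal,
      Complex.conj_I, conj_invSq, conj_shearConst, map_ofNat]
    ring

end InternalWave

end

noncomputable section

namespace InternalWave

/-! ## Block diagonal operators on `X_k` -/

/-- A symbol that decays like the inverse of the H¹ weight gains one derivative; this is how a
candidate resolvent lands in the domain. -/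
lemma exists_smoothing_multiplier (s : (Fin 2 → ℤ) → ℂ) (C : ℝ)
    (hs : ∀ j, √(1 + ‖vec j‖ ^ 2) * ‖s j‖ ≤ C) :
    ∃ M : L2T →ₗ[ℂ] L2T, (∀ f, M f ∈ H1) ∧ ∀ f j, coeff (M f) j = s j * coeff f j := by
  have hmem : ∀ f : L2T, Memℓp (fun j => ((√(1 + ‖vec j‖ ^ 2) : ℝ) : ℂ) * (s j * coeff f j)) 2 := by
    intro f
    have hf : Memℓp (fun j => coeff f j) 2 := (fourierBasis.repr f).2
    refine (hf.const_smul (C : ℂ)).mono' fun j => ?_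
    simp only [Pi.smul_apply, smul_eq_mul, norm_mul, Complex.norm_real, Real.norm_eq_abs,
      abs_of_nonneg (Real.sqrt_nonneg _)]
    rw [← mul_assoc]
    exact mul_le_mul_of_nonneg_right ((hs j).trans (le_abs_self C)) (norm_nonneg _)
  have hmem' : ∀ f : L2T, Memℓp (fun j => s j * coeff f j) 2 := fun f => by
    refine (hmem f).mono' fun j => ?_
    have h1 : 1 ≤ √(1 + ‖vec j‖ ^ 2) :=
      Real.le_sqrt_of_sq_le (by nlinarith [sq_nonneg ‖vec j‖])
    rw [norm_mul ((√(1 + ‖vec j‖ ^ 2) : ℝ) : ℂ), Complex.norm_real, Real.norm_eq_abs,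
      abs_of_nonneg (Real.sqrt_nonneg _)]
    exact le_mul_of_one_le_left (norm_nonneg _) h1
  have hc : ∀ (f : L2T) j, coeff (fourierBasis.repr.symm ⟨_, hmem' f⟩) j = s j * coeff f j :=
    fun f j => by simp [coeff]
  refine ⟨{ toFun := fun f => fourierBasis.repr.symm ⟨_, hmem' f⟩
            map_add' := fun f g => L2T_ext fun j => by
              rw [coeff_add, hc, hc, hc, coeff_add, mul_add]
            map_smul' := fun a f => L2T_ext fun j => by
              rw [coeff_smul, hc, hc, coeff_smul, RingHom.id_apply]; ring }, fun f => ?_, hc⟩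
  have := hmem f
  change Memℓp (fun j => ((√(1 + ‖vec j‖ ^ 2) : ℝ) : ℂ) * coeff (fourierBasis.repr.symm _) j) 2
  simpa only [hc] using this

lemma zsmul_injective {k : Fin 2 → ℤ} (hk : 0 < k 0) :
    Function.Injective fun n : ℤ => n • k := by
  intro n m h
  have := congrFun h 0
  simp only [Pi.smul_apply, smul_eq_mul] at this
  exact mul_right_cancel₀ hk.ne' this

/-- Each of the four entries is a smoothing multiplier whose symbol is extended by zero off kℤ; k₁ >
0 makes n ↦ nk injective, so the extension takes the prescribed values. -/
lemma exists_blockDiagonal {k : Fin 2 → ℤ} (hk : 0 < k 0) (M : ℤ → Fin 2 → Fin 2 → ℂ) (C : ℝ)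
    (hM : ∀ n i j, √(1 + ‖vec (n • k)‖ ^ 2) * ‖M n i j‖ ≤ C) :
    ∃ R : Xk k →L[ℂ] Xk k, (∀ g i, ((R g : Xk k) : X) i ∈ H1) ∧
      ∀ g i n, coord i n (R g) = M n i 0 * coord 0 n g + M n i 1 * coord 1 n g := by
  have hC : 0 ≤ C := (by positivity : (0 : ℝ) ≤ _).trans (hM 0 0 0)
  have hinj := zsmul_injective hk
  have hex : ∀ i j, ∃ A : L2T →ₗ[ℂ] L2T, (∀ f, A f ∈ H1) ∧ ∀ f l, coeff (A f) l =
      Function.extend (fun n : ℤ => n • k) (fun n => M n i j) 0 l * coeff f l := by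
    refine fun i j => exists_smoothing_multiplier _ C fun l => ?_
    by_cases hl : ∃ n : ℤ, n • k = l
    · obtain ⟨n, rfl⟩ := hl
      rw [hinj.extend_apply (fun n => M n i j) 0 n]
      exact hM n i j
    · rw [Function.extend_apply' _ _ _ hl]
      simpa using hC
  choose A hA1 hA2 using hex
  have hline : ∀ i j f, f ∈ lineSub k → A i j f ∈ lineSub k := fun i j f hf l hl => by
    rw [hA2, hf l hl, mul_zero]
  let R₀ : Xk k → Xk k := fun g =>
    ⟨!₂[A 0 0 ((g : X) 0) + A 0 1 ((g : X) 1), A 1 0 ((g : X) 0) + A 1 1 ((g : X) 1)], by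
      intro i
      fin_cases i
      · exact (lineSub k).add_mem (hline _ _ _ (g.2 0)) (hline _ _ _ (g.2 1))
      · exact (lineSub k).add_mem (hline _ _ _ (g.2 0)) (hline _ _ _ (g.2 1))⟩
  have hR : ∀ g i n, coord i n (R₀ g) = M n i 0 * coord 0 n g + M n i 1 * coord 1 n g := by
    have hext : ∀ i j (n : ℤ), Function.extend (fun n : ℤ => n • k) (fun n => M n i j) 0 (n • k)
        = M n i j := fun i j n => hinj.extend_apply (fun n => M n i j) 0 n
    intro g i n
    fin_cases i
    · change coeff (A 0 0 ((g : X) 0) + A 0 1 ((g : X) 1)) (n • k) = _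
      rw [coeff_add, hA2, hA2, hext, hext]; rfl
    · change coeff (A 1 0 ((g : X) 0) + A 1 1 ((g : X) 1)) (n • k) = _
      rw [coeff_add, hA2, hA2, hext, hext]; rfl
  refine ⟨clmOfCoord
    { toFun := R₀
      map_add' := fun f g => Xk_ext fun i n => by simp only [hR, map_add]; ring
      map_smul' := fun a f => Xk_ext fun i n => by
        simp only [hR, map_smul, smul_eq_mul, RingHom.id_apply]; ring } ?_, ?_, hR⟩
  · intro i n
    have hc := fun i n => continuous_coord (k := k) i n
    simp only [LinearMap.coe_mk, AddHom.coe_mk, hR]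
    fun_prop
  · intro g i
    fin_cases i
    · exact H1.add_mem (hA1 _ _ _) (hA1 _ _ _)
    · exact H1.add_mem (hA1 _ _ _) (hA1 _ _ _)

/-! ## The spectrum of `ℒ_{μ,0}` -/

variable {N : ℝ} {k : Fin 2 → ℤ} {μ : EuclideanSpace ℝ (Fin 2)}

lemma norm_vec_pos (hk0 : 0 < k 0) : 0 < ‖vec k‖ := by
  refine norm_pos_iff.mpr fun h => ?_
  have : vec k 0 = 0 := by rw [h]; rfl
  simp only [vec, Int.cast_eq_zero] at this
  omega

lemma inner_phaseVelocity_vec (hN : 0 < N) (hk0 : 0 < k 0) :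
    0 < inner ℝ (phaseVelocity N k) (vec k) := by
  have h1 := norm_vec_pos hk0
  have h2 : (0 : ℝ) < k 0 := by exact_mod_cast hk0
  rw [phaseVelocity, real_inner_smul_left, real_inner_self_eq_norm_sq]
  positivity

lemma abs_Omega_le (hN : 0 < N) (v : EuclideanSpace ℝ (Fin 2)) : |Omega N v| ≤ N := by
  rw [Omega, abs_div, abs_mul, abs_of_pos hN, abs_norm]
  exact div_le_of_le_mul₀ (norm_nonneg _) hN.le
    (mul_le_mul_of_nonneg_left (abs_coord_le v 0) hN.le)

/-- The diagonal entry of the block of `ℒ_{μ,0} - z` in the mode `n`. -/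
def blockDiag (N : ℝ) (k : Fin 2 → ℤ) (μ : EuclideanSpace ℝ (Fin 2)) (z : ℂ) (n : ℤ) : ℂ :=
  Complex.I * ((inner ℝ (phaseVelocity N k) (vec (n • k) + μ) : ℝ) : ℂ) - z

/-- The determinant of the block of `ℒ_{μ,0} - z` in the mode `n`. -/
def blockDet (N : ℝ) (k : Fin 2 → ℤ) (μ : EuclideanSpace ℝ (Fin 2)) (z : ℂ) (n : ℤ) : ℂ :=
  blockDiag N k μ z n ^ 2 + ((Omega N (vec (n • k) + μ) : ℝ) : ℂ) ^ 2

/-- With D the diagonal entry, D² + Ω² = (D + iΩ)(D - iΩ). -/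
lemma blockDet_eq (z : ℂ) (n : ℤ) : blockDet N k μ z n =
    (Complex.I * ((freq N k μ 1 n : ℝ) : ℂ) - z) *
      (Complex.I * ((freq N k μ (-1) n : ℝ) : ℂ) - z) := by
  simp only [blockDet, blockDiag, freq]
  push_cast
  linear_combination ((Omega N (vec (n • k) + μ) : ℝ) : ℂ) ^ 2 * Complex.I_sq

/-- No exclusion of nk + μ = 0 is needed: both sides then vanish by the conventions for division by
zero. -/
lemma Omega_sq (n : ℤ) : ((Omega N (vec (n • k) + μ) : ℝ) : ℂ) ^ 2 =
    N ^ 2 * (((vec (n • k) + μ) 0 : ℝ) : ℂ) ^ 2 * invSq k μ n := by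
  simp only [Omega, invSq]
  push_cast
  rw [div_pow, mul_pow, div_eq_mul_inv]

/-- Because c·k > 0, the quantity c·(nk + μ) grows linearly in |n|, so the diagonal entry controls
the H¹ weight and the wavenumber, up to constants. -/
lemma exists_weight_le_blockDiag (hN : 0 < N) (hk0 : 0 < k 0) (μ : EuclideanSpace ℝ (Fin 2))
    (z : ℂ) : ∃ C > 0, ∀ n : ℤ, √(1 + ‖vec (n • k)‖ ^ 2) ≤ C * (‖blockDiag N k μ z n‖ + 1) ∧
      ‖vec (n • k) + μ‖ ≤ C * (‖blockDiag N k μ z n‖ + 1) := by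
  set a := inner ℝ (phaseVelocity N k) (vec k) with ha
  have ha0 : 0 < a := inner_phaseVelocity_vec hN hk0
  set b := |inner ℝ (phaseVelocity N k) μ| + ‖z‖ with hb
  have hb0 : 0 ≤ b := by positivity
  have hn : ∀ n : ℤ, ‖vec (n • k)‖ ≤ ‖vec k‖ / a * (‖blockDiag N k μ z n‖ + b) := by
    intro n
    have h1 : |(n : ℝ)| * a ≤ ‖blockDiag N k μ z n‖ + b := by
      have e : inner ℝ (phaseVelocity N k) (vec (n • k) + μ)
          = n * a + inner ℝ (phaseVelocity N k) μ := by
        rw [inner_add_right, vec_zsmul, real_inner_smul_right]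
      have h2 : |inner ℝ (phaseVelocity N k) (vec (n • k) + μ)| ≤ ‖blockDiag N k μ z n‖ + ‖z‖ := by
        have : Complex.I * ((inner ℝ (phaseVelocity N k) (vec (n • k) + μ) : ℝ) : ℂ)
          = blockDiag N k μ z n + z := by rw [blockDiag]; ring
        have h3 := norm_add_le (blockDiag N k μ z n) z
        rw [← this, norm_mul, Complex.norm_I, one_mul, Complex.norm_real, Real.norm_eq_abs] at h3
        exact h3
      have h4 : |(n : ℝ) * a| ≤ |inner ℝ (phaseVelocity N k) (vec (n • k) + μ)|
          + |inner ℝ (phaseVelocity N k) μ| := by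
        have : (n : ℝ) * a = inner ℝ (phaseVelocity N k) (vec (n • k) + μ)
          - inner ℝ (phaseVelocity N k) μ := by rw [e]; ring
        rw [this]; exact abs_sub _ _
      rw [abs_mul, abs_of_pos ha0] at h4
      linarith
    rw [vec_zsmul, norm_smul, Real.norm_eq_abs, div_mul_eq_mul_div, le_div_iff₀ ha0]
    calc |(n : ℝ)| * ‖vec k‖ * a = ‖vec k‖ * (|(n : ℝ)| * a) := by ring
      _ ≤ _ := mul_le_mul_of_nonneg_left h1 (norm_nonneg _)
  set q := ‖vec k‖ / a with hq
  have hq0 : 0 ≤ q := by positivity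
  refine ⟨1 + ‖μ‖ + q + q * b, by positivity, fun n => ?_⟩
  have h1 := hn n
  have h2 : √(1 + ‖vec (n • k)‖ ^ 2) ≤ 1 + ‖vec (n • k)‖ := by
    rw [Real.sqrt_le_left (by positivity)]
    nlinarith [norm_nonneg (vec (n • k))]
  have h3 := norm_add_le (vec (n • k)) μ
  have h4 := norm_nonneg (blockDiag N k μ z n)
  have h5 := norm_nonneg μ
  have h6 := mul_nonneg hq0 hb0
  constructor
  · nlinarith [mul_nonneg h5 h4, mul_nonneg h6 h4]
  · nlinarith [mul_nonneg h5 h4, mul_nonneg h6 h4]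

/-- A point at positive distance from all `i w^±_{nk}` is in the resolvent set of `ℒ_{μ,0}`. -/
lemma notMem_spec_of_separated (hN : 0 < N) (hk0 : 0 < k 0) {z : ℂ} {δ : ℝ} (hδ : 0 < δ)
    (h1 : ∀ n, δ ≤ ‖Complex.I * ((freq N k μ 1 n : ℝ) : ℂ) - z‖)
    (h2 : ∀ n, δ ≤ ‖Complex.I * ((freq N k μ (-1) n : ℝ) : ℂ) - z‖) :
    z ∉ spec (opLk N k μ 0) := by
  have hdet : ∀ n, δ ^ 2 ≤ ‖blockDet N k μ z n‖ := fun n => by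
    rw [blockDet_eq, norm_mul, sq]
    exact mul_le_mul (h1 n) (h2 n) hδ.le (norm_nonneg _)
  have hdet0 : ∀ n, blockDet N k μ z n ≠ 0 := fun n =>
    norm_pos_iff.mp ((by positivity : (0 : ℝ) < δ ^ 2).trans_le (hdet n))
  obtain ⟨C, hC0, hC⟩ := exists_weight_le_blockDiag hN hk0 μ z
  have hD : ∃ C' > 0, ∀ n, (‖blockDiag N k μ z n‖ + 1) ^ 2 ≤ C' * ‖blockDet N k μ z n‖ := by
    -- With D the diagonal entry, (|D| + 1)² ≤ 2|D|² + 2 ≤ 2|det| + 2(N² + 1), and the lower bound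
    -- δ² ≤ |det| absorbs the last constant.
    refine ⟨2 + 2 * (N ^ 2 + 1) / δ ^ 2, by positivity, fun n => ?_⟩
    have e1 : ‖blockDiag N k μ z n‖ ^ 2 ≤ ‖blockDet N k μ z n‖ + N ^ 2 := by
      have e2 : blockDiag N k μ z n ^ 2 = blockDet N k μ z n -
        ((Omega N (vec (n • k) + μ) : ℝ) : ℂ) ^ 2 := by rw [blockDet]; ring
      rw [← norm_pow, e2]
      refine (norm_sub_le _ _).trans (add_le_add le_rfl ?_)
      rw [norm_pow, Complex.norm_real, Real.norm_eq_abs]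
      exact pow_le_pow_left₀ (abs_nonneg _) (abs_Omega_le hN _) 2
    have e3 : 2 * (N ^ 2 + 1) ≤ 2 * (N ^ 2 + 1) / δ ^ 2 * ‖blockDet N k μ z n‖ := by
      rw [div_mul_eq_mul_div, le_div_iff₀ (by positivity)]
      exact mul_le_mul_of_nonneg_left (hdet n) (by positivity)
    nlinarith [sq_nonneg (‖blockDiag N k μ z n‖ - 1)]
  obtain ⟨C', hC'0, hC'⟩ := hD
  obtain ⟨Q, hQ⟩ := exists_invLaplaceBound μ
  have hbound : ∀ n (s : ℂ) (K : ℝ), 0 ≤ K →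
      √(1 + ‖vec (n • k)‖ ^ 2) * ‖s‖ ≤ K * (‖blockDiag N k μ z n‖ + 1) ^ 2 →
      √(1 + ‖vec (n • k)‖ ^ 2) * ‖s / blockDet N k μ z n‖ ≤ K * C' := fun n s K hK hs => by
    rw [norm_div, ← mul_div_assoc, div_le_iff₀ (norm_pos_iff.mpr (hdet0 n)), mul_assoc]
    exact hs.trans (mul_le_mul_of_nonneg_left (hC' n) hK)
  have hsqrt := fun n : ℤ => Real.sqrt_nonneg (1 + ‖vec (n • k)‖ ^ 2)
  have hD0 := fun n : ℤ => norm_nonneg (blockDiag N k μ z n)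
  have hx : ∀ n : ℤ, |(vec (n • k) + μ) 0| ≤ C * (‖blockDiag N k μ z n‖ + 1) := fun n =>
    (abs_coord_le _ 0).trans (hC n).2
  have hb1 : ∀ n, √(1 + ‖vec (n • k)‖ ^ 2) * ‖blockDiag N k μ z n / blockDet N k μ z n‖
      ≤ C * C' := fun n => hbound n _ C hC0.le (by
    calc _ ≤ C * (‖blockDiag N k μ z n‖ + 1) * (‖blockDiag N k μ z n‖ + 1) :=
          mul_le_mul (hC n).1 (by linarith) (hD0 n) (by have := hD0 n; positivity)
      _ = _ := by ring)
  have hb2 : ∀ n, √(1 + ‖vec (n • k)‖ ^ 2) *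
      ‖Complex.I * (((vec (n • k) + μ) 0 : ℝ) : ℂ) / blockDet N k μ z n‖ ≤ C ^ 2 * C' :=
    fun n => hbound n _ (C ^ 2) (by positivity) (by
      rw [norm_mul, Complex.norm_I, one_mul, Complex.norm_real, Real.norm_eq_abs]
      calc _ ≤ C * (‖blockDiag N k μ z n‖ + 1) * (C * (‖blockDiag N k μ z n‖ + 1)) :=
            mul_le_mul (hC n).1 (hx n) (abs_nonneg _) (by have := hD0 n; positivity)
        _ = _ := by ring)
  have hQ0 : 0 ≤ Q := (by positivity : (0 : ℝ) ≤ _).trans (hQ 0)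
  have hb3 : ∀ n, √(1 + ‖vec (n • k)‖ ^ 2) * ‖Complex.I * N ^ 2 *
      (((vec (n • k) + μ) 0 : ℝ) : ℂ) * invSq k μ n / blockDet N k μ z n‖
        ≤ N ^ 2 * C * Q * C' :=
    fun n => hbound n _ (N ^ 2 * C * Q) (by positivity) (by
      have e : ‖invSq k μ n‖ = (‖vec (n • k) + μ‖ ^ 2)⁻¹ := norm_invLapSymbol μ (n • k)
      rw [norm_mul, norm_mul, norm_mul, Complex.norm_I, one_mul, norm_pow, Complex.norm_real,
        Complex.norm_real, Real.norm_eq_abs, Real.norm_eq_abs, e, abs_of_pos hN]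
      calc _ = N ^ 2 * |(vec (n • k) + μ) 0| *
            (√(1 + ‖vec (n • k)‖ ^ 2) * (‖vec (n • k) + μ‖ ^ 2)⁻¹) := by ring
        _ ≤ N ^ 2 * (C * (‖blockDiag N k μ z n‖ + 1)) * Q := by
            have := hx n; have := hQ (n • k); have := hD0 n; gcongr
        _ = N ^ 2 * C * Q * (‖blockDiag N k μ z n‖ + 1) := by ring
        _ ≤ _ := mul_le_mul_of_nonneg_left (by nlinarith [hD0 n]) (by positivity))
  -- The blocks of the resolvent are the adjugates of the blocks of ℒ_0 - z divided by their
  -- determinants. The determinant is quadratic in the wavenumber while the entries are at most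
  -- linear, which gains the required derivative.
  obtain ⟨R, hR1, hR2⟩ := exists_blockDiagonal hk0
    (fun n => ![![blockDiag N k μ z n / blockDet N k μ z n,
        Complex.I * N ^ 2 * (((vec (n • k) + μ) 0 : ℝ) : ℂ) * invSq k μ n / blockDet N k μ z n],
      ![Complex.I * (((vec (n • k) + μ) 0 : ℝ) : ℂ) / blockDet N k μ z n,
        blockDiag N k μ z n / blockDet N k μ z n]])
    (max (C * C') (max (C ^ 2 * C') (N ^ 2 * C * Q * C'))) (by
      intro n i j
      fin_cases i <;> fin_cases j
      · exact (hb1 n).trans (le_max_left _ _)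
      · exact (hb3 n).trans ((le_max_right _ _).trans (le_max_right _ _))
      · exact (hb2 n).trans ((le_max_left _ _).trans (le_max_right _ _))
      · exact (hb1 n).trans (le_max_left _ _))
  have key : ∀ n, blockDet N k μ z n = blockDiag N k μ z n ^ 2 +
      N ^ 2 * (((vec (n • k) + μ) 0 : ℝ) : ℂ) ^ 2 * invSq k μ n := fun n => by
    rw [blockDet, Omega_sq]
  refine not_not.mpr ⟨R, fun g => ⟨hR1 g, Xk_ext fun i n => ?_⟩, fun f => Xk_ext fun i n => ?_⟩
  · have h0 := hdet0 n
    have hk := key n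
    have hd : Complex.I * ((inner ℝ (phaseVelocity N k) (vec (n • k) + μ) : ℝ) : ℂ)
      = blockDiag N k μ z n + z := by rw [blockDiag]; ring
    fin_cases i
    · simp only [Fin.zero_eta, map_sub, map_smul, coord_opLk_zero, hR2, hd, smul_eq_mul,
        Matrix.cons_val_zero, Matrix.cons_val_one, Complex.ofReal_zero]
      field_simp
      rw [hk]
      linear_combination (-(N : ℂ) ^ 2 * (((vec (n • k) + μ) 0 : ℝ) : ℂ) ^ 2 * invSq k μ n
        * coord 0 n g) * Complex.I_sq
    · simp only [Fin.mk_one, map_sub, map_smul, coord_opLk_one, hR2, hd, smul_eq_mul,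
        Matrix.cons_val_zero, Matrix.cons_val_one, Complex.ofReal_zero]
      field_simp
      rw [hk]
      linear_combination (-(N : ℂ) ^ 2 * (((vec (n • k) + μ) 0 : ℝ) : ℂ) ^ 2 * invSq k μ n
        * coord 1 n g) * Complex.I_sq
  · have h0 := hdet0 n
    have hk := key n
    have hd : Complex.I * ((inner ℝ (phaseVelocity N k) (vec (n • k) + μ) : ℝ) : ℂ)
      = blockDiag N k μ z n + z := by rw [blockDiag]; ring
    fin_cases i
    · simp only [Fin.zero_eta, map_sub, map_smul, coord_opLk_zero, coord_opLk_one, hR2, hd,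
        smul_eq_mul, Matrix.cons_val_zero, Matrix.cons_val_one, Complex.ofReal_zero]
      field_simp
      rw [hk]
      linear_combination (-(N : ℂ) ^ 2 * (((vec (n • k) + μ) 0 : ℝ) : ℂ) ^ 2 * invSq k μ n
        * coord 0 n (f : Xk k)) * Complex.I_sq
    · simp only [Fin.mk_one, map_sub, map_smul, coord_opLk_zero, coord_opLk_one, hR2, hd,
        smul_eq_mul, Matrix.cons_val_zero, Matrix.cons_val_one, Complex.ofReal_zero]
      field_simp
      rw [hk]
      linear_combination (-(N : ℂ) ^ 2 * (((vec (n • k) + μ) 0 : ℝ) : ℂ) ^ 2 * invSq k μ n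
        * coord 1 n (f : Xk k)) * Complex.I_sq

end InternalWave

end

noncomputable section

namespace InternalWave

/-! ## Eigenvectors of `ℒ_{μ,0}` -/

variable {N : ℝ} {k : Fin 2 → ℤ} {μ : EuclideanSpace ℝ (Fin 2)}

lemma coeff_fourierBasis (hk0 : 0 < k 0) (n m : ℤ) :
    coeff (fourierBasis (n • k)) (m • k) = if m = n then 1 else 0 := by
  rw [coeff, fourierBasis.repr_self, lp.single_apply, Pi.single_apply]
  simp only [(zsmul_injective hk0).eq_iff]

lemma coord_eigvec_zero (hk0 : 0 < k 0) (σ : ℝ) (n m : ℤ) :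
    coord 0 m (eigvec N k μ σ n) = if m = n then (N : ℂ) / (√2 : ℝ) else 0 := by
  change coeff (((N / √2 : ℝ) : ℂ) • fourierBasis (n • k)) (m • k) = _
  rw [coeff_smul, coeff_fourierBasis hk0]
  push_cast
  split_ifs <;> simp

lemma coord_eigvec_one (hk0 : 0 < k 0) (σ : ℝ) (n m : ℤ) :
    coord 1 m (eigvec N k μ σ n) =
      if m = n then -σ * (‖vec (n • k) + μ‖ : ℂ) / (√2 : ℝ) else 0 := by
  change coeff (((-σ * ‖vec (n • k) + μ‖ / √2 : ℝ) : ℂ) • fourierBasis (n • k)) (m • k) = _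
  rw [coeff_smul, coeff_fourierBasis hk0]
  push_cast
  split_ifs <;> simp

lemma fourierBasis_mem_H1 (j : Fin 2 → ℤ) : fourierBasis j ∈ H1 := by
  have hf : Memℓp (fun l => coeff (fourierBasis j) l) 2 := (fourierBasis.repr (fourierBasis j)).2
  change Memℓp (fun l => ((√(1 + ‖vec l‖ ^ 2) : ℝ) : ℂ) * coeff (fourierBasis j) l) 2
  refine (hf.const_smul ((√(1 + ‖vec j‖ ^ 2) : ℝ) : ℂ)).mono' fun l => ?_
  by_cases h : l = j
  · subst h; exact le_rfl
  · have : coeff (fourierBasis j) l = 0 := by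
      rw [coeff, fourierBasis.repr_self, lp.single_apply, Pi.single_apply, if_neg h]
    rw [this, mul_zero, norm_zero]
    exact norm_nonneg _

lemma eigvec_mem_domain (ε σ : ℝ) (n : ℤ) : eigvec N k μ σ n ∈ (opLk N k μ ε).domain := by
  intro i
  fin_cases i
  · exact H1.smul_mem _ (fourierBasis_mem_H1 _)
  · exact H1.smul_mem _ (fourierBasis_mem_H1 _)

/-- With p = nk + μ, the off-diagonal block sends (N, -σ|p|) to iσΩ(p) times itself: the first row
cancels a factor |p|, the second uses σ² = 1. -/
lemma opLk_eigvec (hk0 : 0 < k 0) {σ : ℝ} (hσ : σ ^ 2 = 1) {n : ℤ}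
    (hp : ‖vec (n • k) + μ‖ ≠ 0) :
    opLk N k μ 0 ⟨eigvec N k μ σ n, eigvec_mem_domain 0 σ n⟩ =
      (Complex.I * ((freq N k μ σ n : ℝ) : ℂ)) • eigvec N k μ σ n := by
  have hp' : (‖vec (n • k) + μ‖ : ℂ) ≠ 0 := by exact_mod_cast hp
  have hσ' : (σ : ℂ) ^ 2 = 1 := by exact_mod_cast hσ
  refine Xk_ext fun i m => ?_
  fin_cases i
  · simp only [Fin.zero_eta, coord_opLk_zero, map_smul, coord_eigvec_zero hk0,
      coord_eigvec_one hk0, smul_eq_mul, Complex.ofReal_zero, zero_mul, add_zero]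
    split_ifs with h
    · subst h
      simp only [freq, Omega, invSq]
      push_cast
      field_simp
      ring
    · ring
  · simp only [Fin.mk_one, coord_opLk_one, map_smul, coord_eigvec_zero hk0,
      coord_eigvec_one hk0, smul_eq_mul, Complex.ofReal_zero, zero_mul, add_zero]
    split_ifs with h
    · subst h
      simp only [freq, Omega]
      push_cast
      field_simp
      linear_combination (N * (((vec (m • k) + μ) 0 : ℝ) : ℂ)) * hσ'
    · ring

/-- Distinct modes are orthogonal, but the two branches of one mode generally are not; only the
former is used for the vanishing of slopes. -/
lemma inner_eigvec (hk0 : 0 < k 0) (σ τ : ℝ) (n m : ℤ) :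
    inner ℂ (eigvec N k μ σ n) (eigvec N k μ τ m) =
      if n = m then (((N ^ 2 + σ * τ * ‖vec (n • k) + μ‖ ^ 2) / 2 : ℝ) : ℂ) else 0 := by
  rw [inner_Xk]
  change inner ℂ (((N / √2 : ℝ) : ℂ) • fourierBasis (n • k))
      (((N / √2 : ℝ) : ℂ) • fourierBasis (m • k)) +
    inner ℂ (((-σ * ‖vec (n • k) + μ‖ / √2 : ℝ) : ℂ) • fourierBasis (n • k))
      (((-τ * ‖vec (m • k) + μ‖ / √2 : ℝ) : ℂ) • fourierBasis (m • k)) = _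
  have ho := orthonormal_iff_ite.mp fourierBasis.orthonormal (n • k) (m • k)
  simp only [(zsmul_injective hk0).eq_iff] at ho
  simp only [inner_smul_left, inner_smul_right, ho, Complex.conj_ofReal]
  split_ifs with h
  · subst h
    rw [mul_one, mul_one, ← Complex.ofReal_mul, ← Complex.ofReal_mul, ← Complex.ofReal_add]
    congr 1
    have h2 : √2 ^ 2 = 2 := Real.sq_sqrt (by norm_num)
    field_simp
    rw [h2]
    ring
  · simp

lemma eigvec_ne_zero (hN : 0 < N) (hk0 : 0 < k 0) (σ : ℝ) (n : ℤ) : eigvec N k μ σ n ≠ 0 := by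
  intro h
  have h1 := coord_eigvec_zero (N := N) (μ := μ) hk0 σ n n
  rw [h, map_zero, if_pos rfl] at h1
  have h2 : ((√2 : ℝ) : ℂ) ≠ 0 := by
    have : √2 ≠ 0 := by positivity
    exact_mod_cast this
  have h3 : (N : ℂ) ≠ 0 := by exact_mod_cast hN.ne'
  exact div_ne_zero h3 h2 h1.symm

lemma conjXk_eigvec (hk0 : 0 < k 0) (σ : ℝ) (n : ℤ) :
    conjXk k (eigvec N k μ σ n) = eigvec N k μ σ n := by
  refine Xk_ext fun i m => ?_
  rw [coord_conjXk]
  fin_cases i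
  · simp only [Fin.zero_eta, coord_eigvec_zero hk0]
    split_ifs <;> simp
  · simp only [Fin.mk_one, coord_eigvec_one hk0]
    split_ifs <;> simp

/-- The coefficient of `f^τ_{mk}`, `m = n ± 1`, in the perturbation applied to `f^σ_{nk}`. -/
def pertCoef (N : ℝ) (k : Fin 2 → ℤ) (μ : EuclideanSpace ℝ (Fin 2)) (σ : ℝ) (n : ℤ) (τ : ℝ)
    (m : ℤ) : ℂ :=
  shearConst k μ * (((1 / 4 *
    ((-‖vec k‖⁻¹ - σ / ‖vec (n • k) + μ‖) / N -
      τ * (σ * ‖vec (n • k) + μ‖ / (N * ‖vec k‖) - σ * ‖vec k‖ / (N * ‖vec (n • k) + μ‖))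
        / ‖vec (m • k) + μ‖)) : ℝ) : ℂ)

/-- The cosine gives weight 1/2 to each neighbouring mode. In mode m a vector (a, b) has
f^τ-coefficient (√2/2)(a/N - τ b/|mk + μ|). Together with the 1/√2 in f^σ these factors make the 1/4
in `pertCoef`. -/
lemma pert_eigvec (hN : 0 < N) (hk0 : 0 < k 0) (hp : ∀ n : ℤ, ‖vec (n • k) + μ‖ ≠ 0)
    (σ : ℝ) (n : ℤ) :
    pert N k μ (eigvec N k μ σ n) =
      pertCoef N k μ σ n 1 (n - 1) • eigvec N k μ 1 (n - 1)
      + pertCoef N k μ σ n (-1) (n - 1) • eigvec N k μ (-1) (n - 1)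
      + pertCoef N k μ σ n 1 (n + 1) • eigvec N k μ 1 (n + 1)
      + pertCoef N k μ σ n (-1) (n + 1) • eigvec N k μ (-1) (n + 1) := by
  have hN' : (N : ℂ) ≠ 0 := by exact_mod_cast hN.ne'
  have hp' : ∀ n : ℤ, (‖vec (n • k) + μ‖ : ℂ) ≠ 0 := fun n => by exact_mod_cast hp n
  have hk' : (‖vec k‖ : ℂ) ≠ 0 := by exact_mod_cast (norm_vec_pos hk0).ne'
  have h2 : ((√2 : ℝ) : ℂ) ≠ 0 := by
    have : √2 ≠ 0 := by positivity
    exact_mod_cast this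
  have e1 : ∀ m : ℤ, (m - 1 = n) = (m = n + 1) := fun m => propext (by omega)
  have e2 : ∀ m : ℤ, (m + 1 = n) = (m = n - 1) := fun m => propext (by omega)
  have hn := hp' n
  refine Xk_ext fun i m => ?_
  rw [pert_apply]
  have hm := hp' m
  fin_cases i
  · simp only [Fin.zero_eta, map_add, map_smul, coord_pertFun_zero, nbr, coord_eigvec_zero hk0,
      coord_eigvec_one hk0, e1, e2, smul_eq_mul]
    by_cases h3 : m = n + 1
    · have h4 : m ≠ n - 1 := by omega
      simp only [← h3, h4, if_true, if_false]
      rw [h3, add_sub_cancel_right, ← h3]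
      simp only [pertCoef, invSq]
      push_cast
      field_simp
      ring
    · by_cases h4 : m = n - 1
      · simp only [← h4, h3, if_true, if_false]
        rw [h4, sub_add_cancel, ← h4]
        simp only [pertCoef, invSq]
        push_cast
        field_simp
        ring
      · simp [h3, h4]
  · simp only [Fin.mk_one, map_add, map_smul, coord_pertFun_one, nbr,
      coord_eigvec_one hk0, e1, e2, smul_eq_mul]
    by_cases h3 : m = n + 1
    · have h4 : m ≠ n - 1 := by omega
      simp only [← h3, h4, if_true, if_false]
      rw [h3, add_sub_cancel_right, ← h3]
      simp only [pertCoef, invSq]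
      push_cast
      field_simp
      ring
    · by_cases h4 : m = n - 1
      · simp only [← h4, h3, if_true, if_false]
        rw [h4, sub_add_cancel, ← h4]
        simp only [pertCoef, invSq]
        push_cast
        field_simp
        ring
      · simp [h3, h4]

/-! ## The resonant set -/

lemma Omega_smul_of_pos {t : ℝ} (ht : 0 < t) (v : EuclideanSpace ℝ (Fin 2)) :
    Omega N (t • v) = Omega N v := by
  simp only [Omega, norm_smul, Real.norm_eq_abs, abs_of_pos ht, PiLp.smul_apply, smul_eq_mul]
  rw [mul_left_comm, mul_div_mul_left _ _ ht.ne']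

lemma Omega_neg (v : EuclideanSpace ℝ (Fin 2)) : Omega N (-v) = -Omega N v := by
  simp only [Omega, norm_neg, PiLp.neg_apply]
  ring

lemma Omega_zero : Omega N 0 = 0 := by simp [Omega]

lemma inner_phaseVelocity_self (hk0 : 0 < k 0) :
    inner ℝ (phaseVelocity N k) (vec k) = Omega N (vec k) := by
  have h := (norm_vec_pos hk0).ne'
  have e : vec k 0 = (k 0 : ℝ) := rfl
  rw [phaseVelocity, real_inner_smul_left, real_inner_self_eq_norm_sq, Omega, e]
  field_simp

lemma Omega_vec_pos (hN : 0 < N) (hk0 : 0 < k 0) : 0 < Omega N (vec k) := by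
  rw [← inner_phaseVelocity_self hk0]
  exact inner_phaseVelocity_vec hN hk0

/-- At μ = 0 the minus branch takes the value 0 at both n = 0 and n = 1, as c·k = Ω(k), so it is not
separated. -/
lemma zero_mem_exceptionalSet (hk0 : 0 < k 0) : (0 : EuclideanSpace ℝ (Fin 2)) ∈
    exceptionalSet N k := by
  refine ⟨Or.inl rfl, ?_⟩
  rintro ⟨α, hα, -, h⟩
  have h1 := h 0 (by norm_num)
  simp only [freq, add_zero, one_smul, inner_phaseVelocity_self hk0, zero_smul] at h1
  have h2 : vec 0 = 0 := by ext i; simp [vec]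
  simp only [h2, inner_zero_right, Omega_zero] at h1
  norm_num at h1
  linarith

lemma exists_separation (hμ : μ ∈ resonantSet N k \ exceptionalSet N k) : ∃ α > 0,
    (∀ l : ℤ, l ≠ 0 → α ≤ |freq N k μ 1 l - freq N k μ 1 0|) ∧
    (∀ l : ℤ, l ≠ 1 → α ≤ |freq N k μ (-1) l - freq N k μ (-1) 1|) := by
  by_contra h
  exact hμ.2 ⟨hμ.1, h⟩

lemma resonance_eq (hk0 : 0 < k 0) (hμ : μ ∈ resonantSet N k \ exceptionalSet N k) :
    μ ≠ 0 ∧ Omega N (vec k) - Omega N (vec k + μ) = Omega N μ := by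
  refine hμ.1.resolve_left fun h => hμ.2 ?_
  rw [mem_singleton_iff.mp h]
  exact zero_mem_exceptionalSet hk0

/-- Suppose μ = -nk. Since Ω is odd and invariant under positive scaling, every term of the
resonance condition is ±Ω(k) or 0, with Ω(k) > 0. The cases n < 0, n = 1 and n > 1 are
contradictory, and n = 0 means μ = 0, which is exceptional. -/
lemma norm_line_ne_zero (hN : 0 < N) (hk0 : 0 < k 0)
    (hμ : μ ∈ resonantSet N k \ exceptionalSet N k) (n : ℤ) : ‖vec (n • k) + μ‖ ≠ 0 := by
  obtain ⟨h0, hres⟩ := resonance_eq hk0 hμ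
  have hpos := Omega_vec_pos hN hk0
  intro h
  have h1 : μ = -((n : ℝ) • vec k) := by
    rw [norm_eq_zero, vec_zsmul] at h
    exact eq_neg_of_add_eq_zero_right h
  have h2 : vec k + μ = -(((n : ℝ) - 1) • vec k) := by rw [h1]; module
  rw [h2, h1, Omega_neg, Omega_neg] at hres
  rcases lt_trichotomy n 0 with hn | hn | hn
  · have hn' : (0 : ℝ) < -n := by exact_mod_cast neg_pos.mpr hn
    have e1 : Omega N ((n : ℝ) • vec k) = -Omega N (vec k) := by
      rw [← Omega_smul_of_pos hn' (vec k), ← Omega_neg]; congr 1; module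
    have e2 : Omega N (((n : ℝ) - 1) • vec k) = -Omega N (vec k) := by
      rw [← Omega_smul_of_pos (by linarith : (0 : ℝ) < 1 - n) (vec k), ← Omega_neg]
      congr 1; module
    rw [e1, e2] at hres
    linarith
  · exact h0 (by rw [h1, hn]; simp)
  · have hn' : (0 : ℝ) < n := by exact_mod_cast hn
    rw [Omega_smul_of_pos hn'] at hres
    rcases eq_or_lt_of_le (Int.add_one_le_iff.mpr hn) with hn1 | hn1
    · have : (n : ℝ) = 1 := by exact_mod_cast hn1.symm
      rw [this, sub_self, zero_smul, Omega_zero] at hres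
      linarith
    · have : (1 : ℝ) < n := by exact_mod_cast hn1
      rw [Omega_smul_of_pos (by linarith : (0 : ℝ) < (n : ℝ) - 1)] at hres
      linarith

/-- As c·k = Ω(k), this is the resonance condition rearranged. -/
lemma freq_eq (hk0 : 0 < k 0) (hμ : μ ∈ resonantSet N k \ exceptionalSet N k) :
    freq N k μ 1 0 = freq N k μ (-1) 1 := by
  have h := (resonance_eq hk0 hμ).2
  have h2 : vec 0 = 0 := by ext i; simp [vec]
  simp only [freq, zero_smul, one_smul, h2, zero_add, inner_add_right,
    inner_phaseVelocity_self hk0]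
  linarith

lemma freq_mem_spec (hN : 0 < N) (hk0 : 0 < k 0)
    (hμ : μ ∈ resonantSet N k \ exceptionalSet N k) {σ : ℝ} (hσ : σ ^ 2 = 1) (n : ℤ) :
    Complex.I * ((freq N k μ σ n : ℝ) : ℂ) ∈ spec (opLk N k μ 0) :=
  mem_spec_of_eigenvector (eigvec_ne_zero hN hk0 σ n) (eigvec_mem_domain 0 σ n)
    (opLk_eigvec hk0 hσ (norm_line_ne_zero hN hk0 hμ n))

lemma norm_I_mul_sub (a b : ℝ) : ‖Complex.I * (a : ℂ) - Complex.I * (b : ℂ)‖ = |a - b| := by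
  rw [← mul_sub, norm_mul, Complex.norm_I, one_mul, ← Complex.ofReal_sub, Complex.norm_real,
    Real.norm_eq_abs]

lemma exists_separates (hN : 0 < N) (hk0 : 0 < k 0)
    (hμ : μ ∈ resonantSet N k \ exceptionalSet N k) : ∃ r, Separates N k μ r := by
  obtain ⟨α, hα, h1, h2⟩ := exists_separation hμ
  -- For z in the disc of radius α/2, every other i w is at distance at least α - α/2 ≥ |λ⁺ - z|
  -- from z. So δ = |λ⁺ - z| separates z from all eigenvalues when z ≠ λ⁺.
  refine ⟨α / 2, by positivity, Subset.antisymm ?_ ?_⟩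
  · rintro z ⟨hz, hzr⟩
    by_contra hne
    have hd : 0 < ‖lamPlus N k μ - z‖ := norm_pos_iff.mpr (sub_ne_zero.mpr (Ne.symm hne))
    have hzr' : ‖lamPlus N k μ - z‖ ≤ α / 2 := by
      rw [norm_sub_rev]; exact mem_closedBall_iff_norm.mp hzr
    have key : ∀ a : ℝ, α ≤ |a - freq N k μ 1 0| →
        ‖lamPlus N k μ - z‖ ≤ ‖Complex.I * (a : ℂ) - z‖ := by
      intro a ha
      rw [← norm_I_mul_sub] at ha
      have h3 := norm_sub_le_norm_sub_add_norm_sub (Complex.I * (a : ℂ)) z (lamPlus N k μ)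
      rw [norm_sub_rev z] at h3
      rw [lamPlus] at *
      linarith
    refine notMem_spec_of_separated hN hk0 (μ := μ) hd (fun n => ?_) (fun n => ?_) hz
    · by_cases hn : n = 0
      · rw [hn]; exact le_rfl
      · exact key _ (h1 n hn)
    · by_cases hn : n = 1
      · rw [hn, ← freq_eq hk0 hμ]; exact le_rfl
      · rw [freq_eq hk0 hμ] at key
        exact key _ (h2 n hn)
  · rintro z rfl
    exact ⟨freq_mem_spec hN hk0 hμ (by norm_num) 0, Metric.mem_closedBall_self (by positivity)⟩

end InternalWave

end

noncomputable section

namespace InternalWave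

/-! ## Entries of the Gram and action matrices -/

variable {N : ℝ} {k : Fin 2 → ℤ} {μ : EuclideanSpace ℝ (Fin 2)}

lemma Separates.disjoint {r : ℝ} (hs : Separates N k μ r) :
    Disjoint (spec (opLk N k μ 0)) (Metric.sphere (lamPlus N k μ) r) := by
  refine Set.disjoint_left.mpr fun z hz hzr => ?_
  have h1 : z ∈ ({lamPlus N k μ} : Set ℂ) := hs.2 ▸ ⟨hz, Metric.sphere_subset_closedBall hzr⟩
  exact Metric.ne_of_mem_sphere hzr hs.1.ne' h1

lemma Separates.eq_or_notMem {r : ℝ} (hs : Separates N k μ r) {ν : ℂ}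
    (hν : ν ∈ spec (opLk N k μ 0)) :
    ν = lamPlus N k μ ∨ ν ∉ Metric.closedBall (lamPlus N k μ) r := by
  by_cases h : ν ∈ Metric.closedBall (lamPlus N k μ) r
  · left
    have h1 : ν ∈ ({lamPlus N k μ} : Set ℂ) := hs.2 ▸ ⟨hν, h⟩
    exact h1
  · exact Or.inr h

/-- The first order correction of the eigenvector `f^σ_{nk}`. -/
def correction (N : ℝ) (k : Fin 2 → ℤ) (μ : EuclideanSpace ℝ (Fin 2)) (σ : ℝ) (n : ℤ) : Xk k :=
  -- If i w^τ_{mk} = λ⁺ the inverse reads 0, which is the value of the reduced resolvent there.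
  let c : ℝ → ℤ → ℂ := fun τ m =>
    pertCoef N k μ σ n τ m * (lamPlus N k μ - Complex.I * ((freq N k μ τ m : ℝ) : ℂ))⁻¹
  c 1 (n - 1) • eigvec N k μ 1 (n - 1) + c (-1) (n - 1) • eigvec N k μ (-1) (n - 1)
    + c 1 (n + 1) • eigvec N k μ 1 (n + 1) + c (-1) (n + 1) • eigvec N k μ (-1) (n + 1)

/-- The correction lives in modes n ± 1; this is why the diagonal entries have no linear term. -/
lemma inner_correction_self (hk0 : 0 < k 0) (σ ρ : ℝ) (n : ℤ) :
    inner ℂ (eigvec N k μ ρ n) (correction N k μ σ n) = 0 := by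
  have h1 : n ≠ n - 1 := by omega
  have h2 : n ≠ n + 1 := by omega
  simp only [correction, inner_Xk_add_right, inner_Xk_smul_right, inner_eigvec hk0, if_neg h1,
    if_neg h2, mul_zero, add_zero]

/-- The basis vectors are `f^+_0` and `f^-_k`. -/
def baseSign : Fin 2 → ℝ := ![1, -1]

/-- The modes of the basis vectors. -/
def baseMode : Fin 2 → ℤ := ![0, 1]

lemma baseVec_eq (i : Fin 2) : baseVec N k μ i = eigvec N k μ (baseSign i) (baseMode i) := by
  fin_cases i <;> rfl

lemma baseSign_sq (i : Fin 2) : baseSign i ^ 2 = 1 := by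
  fin_cases i <;> simp [baseSign]

lemma lamPlus_eq (hk0 : 0 < k 0) (hμ : μ ∈ resonantSet N k \ exceptionalSet N k) (i : Fin 2) :
    lamPlus N k μ = Complex.I * ((freq N k μ (baseSign i) (baseMode i) : ℝ) : ℂ) := by
  fin_cases i
  · rfl
  · simp only [lamPlus, freq_eq hk0 hμ]; rfl

lemma baseVec_mem_domain (i : Fin 2) : baseVec N k μ i ∈ (opLk N k μ 0).domain := by
  rw [baseVec_eq]; exact eigvec_mem_domain _ _ _

lemma opLk_baseVec (hN : 0 < N) (hk0 : 0 < k 0)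
    (hμ : μ ∈ resonantSet N k \ exceptionalSet N k) (i : Fin 2) :
    opLk N k μ 0 ⟨baseVec N k μ i, baseVec_mem_domain i⟩ = lamPlus N k μ • baseVec N k μ i := by
  simp only [baseVec_eq]
  rw [opLk_eigvec hk0 (baseSign_sq i) (norm_line_ne_zero hN hk0 hμ _), lamPlus_eq hk0 hμ i]

lemma baseVec_ne_zero (hN : 0 < N) (hk0 : 0 < k 0) (i : Fin 2) : baseVec N k μ i ≠ 0 := by
  rw [baseVec_eq]; exact eigvec_ne_zero hN hk0 _ _

/-! ### Projectors, matrix entries and their derivatives for a fixed separating circle -/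

section Fixed

variable (hN : 0 < N) (hk0 : 0 < k 0) (hμ : μ ∈ resonantSet N k \ exceptionalSet N k)
  {r : ℝ} (hs : Separates N k μ r)

include hN hk0 hμ in
-- The perturbed vector is a combination of four eigenvectors, treated term by term. The result does
-- not contain r, so the slopes do not depend on the circle.
lemma reducedResolv_pert_eigvec (σ : ℝ) (n : ℤ) :
    reducedResolv hs.1 hs.disjoint (pert N k μ (eigvec N k μ σ n)) = correction N k μ σ n := by
  have h : ∀ τ : ℝ, τ ^ 2 = 1 → ∀ m, reducedResolv hs.1 hs.disjoint (eigvec N k μ τ m) =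
      (lamPlus N k μ - Complex.I * ((freq N k μ τ m : ℝ) : ℂ))⁻¹ • eigvec N k μ τ m :=
    fun τ hτ m => reducedResolv_eigenvector hs.1 hs.disjoint (eigvec_ne_zero hN hk0 τ m)
      (eigvec_mem_domain 0 τ m) (opLk_eigvec hk0 hτ (norm_line_ne_zero hN hk0 hμ m))
      (hs.eq_or_notMem (freq_mem_spec hN hk0 hμ hτ m))
  rw [pert_eigvec hN hk0 (norm_line_ne_zero hN hk0 hμ)]
  simp only [map_add, map_smul, h 1 (by norm_num), h (-1) (by norm_num), smul_smul, correction]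

include hN hk0 hμ hs in
lemma rieszProj_eigvec_of_eq {τ : ℝ} (hτ : τ ^ 2 = 1) {m : ℤ}
    (h : freq N k μ τ m = freq N k μ 1 0) :
    rieszProj (opLk N k μ 0) (lamPlus N k μ) r (eigvec N k μ τ m) = eigvec N k μ τ m := by
  classical
  rw [rieszProj_eigenvector hs.1 hs.disjoint (eigvec_ne_zero hN hk0 τ m)
      (eigvec_mem_domain 0 τ m) (opLk_eigvec hk0 hτ (norm_line_ne_zero hN hk0 hμ m))
      (hs.eq_or_notMem (freq_mem_spec hN hk0 hμ hτ m)), if_pos (by rw [h, lamPlus]), one_smul]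

include hN hk0 hμ hs in
lemma rieszProj_eigvec_of_ne {τ : ℝ} (hτ : τ ^ 2 = 1) {m : ℤ}
    (h : freq N k μ τ m ≠ freq N k μ 1 0) :
    rieszProj (opLk N k μ 0) (lamPlus N k μ) r (eigvec N k μ τ m) = 0 := by
  classical
  rw [rieszProj_eigenvector hs.1 hs.disjoint (eigvec_ne_zero hN hk0 τ m)
      (eigvec_mem_domain 0 τ m) (opLk_eigvec hk0 hτ (norm_line_ne_zero hN hk0 hμ m))
      (hs.eq_or_notMem (freq_mem_spec hN hk0 hμ hτ m)), if_neg, zero_smul]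
  rw [lamPlus, mul_right_inj' Complex.I_ne_zero, Complex.ofReal_inj]
  exact h

include hμ in
lemma freq_one_ne {m : ℤ} (hm : m ≠ 0) : freq N k μ 1 m ≠ freq N k μ 1 0 := by
  obtain ⟨α, hα, h, -⟩ := exists_separation hμ
  intro h0
  have := h m hm
  rw [h0, sub_self, abs_zero] at this
  linarith

include hk0 hμ in
lemma freq_neg_one_ne {m : ℤ} (hm : m ≠ 1) : freq N k μ (-1) m ≠ freq N k μ 1 0 := by
  obtain ⟨α, hα, -, h⟩ := exists_separation hμ
  intro h0
  have := h m hm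
  rw [h0, freq_eq hk0 hμ, sub_self, abs_zero] at this
  linarith

include hN hk0 hμ hs in
-- Of the four neighbours only f^-_k has frequency w; the separation for non-exceptional μ rules out
-- the others.
lemma rieszProj_pert_eigvec_zero :
    rieszProj (opLk N k μ 0) (lamPlus N k μ) r (pert N k μ (eigvec N k μ 1 0)) =
      pertCoef N k μ 1 0 (-1) 1 • eigvec N k μ (-1) 1 := by
  rw [pert_eigvec hN hk0 (norm_line_ne_zero hN hk0 hμ)]
  simp only [map_add, map_smul, zero_sub, zero_add]
  rw [rieszProj_eigvec_of_ne hN hk0 hμ hs (by norm_num) (freq_one_ne hμ (by norm_num)),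
    rieszProj_eigvec_of_ne hN hk0 hμ hs (by norm_num) (freq_one_ne hμ (by norm_num)),
    rieszProj_eigvec_of_ne hN hk0 hμ hs (by norm_num) (freq_neg_one_ne hk0 hμ (by norm_num)),
    rieszProj_eigvec_of_eq hN hk0 hμ hs (by norm_num) (freq_eq hk0 hμ).symm]
  simp

include hN hk0 hμ hs in
lemma rieszProj_pert_eigvec_one :
    rieszProj (opLk N k μ 0) (lamPlus N k μ) r (pert N k μ (eigvec N k μ (-1) 1)) =
      pertCoef N k μ (-1) 1 1 0 • eigvec N k μ 1 0 := by
  rw [pert_eigvec hN hk0 (norm_line_ne_zero hN hk0 hμ)]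
  simp only [map_add, map_smul, sub_self]
  rw [rieszProj_eigvec_of_ne hN hk0 hμ hs (by norm_num)
      (freq_one_ne hμ (by norm_num : (1 : ℤ) + 1 ≠ 0)),
    rieszProj_eigvec_of_ne hN hk0 hμ hs (by norm_num) (freq_neg_one_ne hk0 hμ (by norm_num)),
    rieszProj_eigvec_of_ne hN hk0 hμ hs (by norm_num)
      (freq_neg_one_ne hk0 hμ (by norm_num : (1 : ℤ) + 1 ≠ 1)),
    rieszProj_eigvec_of_eq hN hk0 hμ hs (by norm_num) rfl]
  simp

include hN hk0 hμ hs in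
lemma proj_zero_baseVec (i : Fin 2) : proj N k μ r 0 (baseVec N k μ i) = baseVec N k μ i := by
  rw [proj, baseVec_eq]
  refine rieszProj_eigvec_of_eq hN hk0 hμ hs (baseSign_sq i) ?_
  fin_cases i
  · rfl
  · exact (freq_eq hk0 hμ).symm

include hN hk0 hμ hs in
lemma gramEntry_eq (i j : Fin 2) (ε : ℝ) : gramEntry N k μ r i j ε =
    inner ℂ (proj N k μ r ε (baseVec N k μ j)) (proj N k μ r ε (baseVec N k μ i)) := by
  change inner ℂ (baseVec N k μ j) (gramOp N k μ r ε (baseVec N k μ i)) = _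
  rw [gramOp, ContinuousLinearMap.adjoint_inner_right,
    ContinuousLinearMap.adjoint_inner_right, proj_zero_baseVec hN hk0 hμ hs,
    proj_zero_baseVec hN hk0 hμ hs]

include hN hk0 hμ hs in
lemma actionEntry_eq (i j : Fin 2) (ε : ℝ) : actionEntry N k μ r i j ε =
    inner ℂ (proj N k μ r ε (baseVec N k μ j))
      (applyOp (opLk N k μ ε) (proj N k μ r ε (baseVec N k μ i))) := by
  change inner ℂ (baseVec N k μ j) (actionOp N k μ r ε (baseVec N k μ i)) = _
  rw [actionOp, ContinuousLinearMap.adjoint_inner_right,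
    ContinuousLinearMap.adjoint_inner_right, proj_zero_baseVec hN hk0 hμ hs,
    proj_zero_baseVec hN hk0 hμ hs]

lemma neg_conj_lamPlus : -(starRingEnd ℂ) (lamPlus N k μ) = lamPlus N k μ := by
  simp [lamPlus]

lemma conjXk_baseVec (hk0 : 0 < k 0) (i : Fin 2) :
    conjXk k (baseVec N k μ i) = baseVec N k μ i := by
  rw [baseVec_eq, conjXk_eigvec hk0]

lemma conjXk_proj (hk0 : 0 < k 0) {ε : ℝ} (hr : 0 ≤ r)
    (hd : Disjoint (spec (opLk N k μ ε)) (Metric.sphere (lamPlus N k μ) r)) (i : Fin 2) :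
    conjXk k (proj N k μ r ε (baseVec N k μ i)) = proj N k μ r ε (baseVec N k μ i) := by
  have h := rieszProj_conj (conjXk k) conjXk_smul (opLk_conjXk ε) hr hd neg_conj_lamPlus
    (baseVec N k μ i)
  exact h.symm.trans (congrArg (rieszProj _ _ _) (conjXk_baseVec hk0 i))

include hN hk0 hμ hs in
-- Conjugation of coefficients fixes P_ε f_i and conjugates inner products, so the entry equals its
-- own conjugate.
lemma gramEntry_eq_re {ε : ℝ}
    (hd : Disjoint (spec (opLk N k μ ε)) (Metric.sphere (lamPlus N k μ) r)) (i j : Fin 2) :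
    gramEntry N k μ r i j ε = ((gramEntry N k μ r i j ε).re : ℂ) := by
  refine (Complex.conj_eq_iff_re.mp ?_).symm
  rw [gramEntry_eq hN hk0 hμ hs, ← inner_conjXk, conjXk_proj hk0 hs.1.le hd,
    conjXk_proj hk0 hs.1.le hd]

include hN hk0 hμ hs in
-- As for the Gram entries, but the operator anticommutes with the conjugation, so the entry is
-- minus its conjugate.
lemma actionEntry_eq_im {ε : ℝ}
    (hd : Disjoint (spec (opLk N k μ ε)) (Metric.sphere (lamPlus N k μ) r)) (i j : Fin 2) :
    actionEntry N k μ r i j ε = Complex.I * ((actionEntry N k μ r i j ε).im : ℂ) := by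
  have h1 : (starRingEnd ℂ) (actionEntry N k μ r i j ε) = -actionEntry N k μ r i j ε := by
    obtain ⟨hdom, -⟩ := rieszProj_mem_domain hs.1.le hd (baseVec N k μ i)
    obtain ⟨hdom', e⟩ := opLk_conjXk ε _ hdom
    have e1 : applyOp (opLk N k μ ε) (proj N k μ r ε (baseVec N k μ i)) =
        opLk N k μ ε ⟨_, hdom⟩ := dif_pos hdom
    have e2 : opLk N k μ ε ⟨_, hdom'⟩ = opLk N k μ ε ⟨_, hdom⟩ := by
      congr 1
      exact Subtype.ext (conjXk_proj hk0 hs.1.le hd i)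
    rw [actionEntry_eq hN hk0 hμ hs, ← inner_conjXk, conjXk_proj hk0 hs.1.le hd, e1,
      ← neg_neg (conjXk k _), ← e, e2, inner_neg_right]
  have h2 : (actionEntry N k μ r i j ε).re = 0 := by
    have := congrArg Complex.re h1
    simp only [Complex.conj_re, Complex.neg_re] at this
    linarith
  nth_rewrite 1 [← Complex.re_add_im (actionEntry N k μ r i j ε)]
  rw [h2]
  push_cast
  ring

/-- The derivative at `ε = 0` of the entries of the Gram matrix. -/
def gramSlope (N : ℝ) (k : Fin 2 → ℤ) (μ : EuclideanSpace ℝ (Fin 2)) (i j : Fin 2) : ℂ :=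
  inner ℂ (baseVec N k μ j) (correction N k μ (baseSign i) (baseMode i))
    + inner ℂ (correction N k μ (baseSign j) (baseMode j)) (baseVec N k μ i)

include hN hk0 hμ hs in
lemma hasDerivAt_proj (i : Fin 2) : HasDerivAt (fun ε => proj N k μ r ε (baseVec N k μ i))
    (correction N k μ (baseSign i) (baseMode i)) 0 := by
  have h := hasDerivAt_rieszProj_apply isBoundedPerturbation_opLk hs.1 hs.disjoint
    (baseVec_ne_zero hN hk0 i) (baseVec_mem_domain i) (opLk_baseVec hN hk0 hμ i)
  rw [baseVec_eq, reducedResolv_pert_eigvec hN hk0 hμ hs] at h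
  rw [baseVec_eq]
  exact h

include hN hk0 hμ hs in
lemma hasDerivAt_gramEntry (i j : Fin 2) :
    HasDerivAt (gramEntry N k μ r i j) (gramSlope N k μ i j) 0 := by
  have h := (hasDerivAt_proj hN hk0 hμ hs j).inner ℂ (hasDerivAt_proj hN hk0 hμ hs i)
  rw [proj_zero_baseVec hN hk0 hμ hs, proj_zero_baseVec hN hk0 hμ hs] at h
  exact h.congr_of_eventuallyEq (Eventually.of_forall fun ε => gramEntry_eq hN hk0 hμ hs i j ε)

include hN hk0 hμ hs in
lemma applyOp_zero_baseVec (i : Fin 2) :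
    applyOp (opLk N k μ 0) (proj N k μ r 0 (baseVec N k μ i)) =
      lamPlus N k μ • baseVec N k μ i := by
  rw [proj_zero_baseVec hN hk0 hμ hs, applyOp, dif_pos (baseVec_mem_domain i),
    opLk_baseVec hN hk0 hμ]

include hN hk0 hμ hs in
-- In the product rule both corrections carry the factor λ⁺ and assemble to λ⁺ times the Gram slope;
-- the projected perturbation is what remains.
lemma hasDerivAt_actionEntry (i j : Fin 2) :
    HasDerivAt (actionEntry N k μ r i j) (lamPlus N k μ * gramSlope N k μ i j +
      inner ℂ (baseVec N k μ j) (proj N k μ r 0 (pert N k μ (baseVec N k μ i)))) 0 := by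
  have h1 := hasDerivAt_applyOp_rieszProj isBoundedPerturbation_opLk hs.1 hs.disjoint
    (baseVec_ne_zero hN hk0 i) (baseVec_mem_domain i) (opLk_baseVec hN hk0 hμ i)
  have h := (hasDerivAt_proj hN hk0 hμ hs j).inner ℂ h1
  rw [proj_zero_baseVec hN hk0 hμ hs] at h
  have e : applyOp (opLk N k μ 0) (rieszProj (opLk N k μ 0) (lamPlus N k μ) r (baseVec N k μ i)) =
      lamPlus N k μ • baseVec N k μ i := applyOp_zero_baseVec hN hk0 hμ hs i
  have e2 : reducedResolv hs.1 hs.disjoint (pert N k μ (baseVec N k μ i)) =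
      correction N k μ (baseSign i) (baseMode i) := by
    rw [baseVec_eq, reducedResolv_pert_eigvec hN hk0 hμ hs]
  rw [e, e2] at h
  refine (h.congr_of_eventuallyEq
    (Eventually.of_forall fun ε => actionEntry_eq hN hk0 hμ hs i j ε)).congr_deriv ?_
  rw [inner_Xk_add_right, inner_Xk_smul_right, inner_Xk_smul_right, gramSlope]
  simp only [proj]
  ring

include hN hk0 hμ hs in
lemma analyticAt_gramEntry {ε : ℝ}
    (hε : ε ∈ Ioo (-neumannRadius (pert N k μ) hs.disjoint)
      (neumannRadius (pert N k μ) hs.disjoint)) (i j : Fin 2) :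
    AnalyticAt ℝ (gramEntry N k μ r i j) ε := by
  have h := fun i => analyticAt_rieszProj_apply isBoundedPerturbation_opLk hs.1 hs.disjoint
    (baseVec N k μ i) hε
  exact (analyticAt_inner (h j) (h i)).congr
    (Eventually.of_forall fun ε => (gramEntry_eq hN hk0 hμ hs i j ε).symm)

include hN hk0 hμ hs in
lemma analyticAt_actionEntry {ε : ℝ}
    (hε : ε ∈ Ioo (-neumannRadius (pert N k μ) hs.disjoint)
      (neumannRadius (pert N k μ) hs.disjoint)) (i j : Fin 2) :
    AnalyticAt ℝ (actionEntry N k μ r i j) ε := by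
  have h1 := analyticAt_rieszProj_apply isBoundedPerturbation_opLk hs.1 hs.disjoint
    (baseVec N k μ j) hε
  have h2 := analyticAt_applyOp_rieszProj isBoundedPerturbation_opLk hs.1 hs.disjoint
    (baseVec N k μ i) hε
  exact (analyticAt_inner h1 h2).congr
    (Eventually.of_forall fun ε => (actionEntry_eq hN hk0 hμ hs i j ε).symm)

include hN hk0 hμ hs in
lemma gramEntry_zero (i j : Fin 2) :
    gramEntry N k μ r i j 0 = inner ℂ (baseVec N k μ j) (baseVec N k μ i) := by
  rw [gramEntry_eq hN hk0 hμ hs, proj_zero_baseVec hN hk0 hμ hs, proj_zero_baseVec hN hk0 hμ hs]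

include hN hk0 hμ hs in
lemma actionEntry_zero (i j : Fin 2) : actionEntry N k μ r i j 0 =
    lamPlus N k μ * inner ℂ (baseVec N k μ j) (baseVec N k μ i) := by
  rw [actionEntry_eq hN hk0 hμ hs, applyOp_zero_baseVec hN hk0 hμ hs,
    proj_zero_baseVec hN hk0 hμ hs, inner_Xk_smul_right]

end Fixed

/-! ### Explicit values of slopes and couplings -/

lemma im_lamPlus_mul (z : ℂ) : (lamPlus N k μ * z).im = freq N k μ 1 0 * z.re := by
  simp [lamPlus]

lemma gramSlope_self (hk0 : 0 < k 0) (i : Fin 2) : gramSlope N k μ i i = 0 := by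
  rw [gramSlope, baseVec_eq, inner_correction_self hk0, ← inner_Xk_conj_symm,
    inner_correction_self hk0, map_zero, add_zero]

lemma gramSlope_swap_re (i j : Fin 2) : (gramSlope N k μ i j).re = (gramSlope N k μ j i).re := by
  have h : gramSlope N k μ i j = (starRingEnd ℂ) (gramSlope N k μ j i) := by
    simp only [gramSlope, map_add, inner_Xk_conj_symm]
    ring
  rw [h, Complex.conj_re]

lemma inner_baseVec_of_ne (hk0 : 0 < k 0) {i j : Fin 2} (h : i ≠ j) :
    inner ℂ (baseVec N k μ i) (baseVec N k μ j) = 0 := by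
  rw [baseVec_eq, baseVec_eq, inner_eigvec hk0, if_neg]
  fin_cases i <;> fin_cases j <;> simp [baseMode] at h ⊢

lemma inner_baseVec_self (hk0 : 0 < k 0) (i : Fin 2) :
    inner ℂ (baseVec N k μ i) (baseVec N k μ i) =
      ((1 / 2 * (N ^ 2 + ‖vec (baseMode i • k) + μ‖ ^ 2) : ℝ) : ℂ) := by
  rw [baseVec_eq, inner_eigvec hk0, if_pos rfl, ← sq, baseSign_sq]
  congr 1
  ring

lemma vec_zero : vec 0 = 0 := by ext i; simp [vec]

/-- With K = |k|, p = |k + μ|, m = |μ|, the bracket in `pertCoef` is [(K - p)m + p² - K²]/(NKpm) =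
(p - K)(p + K - m)/(NKpm). The factor i k^⊥·μ makes its product with real numbers purely imaginary.
-/
lemma im_pertCoef_one_zero (hN : 0 < N) (hk0 : 0 < k 0)
    (hμ : μ ∈ resonantSet N k \ exceptionalSet N k) :
    (pertCoef N k μ (-1) 1 1 0 * ((1 / 2 * (N ^ 2 + ‖μ‖ ^ 2) : ℝ) : ℂ)).im =
      1 / 8 * inner ℝ (perp (vec k)) μ *
        ((‖vec k + μ‖ - ‖vec k‖) *
          (‖vec k + μ‖ + ‖vec k‖ - ‖μ‖) * (N ^ 2 + ‖μ‖ ^ 2)) /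
        (N * ‖vec k‖ * ‖μ‖ * ‖vec k + μ‖) := by
  have h0 := norm_line_ne_zero hN hk0 hμ 0
  have h1 := norm_line_ne_zero hN hk0 hμ 1
  have hk := (norm_vec_pos hk0).ne'
  simp only [zero_smul, vec_zero, zero_add, one_smul] at h0 h1
  simp only [pertCoef, shearConst, zero_smul, vec_zero, zero_add, one_smul, mul_assoc,
    ← Complex.ofReal_mul, Complex.I_mul_im, Complex.ofReal_re]
  field_simp
  ring

/-- In the same notation the bracket is [m² - K² - (K + m)p]/(NKpm) = -(K + m)(p + K - m)/(NKpm). -/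
lemma im_pertCoef_zero_one (hN : 0 < N) (hk0 : 0 < k 0)
    (hμ : μ ∈ resonantSet N k \ exceptionalSet N k) :
    (pertCoef N k μ 1 0 (-1) 1 * ((1 / 2 * (N ^ 2 + ‖vec k + μ‖ ^ 2) : ℝ) : ℂ)).im =
      -(1 / 8) * inner ℝ (perp (vec k)) μ *
        ((‖vec k‖ + ‖μ‖) *
          (‖vec k + μ‖ + ‖vec k‖ - ‖μ‖) *
          (‖vec k + μ‖ ^ 2 + N ^ 2)) /
        (N * ‖vec k‖ * ‖μ‖ * ‖vec k + μ‖) := by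
  have h0 := norm_line_ne_zero hN hk0 hμ 0
  have h1 := norm_line_ne_zero hN hk0 hμ 1
  have hk := (norm_vec_pos hk0).ne'
  simp only [zero_smul, vec_zero, zero_add, one_smul] at h0 h1
  simp only [pertCoef, shearConst, zero_smul, vec_zero, zero_add, one_smul, mul_assoc,
    ← Complex.ofReal_mul, Complex.I_mul_im, Complex.ofReal_re]
  field_simp
  ring

end InternalWave

end

theorem mainTheorem3 (N : ℝ) (hN : 0 < N) (k : Fin 2 → ℤ) (hk0 : 0 < k 0) (hk1 : 0 < k 1)
    (μ : EuclideanSpace ℝ (Fin 2))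
    (hμ : μ ∈ resonantSet N k \ exceptionalSet N k) :
    -- the two expressions of the frequency of the double eigenvalue
    freq N k μ 1 0 = freq N k μ (-1) 1 ∧
    -- separating circles exist
    (∃ r, Separates N k μ r) ∧
    ∃ γ₁ β₁ β₀ : ℝ,
      β₁ - γ₁ * freq N k μ 1 0 =
        1 / 8 * inner ℝ (perp (vec k)) μ *
          ((‖vec k + μ‖ - ‖vec k‖) *
            (‖vec k + μ‖ + ‖vec k‖ - ‖μ‖) * (N ^ 2 + ‖μ‖ ^ 2)) /
          (N * ‖vec k‖ * ‖μ‖ * ‖vec k + μ‖) ∧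
      β₀ - γ₁ * freq N k μ 1 0 =
        -(1 / 8) * inner ℝ (perp (vec k)) μ *
          ((‖vec k‖ + ‖μ‖) *
            (‖vec k + μ‖ + ‖vec k‖ - ‖μ‖) *
            (‖vec k + μ‖ ^ 2 + N ^ 2)) /
          (N * ‖vec k‖ * ‖μ‖ * ‖vec k + μ‖) ∧
      ∀ r, Separates N k μ r →
        ∃ ε₀ > 0, ∃ ι a : Fin 2 → Fin 2 → ℝ → ℝ,
          -- the spectral projectors and the entries are well defined for `|ε| < ε₀`
          (∀ ε ∈ Ioo (-ε₀) ε₀,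
            Disjoint (spec (opLk N k μ ε))
              (Metric.sphere (lamPlus N k μ) r) ∧
            CircleIntegrable (resolv (opLk N k μ ε))
              (lamPlus N k μ) r ∧
            ∀ f, proj N k μ r ε f ∈ (opLk N k μ ε).domain) ∧
          -- the entries are real, respectively purely imaginary, and analytic
          (∀ i j, ∀ ε ∈ Ioo (-ε₀) ε₀,
            gramEntry N k μ r i j ε = (ι i j ε : ℂ) ∧
            actionEntry N k μ r i j ε = Complex.I * (a i j ε : ℂ)) ∧
          (∀ i j, AnalyticOnNhd ℝ (ι i j) (Ioo (-ε₀) ε₀) ∧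
            AnalyticOnNhd ℝ (a i j) (Ioo (-ε₀) ε₀)) ∧
          (∀ ε ∈ Ioo (-ε₀) ε₀, ι 0 1 ε = ι 1 0 ε) ∧
          -- the values at `ε = 0`
          ι 1 1 0 = 1 / 2 * (N ^ 2 + ‖vec k + μ‖ ^ 2) ∧
          ι 0 0 0 = 1 / 2 * (N ^ 2 + ‖μ‖ ^ 2) ∧
          -- the expansions
          (fun ε => ι 1 1 ε - ι 1 1 0) =O[𝓝 0] (fun ε => ε ^ 2) ∧
          (fun ε => ι 1 0 ε - γ₁ * ε) =O[𝓝 0] (fun ε => ε ^ 2) ∧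
          (fun ε => ι 0 0 ε - ι 0 0 0) =O[𝓝 0] (fun ε => ε ^ 2) ∧
          (fun ε => a 1 1 ε - freq N k μ 1 0 * ι 1 1 0) =O[𝓝 0]
            (fun ε => ε ^ 2) ∧
          (fun ε => a 0 0 ε - freq N k μ 1 0 * ι 0 0 0) =O[𝓝 0]
            (fun ε => ε ^ 2) ∧
          (fun ε => a 1 0 ε - β₁ * ε) =O[𝓝 0] (fun ε => ε ^ 2) ∧
          (fun ε => a 0 1 ε - β₀ * ε) =O[𝓝 0] (fun ε => ε ^ 2) := by
  -- The numbers γ₁, β₁, β₀ are fixed before r. Both β's contain w times the same slope γ₁, because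
  -- the Gram slopes (1,0) and (0,1) have equal real parts; the remainders are the two couplings.
  refine ⟨freq_eq hk0 hμ, exists_separates hN hk0 hμ, (gramSlope N k μ 1 0).re,
    freq N k μ 1 0 * (gramSlope N k μ 1 0).re
      + (pertCoef N k μ (-1) 1 1 0 * ((1 / 2 * (N ^ 2 + ‖μ‖ ^ 2) : ℝ) : ℂ)).im,
    freq N k μ 1 0 * (gramSlope N k μ 1 0).re
      + (pertCoef N k μ 1 0 (-1) 1 * ((1 / 2 * (N ^ 2 + ‖vec k + μ‖ ^ 2) : ℝ) : ℂ)).im,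
    by rw [im_pertCoef_one_zero hN hk0 hμ]; ring,
    by rw [im_pertCoef_zero_one hN hk0 hμ]; ring, fun r hs => ?_⟩
  have hd := fun (ε : ℝ) (hε : ε ∈ Ioo (-neumannRadius (pert N k μ) hs.disjoint)
    (neumannRadius (pert N k μ) hs.disjoint)) =>
      disjoint_spec_of_mem isBoundedPerturbation_opLk hs.disjoint hε
  have h0mem := zero_mem_Ioo_neumannRadius hs.disjoint (pert N k μ)
  have hgram0 : ∀ i, (gramEntry N k μ r i i 0).re =
      1 / 2 * (N ^ 2 + ‖vec (baseMode i • k) + μ‖ ^ 2) := fun i => by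
    rw [gramEntry_zero hN hk0 hμ hs, inner_baseVec_self hk0, Complex.ofReal_re]
  have hgramne : ∀ i j, i ≠ j → (gramEntry N k μ r i j 0).re = 0 := fun i j hij => by
    rw [gramEntry_zero hN hk0 hμ hs, inner_baseVec_of_ne hk0 hij.symm, Complex.zero_re]
  have hact0 : ∀ i j, (actionEntry N k μ r i j 0).im =
      freq N k μ 1 0 * (gramEntry N k μ r i j 0).re := fun i j => by
    rw [actionEntry_zero hN hk0 hμ hs, im_lamPlus_mul, gramEntry_zero hN hk0 hμ hs]
  have hanι : ∀ i j, ∀ ε ∈ Ioo (-neumannRadius (pert N k μ) hs.disjoint)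
      (neumannRadius (pert N k μ) hs.disjoint),
      AnalyticAt ℝ (fun ε => (gramEntry N k μ r i j ε).re) ε := fun i j ε hε =>
    AnalyticAt.comp (g := Complex.reCLM) (Complex.reCLM.analyticAt _)
      (analyticAt_gramEntry hN hk0 hμ hs hε i j)
  have hana : ∀ i j, ∀ ε ∈ Ioo (-neumannRadius (pert N k μ) hs.disjoint)
      (neumannRadius (pert N k μ) hs.disjoint),
      AnalyticAt ℝ (fun ε => (actionEntry N k μ r i j ε).im) ε := fun i j ε hε =>
    AnalyticAt.comp (g := Complex.imCLM) (Complex.imCLM.analyticAt _)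
      (analyticAt_actionEntry hN hk0 hμ hs hε i j)
  have hOι : ∀ i j, (fun ε => (gramEntry N k μ r i j ε).re - (gramEntry N k μ r i j 0).re
      - (gramSlope N k μ i j).re * ε) =O[𝓝 0] fun ε => ε ^ 2 := fun i j =>
    isBigO_sub_sub_of_hasDerivAt (hanι i j 0 h0mem)
      (Complex.reCLM.hasFDerivAt.comp_hasDerivAt 0 (hasDerivAt_gramEntry hN hk0 hμ hs i j))
  have hOa : ∀ i j, (fun ε => (actionEntry N k μ r i j ε).im - (actionEntry N k μ r i j 0).im
      - (lamPlus N k μ * gramSlope N k μ i j +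
      inner ℂ (baseVec N k μ j) (proj N k μ r 0 (pert N k μ (baseVec N k μ i)))).im * ε)
        =O[𝓝 0] fun ε => ε ^ 2 := fun i j =>
    isBigO_sub_sub_of_hasDerivAt (hana i j 0 h0mem)
      (Complex.imCLM.hasFDerivAt.comp_hasDerivAt 0 (hasDerivAt_actionEntry hN hk0 hμ hs i j))
  have hP0 : proj N k μ r 0 (pert N k μ (baseVec N k μ 0)) =
      pertCoef N k μ 1 0 (-1) 1 • baseVec N k μ 1 := rieszProj_pert_eigvec_zero hN hk0 hμ hs
  have hP1 : proj N k μ r 0 (pert N k μ (baseVec N k μ 1)) =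
      pertCoef N k μ (-1) 1 1 0 • baseVec N k μ 0 := rieszProj_pert_eigvec_one hN hk0 hμ hs
  have hm0 : vec (baseMode 0 • k) + μ = μ := by simp [baseMode, vec_zero]
  have hm1 : vec (baseMode 1 • k) + μ = vec k + μ := by simp [baseMode]
  refine ⟨neumannRadius (pert N k μ) hs.disjoint, neumannRadius_pos _ _,
    fun i j ε => (gramEntry N k μ r i j ε).re, fun i j ε => (actionEntry N k μ r i j ε).im,
    fun ε hε => ⟨hd ε hε, circleIntegrable_resolv hs.1.le (hd ε hε),
      fun f => (rieszProj_mem_domain hs.1.le (hd ε hε) f).1⟩,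
    fun i j ε hε => ⟨gramEntry_eq_re hN hk0 hμ hs (hd ε hε) i j,
      actionEntry_eq_im hN hk0 hμ hs (hd ε hε) i j⟩,
    fun i j => ⟨hanι i j, hana i j⟩, fun ε _ => ?_, ?_, ?_, ?_, ?_, ?_, ?_, ?_, ?_, ?_⟩
  · simp only [gramEntry_eq hN hk0 hμ hs]
    exact inner_re_symm (𝕜 := ℂ) (E := Xk k) _ _
  · exact (hgram0 1).trans (by rw [hm1])
  · exact (hgram0 0).trans (by rw [hm0])
  · simpa [gramSlope_self hk0] using hOι 1 1
  · simpa [hgramne 1 0 (by decide)] using hOι 1 0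
  · simpa [gramSlope_self hk0] using hOι 0 0
  · have h := hOa 1 1
    rw [hP1, inner_Xk_smul_right, inner_baseVec_of_ne hk0 (by decide), gramSlope_self hk0,
      hact0] at h
    simpa only [mul_zero, zero_mul, add_zero, Complex.zero_im, sub_zero] using h
  · have h := hOa 0 0
    rw [hP0, inner_Xk_smul_right, inner_baseVec_of_ne hk0 (by decide), gramSlope_self hk0,
      hact0] at h
    simpa only [mul_zero, zero_mul, add_zero, Complex.zero_im, sub_zero] using h
  · have h := hOa 1 0
    rw [hP1, inner_Xk_smul_right, inner_baseVec_self hk0, hm0, hact0, hgramne 1 0 (by decide),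
      Complex.add_im, im_lamPlus_mul] at h
    simpa only [mul_zero, sub_zero] using h
  -- The slope (0,1) is replaced by (1,0), so that β₀ is expressed through γ₁.
  · have h := hOa 0 1
    rw [hP0, inner_Xk_smul_right, inner_baseVec_self hk0, hm1, hact0, hgramne 0 1 (by decide),
      Complex.add_im, im_lamPlus_mul, gramSlope_swap_re] at h
    simpa only [mul_zero, sub_zero] using h
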